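/- There are a random access machine program (unit cost, natural-number registers and arrays, arithmetic by addition and truncated subtraction) and a constant $C$ with the following property. Let $G=(V,E)$ be a finite simple undirected graph with $m$ edges and $n_0$ isolated vertices, let $d(v)\in\{0,1,2,\dots\}$ be a demand for each $v\in V$, and put $d^*=\max_{v\in V}d(v)$. Let $(T,\tau)$ be a branch decomposition of $G$, i.e. a tree $T$ whose non-leaf nodes all have degree $3$ (a single node counts as a leaf), with a bijection $\tau$ from $E$ onto the leaves of $T$. Let $b$ be its width, the maximum over the edges $f$ of $T$ of the number of vertices of $G$ incident both to an edge whose leaf lies in one component of $T-f$ and to an edge whose leaf lies in the other ($b=0$ if $T$ has no edge). A set $S\subseteq V$ is a $d$-multiple dominating set if $|N_G[v]\cap S|\ge d(v)$ for every $v\in V$, where $N_G[v]$ is the closed neighbourhood. Then, given $G$, $d$ and $(T,\tau)$, the program halts after at most $$C\cdot 2^{3b/2}\,(d^*+1)^{2b}\,(m+n_0)$$ steps; it outputs a $d$-multiple dominating set of minimum cardinality if there is one, and otherwise reports that there is none. In particular, for graphs without isolated vertices the running time is $O(2^{3b/2}(d^*+1)^{2b}m)$. -/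

import Mathlib

/-! ### Multiple domination -/

/-- The closed neighbourhood `N[v]` of a vertex. -/
def closedNbhd {V : Type*} (G : SimpleGraph V) (v : V) : Set V :=
  insert v (G.neighborSet v)

/-- `S` is a `d`-multiple dominating set: `|N[v] ∩ S| ≥ d v` for every vertex `v`. -/
def IsMultipleDominating {V : Type*} (G : SimpleGraph V) (d : V → ℕ) (S : Finset V) : Prop :=
  ∀ v : V, d v ≤ (closedNbhd G v ∩ (S : Set V)).ncard

/-- `S` is a `d`-multiple dominating set of minimum cardinality. -/
def IsMinimumMultipleDominating {V : Type*} (G : SimpleGraph V) (d : V → ℕ)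
    (S : Finset V) : Prop :=
  IsMultipleDominating G d S ∧ ∀ S' : Finset V, IsMultipleDominating G d S' → S.card ≤ S'.card

/-- The maximum demand. -/
def maxDemand {V : Type*} [Fintype V] (d : V → ℕ) : ℕ := Finset.univ.sup d

/-! ### Branch decompositions -/

/-- A leaf of a tree: a node of degree at most one.  (Degree zero occurs only in the one-node
tree, the tree of a branch decomposition of a graph with a single edge.) -/
def IsLeaf {N : Type*} (T : SimpleGraph N) (x : N) : Prop := (T.neighborSet x).encard ≤ 1

/-- A branch decomposition `(T, τ)` of `G`, with set of nodes `N`: a tree `T` all of whose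
non-leaf nodes have degree three, and a bijection `τ` from the edges of `G` onto the leaves. -/
structure BranchDecomposition {V : Type*} (G : SimpleGraph V) (N : Type*) where
  tree : SimpleGraph N
  isTree : tree.IsTree
  degree_eq_three : ∀ x : N, ¬ IsLeaf tree x → (tree.neighborSet x).encard = 3
  leafOf : G.edgeSet ≃ {x : N // IsLeaf tree x}

namespace BranchDecomposition

variable {V N : Type*} {G : SimpleGraph V}

/-- The order function: `v` belongs to it at `f` iff two edges of `G` incident to `v` have their
leaves in different components of the forest obtained from the tree by removing `f`. -/
def orderFun (B : BranchDecomposition G N) (f : Sym2 N) : Set V :=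
  {v | ∃ e e' : G.edgeSet, v ∈ (e : Sym2 V) ∧ v ∈ (e' : Sym2 V) ∧
    ¬ (B.tree.deleteEdges {f}).Reachable (B.leafOf e : N) (B.leafOf e' : N)}

/-- The width: the maximum of `|orderFun f|` over the edges `f` of the tree (zero if the tree has
no edge). -/
noncomputable def width (B : BranchDecomposition G N) : ℕ :=
  ⨆ f : B.tree.edgeSet, (B.orderFun f).ncard

end BranchDecomposition

/-- A list of the edges of a graph: each edge occurs exactly once, with its two ends written down
in either order. -/
structure EdgeList {V : Type*} (G : SimpleGraph V) (m : ℕ) where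
  edge : Fin m ≃ G.edgeSet
  fst : Fin m → V
  snd : Fin m → V
  edge_eq : ∀ i : Fin m, (edge i : Sym2 V) = s(fst i, snd i)

/-! ### Random access machines

Programs of a unit-cost random access machine on natural numbers.  The store consists of
registers and of arrays with random access; a program names its (finitely many) registers and
arrays by constants, only the index into an array may be computed.  Arithmetic is addition and
truncated subtraction only. -/

namespace RAM

/-- The store: `reg r` is the content of register `r`, and `arr a i` that of cell `i` of
array `a`. -/
structure Store where
  reg : ℕ → ℕ
  arr : ℕ → ℕ → ℕ

/-- Arithmetic terms. -/
inductive Term where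
  | const (k : ℕ)
  | reg (r : ℕ)
  | arr (a : ℕ) (index : Term)
  | add (x y : Term)
  | sub (x y : Term)

/-- The value of a term. -/
def Term.eval (s : Store) : Term → ℕ
  | .const k => k
  | .reg r => s.reg r
  | .arr a i => s.arr a (i.eval s)
  | .add x y => x.eval s + y.eval s
  | .sub x y => x.eval s - y.eval s

/-- The number of unit-cost operations for evaluating a term. -/
def Term.cost : Term → ℕ
  | .const _ => 1
  | .reg _ => 1
  | .arr _ i => i.cost + 1
  | .add x y => x.cost + y.cost + 1
  | .sub x y => x.cost + y.cost + 1

/-- Tests. -/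
inductive Test where
  | lt (x y : Term)
  | eq (x y : Term)

/-- The truth value of a test. -/
def Test.holds (s : Store) : Test → Prop
  | .lt x y => x.eval s < y.eval s
  | .eq x y => x.eval s = y.eval s

/-- The number of unit-cost operations for evaluating a test. -/
def Test.cost : Test → ℕ
  | .lt x y => x.cost + y.cost + 1
  | .eq x y => x.cost + y.cost + 1

/-- Programs. -/
inductive Prog where
  | skip
  | setReg (r : ℕ) (x : Term)
  | setArr (a : ℕ) (index x : Term)
  | seq (p q : Prog)
  | ite (c : Test) (p q : Prog)
  | loop (c : Test) (p : Prog)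

/-- Write a value into a register. -/
def Store.setReg (s : Store) (r v : ℕ) : Store :=
  { s with reg := Function.update s.reg r v }

/-- Write a value into an array cell. -/
def Store.setArr (s : Store) (a i v : ℕ) : Store :=
  { s with arr := Function.update s.arr a (Function.update (s.arr a) i v) }

/-- `Exec p s t s'`: started in the store `s`, the program `p` halts after exactly `t` steps in
the store `s'`.  Here `loop c p` repeats `p` as long as `c` holds. -/
inductive Exec : Prog → Store → ℕ → Store → Prop where
  | skip (s : Store) : Exec .skip s 1 s
  | setReg (s : Store) (r : ℕ) (x : Term) :
      Exec (.setReg r x) s (x.cost + 1) (s.setReg r (x.eval s))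
  | setArr (s : Store) (a : ℕ) (i x : Term) :
      Exec (.setArr a i x) s (i.cost + x.cost + 1) (s.setArr a (i.eval s) (x.eval s))
  | seq {p q : Prog} {s s₁ s₂ : Store} {t₁ t₂ : ℕ} :
      Exec p s t₁ s₁ → Exec q s₁ t₂ s₂ → Exec (.seq p q) s (t₁ + t₂) s₂
  | ite_true {c : Test} {p q : Prog} {s s₁ : Store} {t : ℕ} :
      c.holds s → Exec p s t s₁ → Exec (.ite c p q) s (c.cost + t) s₁
  | ite_false {c : Test} {p q : Prog} {s s₁ : Store} {t : ℕ} :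
      ¬ c.holds s → Exec q s t s₁ → Exec (.ite c p q) s (c.cost + t) s₁
  | loop_true {c : Test} {p : Prog} {s s₁ s₂ : Store} {t₁ t₂ : ℕ} :
      c.holds s → Exec p s t₁ s₁ → Exec (.loop c p) s₁ t₂ s₂ →
        Exec (.loop c p) s (c.cost + t₁ + t₂) s₂
  | loop_false {c : Test} {p : Prog} {s : Store} :
      ¬ c.holds s → Exec (.loop c p) s c.cost s

/-- A finite sequence as the content of an array, followed by zeros. -/
def arrayOf {k : ℕ} (f : Fin k → ℕ) (i : ℕ) : ℕ := if h : i < k then f ⟨i, h⟩ else 0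

end RAM

/-! ### Input and output -/

/-- The initial store for a graph on the vertices `0, …, n - 1` with demands `d`, given by a list
of its edges, together with a branch decomposition on the nodes `0, …, k - 1`, given by a list of
the edges of its tree and by the leaf assigned to each edge of the graph.
Registers: the numbers of vertices, edges, nodes and tree edges.
Arrays: the demands, the first ends and the second ends of the edges, the first ends and the
second ends of the tree edges, and the leaves of the edges.
Everything else is zero. -/
def inputStore {n m k l : ℕ} {G : SimpleGraph (Fin n)} (d : Fin n → ℕ) (E : EdgeList G m)
    (B : BranchDecomposition G (Fin k)) (F : EdgeList B.tree l) : RAM.Store where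
  reg
    | 0 => n
    | 1 => m
    | 2 => k
    | 3 => l
    | _ => 0
  arr
    | 0 => RAM.arrayOf d
    | 1 => RAM.arrayOf fun i : Fin m => (E.fst i : ℕ)
    | 2 => RAM.arrayOf fun i : Fin m => (E.snd i : ℕ)
    | 3 => RAM.arrayOf fun i : Fin l => (F.fst i : ℕ)
    | 4 => RAM.arrayOf fun i : Fin l => (F.snd i : ℕ)
    | 5 => RAM.arrayOf fun i : Fin m => ((B.leafOf (E.edge i) : Fin k) : ℕ)
    | _ => fun _ => 0

/-- The set of vertices whose cell in array `0` holds `1`. -/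
def outputSet (n : ℕ) (s : RAM.Store) : Finset (Fin n) :=
  Finset.univ.filter fun v : Fin n => s.arr 0 v = 1

/-- A correct answer: register `0` holds `1` and the output set is a minimum `d`-multiple
dominating set, or register `0` holds `0` and there is no `d`-multiple dominating set. -/
def IsCorrectAnswer {n : ℕ} (G : SimpleGraph (Fin n)) (d : Fin n → ℕ) (s : RAM.Store) : Prop :=
  (s.reg 0 = 1 ∧ IsMinimumMultipleDominating G d (outputSet n s)) ∨
    (s.reg 0 = 0 ∧ ∀ S : Finset (Fin n), ¬ IsMultipleDominating G d S)

/-! ### A cost calculus for programs. -/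

namespace RAM

/-! The algorithm is dynamic programming over the tree, organised as a contraction of leaves. Each
surviving node owns the graph edges whose leaves have been merged into it (`part`), a vertex list
containing the boundary of this part, and a table. A state gives every listed vertex a selection bit
`σ` and a number `c` of selected neighbours demanded along edges of the part. The cell of a state
holds `0` if no partial solution fits, and otherwise one more than the least number of selected
forgotten vertices, i.e. vertices of the part that are no longer listed. To join two disjoint parts,
one chooses at every vertex of the merged list a bit `σ` and the shares `i`, `j` of the two parts. A
vertex all of whose edges are now present is forgotten and must satisfy `d v ≤ σ + i + j`; any other
vertex passes on `i + j`, at most the maximum demand. `TableFor.join` proves this recurrence without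
reference to the machine.

The exponents come from `Inst.joinCost_le`. Let `A` and `B` be the parts to be joined. Apart from a
few vertices of degree one, every vertex of the merged list lies in at least two of the boundaries
of `A`, `B` and `A ∪ B`. Each has at most `b` vertices, so the list has at most `3b/2`, and the
selection bits give `2 ^ (3b/2)`. A factor `d* + 1` arises once for each vertex in the boundary of
`A` and once for each in that of `B`, hence `(d* + 1) ^ (2b)`. Boundaries stay below the width by
`BranchDecomposition.boundary_le_width`: up to one non-leaf node, which carries no graph edge, the
nodes merged into one node are cut off by at most one tree edge.

The choices are enumerated vertex by vertex in a queue. An entry stores the cell numbers reached so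
far, which are continued by adding strides, so that no multiplication is needed. There are at least
two choices per vertex, so the bounds for the levels grow geometrically and the last one dominates
(`sum_prod_take_le`). Tables are placed in fresh zero memory and never cleared, so only the choices
cost time, not the table size. The queue is kept, and every cell remembers the entry that gave its
value; a stack machine reads a solution back from this (`Rec`, `popLoop_spec`).

The tree has fewer than `3m` nodes (`BranchDecomposition.card_nodes_le`), so there are `O(m)` joins,
organised by `contractLoop_spec`. A demand above the degree plus one is rejected at once; otherwise
the maximum demand is `O(m)` and may be spent on preparations. Isolated vertices have no part in the
tables; those with demand one belong to every solution (`isMinimum_of_table`). -/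

instance : Add Term := ⟨Term.add⟩
instance : Sub Term := ⟨Term.sub⟩
notation "κ" => Term.const

infixr:50 " ;; " => Prog.seq
infix:60 " ≔ " => Prog.setReg

@[simp] theorem Term.cost_add (x y : Term) : (x + y).cost = x.cost + y.cost + 1 := rfl
@[simp] theorem Term.cost_sub (x y : Term) : (x - y).cost = x.cost + y.cost + 1 := rfl
@[simp] theorem Term.eval_add (s : Store) (x y : Term) : (x + y).eval s = x.eval s + y.eval s := rfl
@[simp] theorem Term.eval_sub (s : Store) (x y : Term) : (x - y).eval s = x.eval s - y.eval s := rfl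
@[simp] theorem Term.eval_const (s : Store) (k : ℕ) : (Term.const k).eval s = k := rfl
@[simp] theorem Term.eval_reg (s : Store) (r : ℕ) : (Term.reg r).eval s = s.reg r := rfl
@[simp] theorem Term.eval_arr (s : Store) (a : ℕ) (i : Term) :
    (Term.arr a i).eval s = s.arr a (i.eval s) := rfl
@[simp] theorem Test.holds_lt (s : Store) (x y : Term) :
    (Test.lt x y).holds s ↔ x.eval s < y.eval s := Iff.rfl
@[simp] theorem Test.holds_eq (s : Store) (x y : Term) :
    (Test.eq x y).holds s ↔ x.eval s = y.eval s := Iff.rfl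

@[simp] theorem Store.setReg_reg (s : Store) (r v r' : ℕ) :
    (s.setReg r v).reg r' = if r' = r then v else s.reg r' := by
  simp [Store.setReg, Function.update_apply]
@[simp] theorem Store.setReg_arr (s : Store) (r v : ℕ) : (s.setReg r v).arr = s.arr := rfl
@[simp] theorem Store.setArr_reg (s : Store) (a i v : ℕ) : (s.setArr a i v).reg = s.reg := rfl
theorem Store.setArr_arr (s : Store) (a i v a' : ℕ) :
    (s.setArr a i v).arr a' = if a' = a then Function.update (s.arr a) i v else s.arr a' := by
  simp [Store.setArr, Function.update_apply]
@[simp] theorem Store.setArr_arr_apply (s : Store) (a i v a' j : ℕ) :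
    (s.setArr a i v).arr a' j = if a' = a then if j = i then v else s.arr a j else s.arr a' j := by
  rw [Store.setArr_arr]; split_ifs <;> simp_all

instance (c : Test) (s : Store) : Decidable (c.holds s) := by
  cases c <;> (simp only [Test.holds]; infer_instance)

namespace Prog

/-- The registers a program may write. -/
def regs : Prog → List ℕ
  | skip => []
  | setReg r _ => [r]
  | setArr _ _ _ => []
  | seq p q => p.regs ++ q.regs
  | ite _ p q => p.regs ++ q.regs
  | loop _ p => p.regs

/-- The arrays a program may write. -/
def arrs : Prog → List ℕ
  | skip => []
  | setReg _ _ => []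
  | setArr a _ _ => [a]
  | seq p q => p.arrs ++ q.arrs
  | ite _ p q => p.arrs ++ q.arrs
  | loop _ p => p.arrs

/-- A program without loops. -/
def flat : Prog → Bool
  | skip => true
  | setReg _ _ => true
  | setArr _ _ _ => true
  | seq p q => p.flat && q.flat
  | ite _ p q => p.flat && q.flat
  | loop _ _ => false

/-- The effect of a loop-free program. -/
def run : Prog → Store → Store
  | skip, s => s
  | setReg r x, s => s.setReg r (x.eval s)
  | setArr a i x, s => s.setArr a (i.eval s) (x.eval s)
  | seq p q, s => q.run (p.run s)
  | ite c p q, s => if c.holds s then p.run s else q.run s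
  -- A default value: `run` is tied to execution for loop-free programs only.
  | loop _ _, s => s

/-- A bound for the running time of a loop-free program. -/
def bound : Prog → ℕ
  | skip => 1
  | setReg _ x => x.cost + 1
  | setArr _ i x => i.cost + x.cost + 1
  | seq p q => p.bound + q.bound
  | ite c p q => c.cost + (p.bound + q.bound)
  | loop _ _ => 0

end Prog

/-- Two stores agree outside the registers and arrays which `p` may write. -/
structure Frame (p : Prog) (s s' : Store) : Prop where
  reg : ∀ r, r ∉ p.regs → s'.reg r = s.reg r
  arr : ∀ a, a ∉ p.arrs → s'.arr a = s.arr a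

theorem Frame.refl (p : Prog) (s : Store) : Frame p s s := ⟨fun _ _ => rfl, fun _ _ => rfl⟩

theorem Frame.trans {p : Prog} {s s' s'' : Store} (h : Frame p s s') (h' : Frame p s' s'') :
    Frame p s s'' :=
  ⟨fun r hr => (h'.reg r hr).trans (h.reg r hr), fun a ha => (h'.arr a ha).trans (h.arr a ha)⟩

/-- All programs share one global store, so every specification needs to know what survives. The
written names are read off the syntax, which lets `decide` settle later questions of survival. -/
theorem Exec.frame {p : Prog} {s s' : Store} {t : ℕ} (h : Exec p s t s') : Frame p s s' := by
  induction h with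
  | skip s => exact Frame.refl _ _
  | setReg s r x =>
    refine ⟨fun r' hr => ?_, fun _ _ => rfl⟩
    simp [Prog.regs] at hr; simp [hr]
  | setArr s a i x =>
    refine ⟨fun _ _ => rfl, fun a' ha => ?_⟩
    simp [Prog.arrs] at ha; simp [Store.setArr_arr, ha]
  | seq _ _ ih1 ih2 =>
    refine ⟨fun r hr => ?_, fun r hr => ?_⟩
    · simp [Prog.regs] at hr; rw [ih2.reg _ hr.2, ih1.reg _ hr.1]
    · simp [Prog.arrs] at hr; rw [ih2.arr _ hr.2, ih1.arr _ hr.1]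
  | ite_true _ _ ih =>
    refine ⟨fun r hr => ?_, fun r hr => ?_⟩
    · simp [Prog.regs] at hr; rw [ih.reg _ hr.1]
    · simp [Prog.arrs] at hr; rw [ih.arr _ hr.1]
  | ite_false _ _ ih =>
    refine ⟨fun r hr => ?_, fun r hr => ?_⟩
    · simp [Prog.regs] at hr; rw [ih.reg _ hr.2]
    · simp [Prog.arrs] at hr; rw [ih.arr _ hr.2]
  | loop_true _ _ _ ih1 ih2 =>
    exact ⟨fun r hr => (ih2.reg r hr).trans (ih1.reg r hr),
      fun r hr => (ih2.arr r hr).trans (ih1.arr r hr)⟩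
  | loop_false _ => exact Frame.refl _ _

/-- `p`, started in `s`, halts after at most `B` steps in a store satisfying `Q`. -/
def Runs (p : Prog) (s : Store) (B : ℕ) (Q : Store → Prop) : Prop :=
  ∃ t s', Exec p s t s' ∧ t ≤ B ∧ Q s'

namespace Runs

theorem mono {p : Prog} {s : Store} {B B' : ℕ} {Q Q' : Store → Prop} (h : Runs p s B Q)
    (hB : B ≤ B') (hQ : ∀ s', Frame p s s' → Q s' → Q' s') : Runs p s B' Q' := by
  obtain ⟨t, s', he, ht, hq⟩ := h
  exact ⟨t, s', he, ht.trans hB, hQ _ he.frame hq⟩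

theorem seq {p q : Prog} {s : Store} {B₁ B₂ : ℕ} {R Q : Store → Prop} (h : Runs p s B₁ R)
    (h' : ∀ s₁, Frame p s s₁ → R s₁ → Runs q s₁ B₂ Q) : Runs (p ;; q) s (B₁ + B₂) Q := by
  obtain ⟨t, s', he, ht, hq⟩ := h
  obtain ⟨t', s'', he', ht', hq'⟩ := h' s' he.frame hq
  exact ⟨_, _, he.seq he', by omega, hq'⟩

/-- Loop-free code can be evaluated symbolically, so its specifications reduce to `simp` on `run`.
Charging both branches of a conditional makes the bound a constant of the program. -/
theorem ofFlat (p : Prog) (s : Store) (h : p.flat = true) :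
    Runs p s p.bound (fun s' => s' = p.run s) := by
  induction p generalizing s with
  | skip => exact ⟨_, _, .skip s, le_rfl, rfl⟩
  | setReg r x => exact ⟨_, _, .setReg s r x, le_rfl, rfl⟩
  | setArr a i x => exact ⟨_, _, .setArr s a i x, le_rfl, rfl⟩
  | seq p q ihp ihq =>
    simp [Prog.flat] at h
    refine (ihp s h.1).seq (fun s₁ _ h₁ => ?_)
    subst h₁; exact ihq _ h.2
  | ite c p q ihp ihq =>
    simp [Prog.flat] at h
    by_cases hc : c.holds s
    · obtain ⟨t, s', he, ht, hq⟩ := ihp s h.1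
      exact ⟨_, _, .ite_true hc he, by simp [Prog.bound]; omega, by simp [Prog.run, hc, hq]⟩
    · obtain ⟨t, s', he, ht, hq⟩ := ihq s h.2
      exact ⟨_, _, .ite_false hc he, by simp [Prog.bound]; omega, by simp [Prog.run, hc, hq]⟩
  | loop c p _ => simp [Prog.flat] at h

theorem flat {p : Prog} {s : Store} {B : ℕ} {Q : Store → Prop} (h : p.flat = true)
    (hB : p.bound ≤ B) (hQ : Q (p.run s)) : Runs p s B Q :=
  (ofFlat p s h).mono hB (fun _ _ h => h ▸ hQ)

theorem flat_seq {p q : Prog} {s : Store} {B : ℕ} {Q : Store → Prop} (h : p.flat = true)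
    (h' : Runs q (p.run s) B Q) : Runs (p ;; q) s (p.bound + B) Q :=
  (ofFlat p s h).seq (fun _ _ h => h ▸ h')

theorem ite {c : Test} {p q : Prog} {s : Store} {B : ℕ} {Q : Store → Prop}
    (h : c.holds s → Runs p s B Q) (h' : ¬ c.holds s → Runs q s B Q) :
    Runs (.ite c p q) s (c.cost + B) Q := by
  by_cases hc : c.holds s
  · obtain ⟨t, s', he, ht, hq⟩ := h hc
    exact ⟨_, _, .ite_true hc he, by omega, hq⟩
  · obtain ⟨t, s', he, ht, hq⟩ := h' hc
    exact ⟨_, _, .ite_false hc he, by omega, hq⟩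

/-- A loop with `N` rounds, the `j`-th of which takes `T j` steps. -/
theorem loop_sum {c : Test} {p : Prog} {s₀ : Store} (N : ℕ) (I : ℕ → Store → Prop) (T : ℕ → ℕ)
    (h0 : I 0 s₀)
    (hstep : ∀ j < N, ∀ s, Frame p s₀ s → I j s → c.holds s ∧ Runs p s (T j) (I (j + 1)))
    (hend : ∀ s, Frame p s₀ s → I N s → ¬ c.holds s) :
    Runs (.loop c p) s₀ (∑ j ∈ Finset.range N, (c.cost + T j) + c.cost)
      (fun s' => I N s' ∧ Frame p s₀ s') := by
  -- The induction is on the number of rounds still to come, because `Exec` unfolds a loop at its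
  -- front; the reversed sum is reflected at the end.
  suffices H : ∀ i ≤ N, ∀ s, Frame p s₀ s → I (N - i) s →
      Runs (.loop c p) s (∑ j ∈ Finset.range i, (c.cost + T (N - 1 - j)) + c.cost)
        (fun s' => I N s' ∧ Frame p s₀ s') by
    have := H N le_rfl s₀ (Frame.refl _ _) (by simpa using h0)
    rwa [Finset.sum_range_reflect (fun j => c.cost + T j) N] at this
  intro i
  induction i with
  | zero =>
    intro _ s hf hI
    exact ⟨_, _, .loop_false (hend s hf hI), by simp, hI, hf⟩
  | succ i ih =>
    intro hi s hf hI
    obtain ⟨hc, t, s', he, ht, hI'⟩ := hstep _ (by omega) s hf hI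
    obtain ⟨t', s'', he', ht', hq⟩ := ih (by omega) s' (hf.trans he.frame)
      (by convert hI' using 1; omega)
    refine ⟨_, _, .loop_true hc he he', ?_, hq⟩
    rw [Finset.sum_range_succ]
    have : N - 1 - i = N - (i + 1) := by omega
    rw [this]; omega

/-- A loop with `N` rounds, each of which takes `T` steps. -/
theorem loop_const {c : Test} {p : Prog} {s₀ : Store} (N : ℕ) (I : ℕ → Store → Prop) (T : ℕ)
    (h0 : I 0 s₀)
    (hstep : ∀ j < N, ∀ s, Frame p s₀ s → I j s → c.holds s ∧ Runs p s T (I (j + 1)))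
    (hend : ∀ s, Frame p s₀ s → I N s → ¬ c.holds s) :
    Runs (.loop c p) s₀ (N * (c.cost + T) + c.cost) (fun s' => I N s' ∧ Frame p s₀ s') := by
  have := loop_sum N I (fun _ => T) h0 hstep hend
  simpa using this

/-- A loop whose running time is paid for by a potential. -/
theorem loop_potential {c : Test} {p : Prog} (I : ℕ → Store → Prop)
    (hstep : ∀ φ s, I φ s → c.holds s → ∃ φ' B, c.cost + B + φ' ≤ φ ∧ Runs p s B (I φ'))
    (φ : ℕ) (s : Store) (h : I φ s) :
    Runs (.loop c p) s (φ + c.cost) (fun s' => (∃ φ', I φ' s') ∧ ¬ c.holds s') := by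
  -- A test is never free, so the potential falls strictly in every round and strong induction
  -- applies.
  have hpos : 1 ≤ c.cost := by cases c <;> simp [Test.cost]
  induction φ using Nat.strong_induction_on generalizing s with
  | _ φ ih =>
    by_cases hc : c.holds s
    · obtain ⟨φ', B, hB, t, s', he, ht, hI⟩ := hstep φ s h hc
      obtain ⟨t', s'', he', ht', hq⟩ := ih φ' (by omega) s' hI
      exact ⟨_, _, .loop_true hc he he', by omega, hq⟩
    · exact ⟨_, _, .loop_false hc, by omega, ⟨φ, h⟩, hc⟩

end Runs
end RAM

/-! ### Partial solutions and their tables -/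

section Tables

/-- The sum of `g` over the neighbours of `v` along the edges with indices in `P`. -/
def nbSum (eu ev : ℕ → ℕ) (P : Finset ℕ) (g : ℕ → ℕ) (v : ℕ) : ℕ :=
  ∑ i ∈ P, ((if eu i = v then g (ev i) else 0) + (if ev i = v then g (eu i) else 0))

/-- The number of edges at `v` with indices in `P`. -/
def incCount (eu ev : ℕ → ℕ) (P : Finset ℕ) (v : ℕ) : ℕ := nbSum eu ev P (fun _ => 1) v

/-- The vertices outside `L` which are incident to an edge with index in `P`. -/
def forgotten (eu ev : ℕ → ℕ) (P : Finset ℕ) (L : List ℕ) : Finset ℕ :=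
  (P.image eu ∪ P.image ev).filter (· ∉ L)

/-- The characteristic function of a finite set. -/
def ind (S : Finset ℕ) (v : ℕ) : ℕ := if v ∈ S then 1 else 0

variable {eu ev : ℕ → ℕ} {P P' : Finset ℕ} {g g' : ℕ → ℕ} {v : ℕ} {L : List ℕ}

theorem nbSum_union (h : Disjoint P P') :
    nbSum eu ev (P ∪ P') g v = nbSum eu ev P g v + nbSum eu ev P' g v :=
  Finset.sum_union h

theorem nbSum_mono (h : P ⊆ P') : nbSum eu ev P g v ≤ nbSum eu ev P' g v :=
  Finset.sum_le_sum_of_subset h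

theorem incCount_pos : 0 < incCount eu ev P v ↔ v ∈ P.image eu ∪ P.image ev := by
  rw [Nat.pos_iff_ne_zero, Ne, incCount, nbSum, Finset.sum_eq_zero_iff]
  simp only [Finset.mem_union, Finset.mem_image]
  constructor
  · intro h
    by_contra! h'
    refine h fun i hi => ?_
    simp [h'.1 i hi, h'.2 i hi]
  · rintro (⟨i, hi, rfl⟩ | ⟨i, hi, rfl⟩) h <;> simpa using h i hi

theorem mem_forgotten : v ∈ forgotten eu ev P L ↔ 0 < incCount eu ev P v ∧ v ∉ L := by
  rw [forgotten, Finset.mem_filter, incCount_pos]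

theorem nbSum_congr (h : ∀ w, 0 < incCount eu ev P w → g w = g' w) :
    nbSum eu ev P g v = nbSum eu ev P g' v := by
  refine Finset.sum_congr rfl fun i hi => ?_
  rw [h _ (incCount_pos.2 (Finset.mem_union_left _ (Finset.mem_image_of_mem _ hi))),
    h _ (incCount_pos.2 (Finset.mem_union_right _ (Finset.mem_image_of_mem _ hi)))]

theorem nbSum_le_incCount (h : ∀ w, g w ≤ 1) : nbSum eu ev P g v ≤ incCount eu ev P v := by
  refine Finset.sum_le_sum fun i _ => ?_
  have h1 := h (ev i); have h2 := h (eu i)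
  dsimp only
  split_ifs <;> omega

/-- The stride of `v` in the table over the vertex list `L`. -/
def stride (M : ℕ) (L : List ℕ) (v : ℕ) : ℕ := if v ∈ L then (2 * M) ^ L.idxOf v else 0

/-- The cell of the state `(σ, c)` in the table over `L` which begins at cell `b`. -/
def cellAt (M b : ℕ) (L : List ℕ) (σ c : ℕ → ℕ) : ℕ :=
  b + ∑ v ∈ L.toFinset, (σ v * M + c v) * stride M L v

theorem cellAt_congr {M b : ℕ} {σ c σ' c' : ℕ → ℕ} (h : ∀ v ∈ L, σ v = σ' v ∧ c v = c' v) :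
    cellAt M b L σ c = cellAt M b L σ' c' := by
  rw [cellAt, cellAt]
  congr 1
  refine Finset.sum_congr rfl fun v hv => ?_
  rw [List.mem_toFinset] at hv
  rw [(h v hv).1, (h v hv).2]

theorem cellAt_nil {M b : ℕ} {σ c : ℕ → ℕ} : cellAt M b [] σ c = b := by simp [cellAt]

theorem cellAt_append {M b : ℕ} {σ c : ℕ → ℕ} (hv : v ∉ L) :
    cellAt M b (L ++ [v]) σ c = cellAt M b L σ c + (σ v * M + c v) * (2 * M) ^ L.length := by
  have h1 : (L ++ [v]).toFinset = insert v L.toFinset := by ext; simp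
  rw [cellAt, cellAt, h1, Finset.sum_insert (by simpa using hv)]
  have h2 : stride M (L ++ [v]) v = (2 * M) ^ L.length := by
    simp [stride, List.idxOf_append_of_notMem hv]
  rw [h2, add_assoc, add_comm (_ * _)]
  congr 2
  refine Finset.sum_congr rfl fun w hw => ?_
  rw [List.mem_toFinset] at hw
  simp [stride, hw, List.idxOf_append_of_mem hw]

/-- Each vertex contributes one digit `σ v * M + c v`, which is below `2 * M`; a table over `L`
therefore fits into `(2 * M) ^ L.length` cells. -/
theorem cellAt_lt {M b : ℕ} {σ c : ℕ → ℕ} (hL : L.Nodup) (hσ : ∀ v ∈ L, σ v ≤ 1)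
    (hc : ∀ v ∈ L, c v < M) : cellAt M b L σ c < b + (2 * M) ^ L.length := by
  induction L using List.reverseRecOn with
  | nil => simp [cellAt_nil]
  | append_singleton L v ih =>
    rw [List.nodup_append] at hL
    have hv : v ∉ L := fun h => hL.2.2 v h v (by simp) rfl
    have := ih hL.1 (fun w hw => hσ w (by simp [hw])) (fun w hw => hc w (by simp [hw]))
    have h1 := hσ v (by simp)
    have h2 := hc v (by simp)
    rw [cellAt_append hv]
    have h3 : σ v * M + c v + 1 ≤ 2 * M := by nlinarith
    have h4 := Nat.mul_le_mul_right ((2 * M) ^ L.length) h3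
    rw [List.length_append, List.length_singleton, pow_succ, mul_comm _ (2 * M)]
    linarith

/-- Uniqueness of the expansion to base `2 * M`: the leading digit is split off modulo `(2 * M) ^
L.length`, and `c` is then separated from `σ` modulo `M`. The states behind two descriptions of one
cell can thus be identified. -/
theorem cellAt_inj {M b : ℕ} {σ c σ' c' : ℕ → ℕ} (hM : 0 < M) (hL : L.Nodup)
    (hσ : ∀ v ∈ L, σ v ≤ 1) (hc : ∀ v ∈ L, c v < M)
    (hσ' : ∀ v ∈ L, σ' v ≤ 1) (hc' : ∀ v ∈ L, c' v < M)
    (h : cellAt M b L σ c = cellAt M b L σ' c') : ∀ v ∈ L, σ v = σ' v ∧ c v = c' v := by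
  induction L using List.reverseRecOn with
  | nil => simp
  | append_singleton L v ih =>
    rw [List.nodup_append] at hL
    have hv : v ∉ L := fun h => hL.2.2 v h v (by simp) rfl
    have m1 : ∀ w ∈ L, w ∈ L ++ [v] := fun w hw => by simp [hw]
    have m2 : v ∈ L ++ [v] := by simp
    have l1 := cellAt_lt (b := b) hL.1 (fun w hw => hσ w (m1 w hw)) (fun w hw => hc w (m1 w hw))
    have l2 := cellAt_lt (b := b) hL.1 (fun w hw => hσ' w (m1 w hw))
      (fun w hw => hc' w (m1 w hw))
    rw [cellAt_append hv, cellAt_append hv] at h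
    have g1 : b ≤ cellAt M b L σ c := Nat.le_add_right _ _
    have g2 : b ≤ cellAt M b L σ' c' := Nat.le_add_right _ _
    obtain ⟨x, hx⟩ := Nat.exists_eq_add_of_le g1
    obtain ⟨y, hy⟩ := Nat.exists_eq_add_of_le g2
    rw [hx, hy] at h
    rw [hx] at l1; rw [hy] at l2
    have l1' : x < (2 * M) ^ L.length := by omega
    have l2' : y < (2 * M) ^ L.length := by omega
    set K := (2 * M) ^ L.length
    have e : x + K * (σ v * M + c v) = y + K * (σ' v * M + c' v) := by
      rw [mul_comm K, mul_comm K]; omega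
    have e1 : x = y := by
      have := congrArg (· % K) e
      simpa [Nat.add_mul_mod_self_left, Nat.mod_eq_of_lt l1', Nat.mod_eq_of_lt l2'] using this
    have e2 : σ v * M + c v = σ' v * M + c' v := by
      rw [e1] at e
      exact Nat.eq_of_mul_eq_mul_left (by omega) (Nat.add_left_cancel e)
    have e3 : c v = c' v := by
      have := congrArg (· % M) e2
      simpa [mul_comm _ M, Nat.mul_add_mod, Nat.mod_eq_of_lt (hc v m2),
        Nat.mod_eq_of_lt (hc' v m2)] using this
    have e4 : σ v = σ' v := by
      rw [e3] at e2
      exact Nat.eq_of_mul_eq_mul_right hM (Nat.add_right_cancel e2)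
    intro w hw
    rw [List.mem_append, List.mem_singleton] at hw
    rcases hw with hw | rfl
    · exact ih hL.1 (fun w hw => hσ w (m1 w hw)) (fun w hw => hc w (m1 w hw))
        (fun w hw => hσ' w (m1 w hw)) (fun w hw => hc' w (m1 w hw)) (by omega) w hw
    · exact ⟨e4, e3⟩

/-- `g` is (the characteristic function of) a partial solution for the edges in `P` which gives
at least `c v` neighbours to every `v` in `L` and satisfies the forgotten vertices. -/
def Feasible (eu ev d : ℕ → ℕ) (P : Finset ℕ) (L : List ℕ) (g c : ℕ → ℕ) : Prop :=
  (∀ v ∈ L, c v ≤ nbSum eu ev P g v) ∧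
    ∀ v ∉ L, 0 < incCount eu ev P v → d v ≤ g v + nbSum eu ev P g v

/-- The vertex list of a part lists its boundary. -/
structure BoundaryList (eu ev : ℕ → ℕ) (m : ℕ) (P : Finset ℕ) (L : List ℕ) : Prop where
  sub : P ⊆ Finset.range m
  nodup : L.Nodup
  pos : ∀ v ∈ L, 0 < incCount eu ev P v
  cover : ∀ v ∉ L, 0 < incCount eu ev P v →
    incCount eu ev P v = incCount eu ev (Finset.range m) v

/-- The table which begins at cell `b` is correct for the part `P` with vertex list `L`;
`Rec q S z` means that the solution `S` can be recovered from cell `q` at cost `z`. -/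
structure TableFor (eu ev d : ℕ → ℕ) (M ds : ℕ) (P : Finset ℕ) (L : List ℕ)
    (b : ℕ) (val : ℕ → ℕ) (Rec : ℕ → Finset ℕ → ℕ → Prop) (Z : ℕ) : Prop where
  sound : ∀ σ c : ℕ → ℕ, (∀ v ∈ L, σ v ≤ 1) → (∀ v ∈ L, c v ≤ ds ∧ c v ≤ incCount eu ev P v) →
    val (cellAt M b L σ c) ≠ 0 → ∃ S z, Rec (cellAt M b L σ c) S z ∧ z ≤ Z ∧
      val (cellAt M b L σ c) = S.card + 1 ∧ S ⊆ forgotten eu ev P L ∧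
      Feasible eu ev d P L (fun v => if v ∈ L then σ v else ind S v) c
  complete : ∀ g c : ℕ → ℕ, (∀ v, g v ≤ 1) → (∀ v, c v ≤ ds) → Feasible eu ev d P L g c →
    val (cellAt M b L g c) ≠ 0 ∧ val (cellAt M b L g c) ≤ ∑ v ∈ forgotten eu ev P L, g v + 1

/-- The admissible choices at a vertex when two parts are joined. -/
def Choice (eu ev d : ℕ → ℕ) (m ds : ℕ) (P P' : Finset ℕ) (v s i j : ℕ) : Prop :=
  s ≤ 1 ∧ (i ≤ ds ∧ i ≤ incCount eu ev P v) ∧ (j ≤ ds ∧ j ≤ incCount eu ev P' v) ∧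
    if incCount eu ev P v + incCount eu ev P' v = incCount eu ev (Finset.range m) v
    then d v ≤ s + i + j else i + j ≤ ds

/-- The vertices of `X` which remain in the boundary when two parts are joined. -/
def keep (eu ev : ℕ → ℕ) (m : ℕ) (P P' : Finset ℕ) (X : List ℕ) : List ℕ :=
  X.filter fun v => incCount eu ev P v + incCount eu ev P' v ≠ incCount eu ev (Finset.range m) v

/-- The selected vertices of `X` which are forgotten when two parts are joined. -/
def marks (eu ev : ℕ → ℕ) (m : ℕ) (P P' : Finset ℕ) (X : List ℕ) (σ : ℕ → ℕ) : Finset ℕ :=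
  X.toFinset.filter fun v => incCount eu ev P v + incCount eu ev P' v =
    incCount eu ev (Finset.range m) v ∧ σ v = 1

variable {d : ℕ → ℕ} {m : ℕ} {LA LB X : List ℕ} {PA PB : Finset ℕ}

theorem mem_keep : v ∈ keep eu ev m PA PB X ↔ v ∈ X ∧
    incCount eu ev PA v + incCount eu ev PB v ≠ incCount eu ev (Finset.range m) v := by
  simp [keep]

theorem mem_marks {σ : ℕ → ℕ} : v ∈ marks eu ev m PA PB X σ ↔ v ∈ X ∧
    incCount eu ev PA v + incCount eu ev PB v = incCount eu ev (Finset.range m) v ∧ σ v = 1 := by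
  simp [marks]

theorem incCount_add_le (hAB : Disjoint PA PB) (hA : PA ⊆ Finset.range m)
    (hB : PB ⊆ Finset.range m) (v : ℕ) :
    incCount eu ev PA v + incCount eu ev PB v ≤ incCount eu ev (Finset.range m) v := by
  rw [incCount, incCount, ← nbSum_union hAB]
  exact nbSum_mono (Finset.union_subset hA hB)

/-- A vertex outside the new list was either dropped because all its edges are present, or it was on
neither old list and so already had all its edges in one of the parts. -/
theorem BoundaryList.join (hAB : Disjoint PA PB) (lA : BoundaryList eu ev m PA LA) (lB : BoundaryList eu ev m PB LB)
    (hX : X.Nodup) (hmem : ∀ v, v ∈ X ↔ v ∈ LA ∨ v ∈ LB) :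
    BoundaryList eu ev m (PA ∪ PB) (keep eu ev m PA PB X) where
  sub := Finset.union_subset lA.sub lB.sub
  nodup := hX.filter _
  pos v hv := by
    rw [mem_keep, hmem] at hv
    rw [incCount, nbSum_union hAB]
    rcases hv.1 with h | h
    · exact Nat.add_pos_left (lA.pos v h) _
    · exact Nat.add_pos_right _ (lB.pos v h)
  cover v hv hp := by
    have hle := incCount_add_le (eu := eu) (ev := ev) hAB lA.sub lB.sub v
    rw [incCount, nbSum_union hAB] at hp ⊢
    change 0 < incCount eu ev PA v + incCount eu ev PB v at hp
    change incCount eu ev PA v + incCount eu ev PB v = _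
    by_cases h : v ∈ X
    · rw [mem_keep] at hv
      by_contra h'
      exact hv ⟨h, h'⟩
    · rw [hmem, not_or] at h
      rcases Nat.eq_zero_or_pos (incCount eu ev PA v) with h0 | h0
      · have := lB.cover v h.2 (by omega); omega
      · have := lA.cover v h.1 h0; omega

/-- A vertex of the other list which is not in the list of `PA` is not incident to `PA`. -/
theorem BoundaryList.incCount_eq_zero (hAB : Disjoint PA PB) (lA : BoundaryList eu ev m PA LA)
    (lB : BoundaryList eu ev m PB LB) (h : v ∉ LA) (h' : v ∈ LB) : incCount eu ev PA v = 0 := by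
  have h1 := incCount_add_le (eu := eu) (ev := ev) hAB lA.sub lB.sub v
  have h2 := lB.pos v h'
  by_contra h0
  -- Otherwise all edges at `v` would lie in `PA`, leaving none for the disjoint part `PB`.
  have := lA.cover v h (by omega)
  omega

/-- The correctness of the recurrence, isolated from the machine: `h1` and `h2` are what the queue
has to guarantee about the new cells. Soundness glues the two partial solutions and the newly
forgotten selected vertices; completeness splits the neighbours supplied by a given solution between
the two parts. -/
theorem TableFor.join {M ds tA tB tC ZA ZB ZC : ℕ} {val val' : ℕ → ℕ}
    {Rec Rec' : ℕ → Finset ℕ → ℕ → Prop} (hd : ∀ v, d v ≤ ds) (hM : ds < M)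
    (hAB : Disjoint PA PB) (lA : BoundaryList eu ev m PA LA) (lB : BoundaryList eu ev m PB LB)
    (hX : X.Nodup) (hmem : ∀ v, v ∈ X ↔ v ∈ LA ∨ v ∈ LB)
    (hA : TableFor eu ev d M ds PA LA tA val Rec ZA)
    (hB : TableFor eu ev d M ds PB LB tB val Rec ZB)
    (h1 : ∀ q, tC ≤ q → val' q ≠ 0 → ∃ σ i j : ℕ → ℕ,
      (∀ v ∈ X, Choice eu ev d m ds PA PB v (σ v) (i v) (j v)) ∧
      q = cellAt M tC (keep eu ev m PA PB X) σ (fun v => i v + j v) ∧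
      val (cellAt M tA LA σ i) ≠ 0 ∧ val (cellAt M tB LB σ j) ≠ 0 ∧
      val' q = val (cellAt M tA LA σ i) + val (cellAt M tB LB σ j) - 1 +
        (marks eu ev m PA PB X σ).card ∧
      ∀ SA zA SB zB, Rec (cellAt M tA LA σ i) SA zA → Rec (cellAt M tB LB σ j) SB zB →
        zA ≤ ZA → zB ≤ ZB →
        ∃ z ≤ ZC, Rec' q (marks eu ev m PA PB X σ ∪ (SA ∪ SB)) z)
    (h2 : ∀ σ i j : ℕ → ℕ, (∀ v ∈ X, Choice eu ev d m ds PA PB v (σ v) (i v) (j v)) →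
      val (cellAt M tA LA σ i) ≠ 0 → val (cellAt M tB LB σ j) ≠ 0 →
      val' (cellAt M tC (keep eu ev m PA PB X) σ (fun v => i v + j v)) ≠ 0 ∧
      val' (cellAt M tC (keep eu ev m PA PB X) σ (fun v => i v + j v)) ≤
        val (cellAt M tA LA σ i) + val (cellAt M tB LB σ j) - 1 +
        (marks eu ev m PA PB X σ).card) :
    TableFor eu ev d M ds (PA ∪ PB) (keep eu ev m PA PB X) tC val' Rec' ZC := by
  have hle := incCount_add_le (eu := eu) (ev := ev) hAB lA.sub lB.sub
  have zA : ∀ v, v ∉ LA → v ∈ LB → incCount eu ev PA v = 0 := fun v h h' =>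
    lA.incCount_eq_zero hAB lB h h'
  have zB : ∀ v, v ∉ LB → v ∈ LA → incCount eu ev PB v = 0 := fun v h h' =>
    lB.incCount_eq_zero hAB.symm lA h h'
  have hinc : ∀ v, incCount eu ev (PA ∪ PB) v = incCount eu ev PA v + incCount eu ev PB v :=
    fun v => nbSum_union hAB
  have lC := BoundaryList.join hAB lA lB hX hmem
  constructor
  · intro σ c hσ hc hval
    obtain ⟨σ', i, j, hch, hq, hvA, hvB, hv, hrec⟩ :=
      h1 (cellAt M tC (keep eu ev m PA PB X) σ c) (Nat.le_add_right _ _) hval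
    -- The choices found in the queue need to agree with the prescribed state only on the vertices
    -- that are kept.
    have hsame := cellAt_inj (by omega : 0 < M) lC.nodup hσ
      (fun v hv => lt_of_le_of_lt (hc v hv).1 hM)
      (fun v hv => (hch v (mem_keep.1 hv).1).1)
      (fun v hv => by
        obtain ⟨hvX, hvn⟩ := mem_keep.1 hv
        have := (hch v hvX).2.2.2
        rw [if_neg hvn] at this
        omega) hq
    have inA : ∀ v ∈ LA, v ∈ X := fun v h => (hmem v).2 (Or.inl h)
    have inB : ∀ v ∈ LB, v ∈ X := fun v h => (hmem v).2 (Or.inr h)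
    obtain ⟨SA, zA', rA, hzA, cA, subA, fA⟩ := hA.sound σ' i (fun v hv => (hch v (inA v hv)).1)
      (fun v hv => (hch v (inA v hv)).2.1) hvA
    obtain ⟨SB, zB', rB, hzB, cB, subB, fB⟩ := hB.sound σ' j (fun v hv => (hch v (inB v hv)).1)
      (fun v hv => (hch v (inB v hv)).2.2.1) hvB
    obtain ⟨z, hz, hr⟩ := hrec SA zA' SB zB' rA rB hzA hzB
    -- A vertex forgotten on one side has all its edges there, so the other side never sees it; this
    -- makes the gluing unambiguous.
    have sA : ∀ v ∈ SA, v ∉ LA ∧ v ∉ LB ∧ 0 < incCount eu ev PA v ∧ incCount eu ev PB v = 0 := by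
      intro v hv
      obtain ⟨p, q⟩ := mem_forgotten.1 (subA hv)
      have := lA.cover v q p
      have := hle v
      exact ⟨q, fun h => by have := zA v q h; omega, p, by omega⟩
    have sB : ∀ v ∈ SB, v ∉ LB ∧ v ∉ LA ∧ 0 < incCount eu ev PB v ∧ incCount eu ev PA v = 0 := by
      intro v hv
      obtain ⟨p, q⟩ := mem_forgotten.1 (subB hv)
      have := lB.cover v q p
      have := hle v
      exact ⟨q, fun h => by have := zB v q h; omega, p, by omega⟩
    set F := marks eu ev m PA PB X σ' with hF
    set C := keep eu ev m PA PB X with hC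
    set G : ℕ → ℕ := fun v => if v ∈ C then σ v else ind (F ∪ (SA ∪ SB)) v with hG
    have onX : ∀ v ∈ X, G v = σ' v := by
      intro v hv
      have hs := (hch v hv).1
      have a1 : v ∉ SA := fun h => by
        rcases (hmem v).1 hv with h' | h'
        exacts [(sA v h).1 h', (sA v h).2.1 h']
      have a2 : v ∉ SB := fun h => by
        rcases (hmem v).1 hv with h' | h'
        exacts [(sB v h).2.1 h', (sB v h).1 h']
      by_cases hvC : v ∈ C
      · simp only [hG, if_pos hvC]; exact (hsame v hvC).1
      · have hfull : incCount eu ev PA v + incCount eu ev PB v =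
            incCount eu ev (Finset.range m) v := by
          by_contra h; exact hvC (mem_keep.2 ⟨hv, h⟩)
        simp only [hG, if_neg hvC, ind, Finset.mem_union, a1, a2, or_false, hF, mem_marks, hv,
          hfull, true_and]
        split_ifs <;> omega
    have offX : ∀ v ∉ X, G v = ind (SA ∪ SB) v := by
      intro v hv
      have b1 : v ∉ C := fun h => hv (mem_keep.1 h).1
      have b2 : v ∉ F := fun h => hv (mem_marks.1 h).1
      simp [hG, b1, b2, ind]
    have gA : ∀ v, 0 < incCount eu ev PA v → G v = if v ∈ LA then σ' v else ind SA v := by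
      intro v hv
      by_cases h : v ∈ LA
      · rw [if_pos h, onX v (inA v h)]
      · have h' : v ∉ LB := fun h' => by have := zA v h h'; omega
        have : v ∉ SB := fun h'' => by have := (sB v h'').2.2.2; omega
        rw [if_neg h, offX v (by rw [hmem]; tauto)]
        simp [ind, this]
    have gB : ∀ v, 0 < incCount eu ev PB v → G v = if v ∈ LB then σ' v else ind SB v := by
      intro v hv
      by_cases h : v ∈ LB
      · rw [if_pos h, onX v (inB v h)]
      · have h' : v ∉ LA := fun h' => by have := zB v h h'; omega
        have : v ∉ SA := fun h'' => by have := (sA v h'').2.2.2; omega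
        rw [if_neg h, offX v (by rw [hmem]; tauto)]
        simp [ind, this]
    have nA : ∀ v ∈ X, i v ≤ nbSum eu ev PA G v := by
      intro v hv
      by_cases h : v ∈ LA
      · rw [nbSum_congr gA]; exact fA.1 v h
      · have := zA v h (((hmem v).1 hv).resolve_left h)
        have := (hch v hv).2.1.2
        omega
    have nB : ∀ v ∈ X, j v ≤ nbSum eu ev PB G v := by
      intro v hv
      by_cases h : v ∈ LB
      · rw [nbSum_congr gB]; exact fB.1 v h
      · have := zB v h (((hmem v).1 hv).resolve_right h)
        have := (hch v hv).2.2.1.2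
        omega
    refine ⟨_, z, hr, hz, ?_, ?_, ?_, ?_⟩
    · have d1 : Disjoint SA SB := Finset.disjoint_left.2 fun v h h' => by
        have := (sA v h).2.2; have := (sB v h').2.2; omega
      have d2 : Disjoint F (SA ∪ SB) := Finset.disjoint_left.2 fun v h h' => by
        have hx := (hmem v).1 (mem_marks.1 h).1
        rcases Finset.mem_union.1 h' with h' | h'
        · have := sA v h'; tauto
        · have := sB v h'; tauto
      rw [Finset.card_union_of_disjoint d2, Finset.card_union_of_disjoint d1, hv, cA, cB]
      omega
    · intro v hv
      rw [mem_forgotten, hinc]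
      rcases Finset.mem_union.1 hv with h | h
      · have hm := mem_marks.1 h
        refine ⟨?_, fun h' => (mem_keep.1 h').2 hm.2.1⟩
        rcases (hmem v).1 hm.1 with h' | h'
        · have := lA.pos v h'; omega
        · have := lB.pos v h'; omega
      · have hx : v ∉ X ∧ 0 < incCount eu ev PA v + incCount eu ev PB v := by
          rw [hmem]
          rcases Finset.mem_union.1 h with h | h
          · have := sA v h; exact ⟨by tauto, by omega⟩
          · have := sB v h; exact ⟨by tauto, by omega⟩
        exact ⟨hx.2, fun h' => hx.1 (mem_keep.1 h').1⟩
    · intro v hv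
      have hvX := (mem_keep.1 hv).1
      rw [nbSum_union hAB, (hsame v hv).2]
      exact Nat.add_le_add (nA v hvX) (nB v hvX)
    · intro v hv hp
      change d v ≤ G v + nbSum eu ev (PA ∪ PB) G v
      rw [nbSum_union hAB]
      by_cases hvX : v ∈ X
      · have hfull : incCount eu ev PA v + incCount eu ev PB v =
            incCount eu ev (Finset.range m) v := by
          by_contra h; exact hv (mem_keep.2 ⟨hvX, h⟩)
        have := (hch v hvX).2.2.2
        rw [if_pos hfull] at this
        have := nA v hvX
        have := nB v hvX
        have := onX v hvX
        omega
      · have hvX' := hvX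
        rw [hmem, not_or] at hvX'
        rw [hinc] at hp
        rcases Nat.eq_zero_or_pos (incCount eu ev PA v) with h0 | h0
        · have := fB.2 v hvX'.2 (by omega)
          rw [nbSum_congr gB, gB v (by omega)]
          dsimp only at this
          omega
        · have := fA.2 v hvX'.1 h0
          rw [nbSum_congr gA, gA v h0]
          dsimp only at this
          omega
  · intro g c hg hc hf
    set C := keep eu ev m PA PB X with hC
    -- At a kept vertex the demand is met from `PA` as far as possible and the rest from `PB`. At a
    -- forgotten vertex the counts are capped at `ds`, which loses nothing because `d v ≤ ds`.
    set i : ℕ → ℕ := fun v => if v ∈ C then min (c v) (nbSum eu ev PA g v)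
      else min ds (nbSum eu ev PA g v) with hi
    set j : ℕ → ℕ := fun v => if v ∈ C then c v - i v else min ds (nbSum eu ev PB g v) with hj
    have leA : ∀ v, nbSum eu ev PA g v ≤ incCount eu ev PA v := fun v => nbSum_le_incCount hg
    have leB : ∀ v, nbSum eu ev PB g v ≤ incCount eu ev PB v := fun v => nbSum_le_incCount hg
    have iA : ∀ v, i v ≤ nbSum eu ev PA g v ∧ i v ≤ ds := fun v => by
      have := hc v; simp only [hi]; split_ifs <;> omega
    have jB : ∀ v, j v ≤ nbSum eu ev PB g v ∧ j v ≤ ds := fun v => by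
      have := hc v
      by_cases h : v ∈ C
      · have h1 := hf.1 v h
        rw [nbSum_union hAB] at h1
        simp only [hj, hi, if_pos h]; omega
      · simp only [hj, if_neg h]; omega
    have ij : ∀ v ∈ C, i v + j v = c v := fun v h => by
      simp only [hj, hi, if_pos h]; omega
    have hch : ∀ v ∈ X, Choice eu ev d m ds PA PB v (g v) (i v) (j v) := by
      intro v hv
      refine ⟨hg v, ⟨(iA v).2, (iA v).1.trans (leA v)⟩, ⟨(jB v).2, (jB v).1.trans (leB v)⟩, ?_⟩
      split_ifs with h
      · have hvC : v ∉ C := fun h' => (mem_keep.1 h').2 h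
        have hp : 0 < incCount eu ev (PA ∪ PB) v := by
          rw [hinc]
          rcases (hmem v).1 hv with h' | h'
          · have := lA.pos v h'; omega
          · have := lB.pos v h'; omega
        have h1 := hf.2 v hvC hp
        rw [nbSum_union hAB] at h1
        have := hd v
        simp only [hj, hi, if_neg hvC]
        omega
      · have hvC : v ∈ C := mem_keep.2 ⟨hv, h⟩
        rw [ij v hvC]; exact hc v
    have nC : ∀ v, v ∉ X → v ∉ C := fun v h h' => h (mem_keep.1 h').1
    have cA := hA.complete g i hg (fun v => (iA v).2) ⟨fun v _ => (iA v).1, fun v hv hp => by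
      have h1 := lA.cover v hv hp
      have h2 := hle v
      have h3 : v ∉ LB := fun h => by have := zA v hv h; omega
      have h4 := hf.2 v (nC v (by rw [hmem]; tauto)) (by rw [hinc]; omega)
      rw [nbSum_union hAB] at h4
      have := leB v
      omega⟩
    have cB := hB.complete g j hg (fun v => (jB v).2) ⟨fun v _ => (jB v).1, fun v hv hp => by
      have h1 := lB.cover v hv hp
      have h2 := hle v
      have h3 : v ∉ LA := fun h => by have := zB v hv h; omega
      have h4 := hf.2 v (nC v (by rw [hmem]; tauto)) (by rw [hinc]; omega)
      rw [nbSum_union hAB] at h4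
      have := leA v
      omega⟩
    have key := h2 g i j hch cA.1 cB.1
    have e : cellAt M tC C g (fun v => i v + j v) = cellAt M tC C g c :=
      cellAt_congr fun v hv => ⟨rfl, ij v hv⟩
    rw [e] at key
    refine ⟨key.1, key.2.trans ?_⟩
    have hFs : (marks eu ev m PA PB X g).card = ∑ v ∈ marks eu ev m PA PB X g, g v := by
      rw [Finset.card_eq_sum_ones]
      exact Finset.sum_congr rfl fun v hv => (mem_marks.1 hv).2.2.symm
    have fA : ∀ v ∈ forgotten eu ev PA LA,
        0 < incCount eu ev PA v ∧ incCount eu ev PB v = 0 ∧ v ∉ X := by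
      intro v hv
      obtain ⟨p, q⟩ := mem_forgotten.1 hv
      have := lA.cover v q p
      have := hle v
      refine ⟨p, by omega, ?_⟩
      rw [hmem, not_or]
      exact ⟨q, fun h => by have := zA v q h; omega⟩
    have fB : ∀ v ∈ forgotten eu ev PB LB,
        0 < incCount eu ev PB v ∧ incCount eu ev PA v = 0 ∧ v ∉ X := by
      intro v hv
      obtain ⟨p, q⟩ := mem_forgotten.1 hv
      have := lB.cover v q p
      have := hle v
      refine ⟨p, by omega, ?_⟩
      rw [hmem, not_or]
      exact ⟨fun h => by have := zB v q h; omega, q⟩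
    have d1 : Disjoint (forgotten eu ev PA LA) (forgotten eu ev PB LB) :=
      Finset.disjoint_left.2 fun v h h' => by have := fA v h; have := fB v h'; omega
    have d2 : Disjoint (marks eu ev m PA PB X g)
        (forgotten eu ev PA LA ∪ forgotten eu ev PB LB) :=
      Finset.disjoint_left.2 fun v h h' => by
        rcases Finset.mem_union.1 h' with h' | h'
        · exact (fA v h').2.2 (mem_marks.1 h).1
        · exact (fB v h').2.2 (mem_marks.1 h).1
    -- Minimality needs only this inclusion: the selected vertices counted by the join are among
    -- those counted by the given solution.
    have hsub : marks eu ev m PA PB X g ∪ (forgotten eu ev PA LA ∪ forgotten eu ev PB LB) ⊆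
        forgotten eu ev (PA ∪ PB) C := by
      intro v hv
      rw [mem_forgotten, hinc]
      rcases Finset.mem_union.1 hv with h | h
      · have hm := mem_marks.1 h
        refine ⟨?_, fun h' => (mem_keep.1 h').2 hm.2.1⟩
        rcases (hmem v).1 hm.1 with h' | h'
        · have := lA.pos v h'; omega
        · have := lB.pos v h'; omega
      · rcases Finset.mem_union.1 h with h | h
        · exact ⟨by have := fA v h; omega, nC v (fA v h).2.2⟩
        · exact ⟨by have := fB v h; omega, nC v (fB v h).2.2⟩
    have := Finset.sum_le_sum_of_subset (f := g) hsub
    rw [Finset.sum_union d2, Finset.sum_union d1] at this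
    omega

end Tables

namespace RAM

/-! ### Names of registers and arrays -/

notation "ʀds" => 4
notation "ʀM" => 5
notation "ʀip" => 7
notation "ʀxp" => 8
notation "ʀqp" => 9
notation "ʀcp" => 10
notation "ʀp" => 11
notation "ʀx" => 12
notation "ʀz" => 20
notation "ʀze" => 21
notation "ʀxs" => 22
notation "ʀxi" => 23
notation "ʀst" => 24
notation "ʀcC" => 25
notation "ʀcS" => 26
notation "ʀlo" => 27
notation "ʀhi" => 28
notation "ʀe" => 29
notation "ʀsel" => 30
notation "ʀi" => 31
notation "ʀj" => 32
notation "ʀa1" => 33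
notation "ʀb1" => 34
notation "ʀc1" => 35
notation "ʀt1" => 36
notation "ʀw1" => 37
notation "ʀmk" => 38
notation "ʀa2" => 39
notation "ʀc2" => 40
notation "ʀt2" => 41
notation "ʀb3" => 42
notation "ʀc3" => 43
notation "ʀt3" => 44
notation "ʀf" => 45
notation "ʀtlo" => 46
notation "ʀthi" => 47
notation "ʀfm" => 48
notation "ʀy" => 49
notation "ʀv" => 50
notation "ʀcs" => 51
notation "ʀw" => 52
notation "ʀt" => 53

notation "ᴀd" => 0
notation "ᴀdeg" => 6
notation "ᴀLS" => 10
notation "ᴀLE" => 11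
notation "ᴀTB" => 12
notation "ᴀitV" => 13
notation "ᴀitN" => 14
notation "ᴀitC" => 15
notation "ᴀitS" => 16
notation "ᴀxV" => 17
notation "ᴀxI" => 18
notation "ᴀxJ" => 19
notation "ᴀxN" => 20
notation "ᴀxAC" => 21
notation "ᴀxAS" => 22
notation "ᴀxBC" => 23
notation "ᴀxBS" => 24
notation "ᴀpos" => 25
notation "ᴀqA" => 26
notation "ᴀqB" => 27
notation "ᴀqC" => 28
notation "ᴀqW" => 29
notation "ᴀqP" => 30
notation "ᴀqM" => 31
notation "ᴀval" => 32
notation "ᴀbp" => 33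

notation "𝐑" => Term.reg
notation:max a "⁅" i "⁆" => Term.arr a i

/-! ### The queue of partial choices -/

/-- An entry of the queue: the cells of the two old tables and of the new one, the number of newly
forgotten selected vertices, the preceding entry, and the mark. -/
structure Entry where
  a : ℕ
  b : ℕ
  c : ℕ
  w : ℕ
  par : ℕ
  mark : ℕ

/-- The entry at position `q` of the queue. -/
def Store.ent (s : Store) (q : ℕ) : Entry :=
  ⟨s.arr ᴀqA q, s.arr ᴀqB q, s.arr ᴀqC q, s.arr ᴀqW q, s.arr ᴀqP q, s.arr ᴀqM q⟩

/-- In going from `s` to `s'` exactly the entries `l` have been appended to the queue. -/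
structure Appended (s s' : Store) (l : List Entry) : Prop where
  reg : s'.reg ʀqp = s.reg ʀqp + l.length
  old : ∀ q < s.reg ʀqp, s'.ent q = s.ent q
  new : ∀ i (h : i < l.length), s'.ent (s.reg ʀqp + i) = l[i]

theorem Appended.nil {s s' : Store} (h : s'.reg ʀqp = s.reg ʀqp) (h' : ∀ q, s'.ent q = s.ent q) :
    Appended s s' [] := ⟨by simpa using h, fun q _ => h' q, fun i h => by simp at h⟩

theorem Appended.append {s s' s'' : Store} {l l' : List Entry} (h : Appended s s' l)
    (h' : Appended s' s'' l') : Appended s s'' (l ++ l') := by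
  refine ⟨by rw [h'.reg, h.reg, List.length_append, add_assoc], fun q hq => ?_, fun i hi => ?_⟩
  · rw [h'.old q (by rw [h.reg]; omega), h.old q hq]
  · rw [List.length_append] at hi
    by_cases hl : i < l.length
    · rw [h'.old _ (by rw [h.reg]; omega), h.new i hl, List.getElem_append_left hl]
    · have := h'.new (i - l.length) (by omega)
      rw [h.reg] at this
      rw [List.getElem_append_right (by omega), ← this]
      congr 1; omega

theorem Appended.congr {s s₁ s' s₁' : Store} {l : List Entry} (h : Appended s s' l)
    (hq : s₁.reg ʀqp = s.reg ʀqp) (he : ∀ q, s₁.ent q = s.ent q)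
    (hq' : s₁'.reg ʀqp = s'.reg ʀqp) (he' : ∀ q, s₁'.ent q = s'.ent q) : Appended s₁ s₁' l := by
  refine ⟨by rw [hq', hq, h.reg], fun q h0 => ?_, fun i h0 => ?_⟩
  · rw [he', he, h.old q (by omega)]
  · rw [he', hq, h.new i h0]

theorem Appended.mem {s s' : Store} {l : List Entry} (h : Appended s s' l) {E : Entry}
    (hE : E ∈ l) : ∃ q, s.reg ʀqp ≤ q ∧ q < s'.reg ʀqp ∧ s'.ent q = E := by
  obtain ⟨i, hi, rfl⟩ := List.getElem_of_mem hE
  exact ⟨_, Nat.le_add_right _ i, by rw [h.reg]; omega, h.new i hi⟩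

theorem Appended.ent_mem {s s' : Store} {l : List Entry} (h : Appended s s' l) {q : ℕ}
    (hq : s.reg ʀqp ≤ q) (hq' : q < s'.reg ʀqp) : s'.ent q ∈ l := by
  obtain ⟨i, rfl⟩ := Nat.exists_eq_add_of_le hq
  rw [h.reg] at hq'
  rw [h.new i (by omega)]
  exact List.getElem_mem _

def appendProg : Prog :=
  .setArr ᴀqA (𝐑 ʀqp) (𝐑 ʀa2) ;; .setArr ᴀqB (𝐑 ʀqp) (𝐑 ʀb3) ;; .setArr ᴀqC (𝐑 ʀqp) (𝐑 ʀc3) ;;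
  .setArr ᴀqW (𝐑 ʀqp) (𝐑 ʀw1) ;; .setArr ᴀqP (𝐑 ʀqp) (𝐑 ʀe) ;; .setArr ᴀqM (𝐑 ʀqp) (𝐑 ʀmk) ;;
  ʀqp ≔ 𝐑 ʀqp + κ 1

theorem appended_appendProg (s : Store) : Appended s (appendProg.run s)
    [⟨s.reg ʀa2, s.reg ʀb3, s.reg ʀc3, s.reg ʀw1, s.reg ʀe, s.reg ʀmk⟩] := by
  refine ⟨by simp [appendProg, Prog.run], fun q hq => ?_, fun i hi => ?_⟩
  · simp [appendProg, Prog.run, Store.ent, hq.ne]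
  · simp at hi
    subst hi
    simp [appendProg, Prog.run, Store.ent]

/-- The innermost of three nested loops, over the selection, `i` and `j`. The registers `b3`, `c3`
and `t3` advance by a stride or by one, so all cell numbers arise by addition; `t3` is the total
that is tested against the window from `tlo` to `thi`. -/
def stepJ : Prog :=
  .ite (.lt (𝐑 ʀt3) (𝐑 ʀtlo)) .skip (.ite (.lt (𝐑 ʀthi) (𝐑 ʀt3)) .skip appendProg) ;;
  ʀb3 ≔ 𝐑 ʀb3 + ᴀxBC⁅𝐑 ʀxi⁆ ;; ʀc3 ≔ 𝐑 ʀc3 + 𝐑 ʀcC ;; ʀt3 ≔ 𝐑 ʀt3 + κ 1 ;; ʀj ≔ 𝐑 ʀj + κ 1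

def loopJ : Prog :=
  (ʀb3 ≔ 𝐑 ʀb1 ;; ʀc3 ≔ 𝐑 ʀc2 ;; ʀt3 ≔ 𝐑 ʀt2 ;; ʀj ≔ κ 0) ;;
  .loop (.lt (𝐑 ʀj) (ᴀxJ⁅𝐑 ʀxi⁆ + κ 1)) stepJ

/-- The entries for a fixed selection and a fixed `i`. -/
def entriesJ (J bC cC tlo thi a b c w e mk t : ℕ) : List Entry :=
  (List.range (J + 1)).flatMap fun j =>
    if tlo ≤ t + j ∧ t + j ≤ thi then [⟨a, b + j * bC, c + j * cC, w, e, mk⟩] else []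

theorem stepJ_run (s : Store) (h : s.reg ʀtlo ≤ s.reg ʀt3 ∧ s.reg ʀt3 ≤ s.reg ʀthi) :
    stepJ.run s = (ʀb3 ≔ 𝐑 ʀb3 + ᴀxBC⁅𝐑 ʀxi⁆ ;; ʀc3 ≔ 𝐑 ʀc3 + 𝐑 ʀcC ;; ʀt3 ≔ 𝐑 ʀt3 + κ 1 ;;
      ʀj ≔ 𝐑 ʀj + κ 1).run (appendProg.run s) := by
  have h1 := not_lt.2 h.1
  have h2 := not_lt.2 h.2
  simp only [stepJ, Prog.run, Test.holds_lt, Term.eval_reg, h1, h2, if_false]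

theorem stepJ_run' (s : Store) (h : ¬ (s.reg ʀtlo ≤ s.reg ʀt3 ∧ s.reg ʀt3 ≤ s.reg ʀthi)) :
    stepJ.run s = (ʀb3 ≔ 𝐑 ʀb3 + ᴀxBC⁅𝐑 ʀxi⁆ ;; ʀc3 ≔ 𝐑 ʀc3 + 𝐑 ʀcC ;; ʀt3 ≔ 𝐑 ʀt3 + κ 1 ;;
      ʀj ≔ 𝐑 ʀj + κ 1).run s := by
  by_cases h1 : s.reg ʀt3 < s.reg ʀtlo
  · simp only [stepJ, Prog.run, Test.holds_lt, Term.eval_reg, h1, if_true]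
  · have h2 : s.reg ʀthi < s.reg ʀt3 := by omega
    simp only [stepJ, Prog.run, Test.holds_lt, Term.eval_reg, h1, if_false, h2, if_true]

theorem loopJ_spec (s : Store) :
    Runs loopJ s (60 * (s.arr ᴀxJ (s.reg ʀxi) + 1) + 20) (fun s' => Appended s s'
      (entriesJ (s.arr ᴀxJ (s.reg ʀxi)) (s.arr ᴀxBC (s.reg ʀxi)) (s.reg ʀcC) (s.reg ʀtlo)
        (s.reg ʀthi) (s.reg ʀa2) (s.reg ʀb1) (s.reg ʀc2) (s.reg ʀw1) (s.reg ʀe) (s.reg ʀmk)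
        (s.reg ʀt2))) := by
  refine (Runs.flat_seq rfl (Runs.loop_const (s.arr ᴀxJ (s.reg ʀxi) + 1) (fun j s' =>
      s'.reg ʀj = j ∧ s'.reg ʀb3 = s.reg ʀb1 + j * s.arr ᴀxBC (s.reg ʀxi) ∧
      s'.reg ʀc3 = s.reg ʀc2 + j * s.reg ʀcC ∧ s'.reg ʀt3 = s.reg ʀt2 + j ∧
      Appended s s' ((List.range j).flatMap fun j =>
        if s.reg ʀtlo ≤ s.reg ʀt2 + j ∧ s.reg ʀt2 + j ≤ s.reg ʀthi then
        [⟨s.reg ʀa2, s.reg ʀb1 + j * s.arr ᴀxBC (s.reg ʀxi), s.reg ʀc2 + j * s.reg ʀcC,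
          s.reg ʀw1, s.reg ʀe, s.reg ʀmk⟩] else [])) stepJ.bound ?_ ?_ ?_)).mono ?_ ?_
  · simp [Prog.run]
    exact Appended.nil (by simp) (fun q => by simp [Store.ent])
  · rintro j hj s' hf ⟨h1, h2, h3, h4, h5⟩
    refine ⟨?_, ?_⟩
    · simp (disch := decide) [hf.reg, hf.arr, h1, Prog.run]; omega
    · refine Runs.flat rfl le_rfl ?_
      rw [List.range_succ, List.flatMap_append, List.flatMap_singleton]
      by_cases hc : s'.reg ʀtlo ≤ s'.reg ʀt3 ∧ s'.reg ʀt3 ≤ s'.reg ʀthi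
      · have h6 := h5.append (appended_appendProg s')
        rw [stepJ_run s' hc]
        rw [h2, h3] at h6
        simp (disch := decide) [hf.reg, Prog.run, h4] at hc h6
        simp (disch := decide) [appendProg, hf.reg, hf.arr, Prog.run, h1, h2, h3, h4, add_mul,
          add_assoc]
        rw [if_pos hc]
        exact h6.congr rfl (fun _ => rfl) (by simp [appendProg, Prog.run])
          (fun q => by simp (disch := decide) [appendProg, Prog.run, Store.ent, hf.reg, h2, h3])
      · rw [stepJ_run' s' hc]
        simp (disch := decide) [hf.reg, Prog.run, h4] at hc
        simp (disch := decide) [hf.reg, hf.arr, Prog.run, h1, h2, h3, h4, add_mul, add_assoc]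
        rw [if_neg (by omega)]
        simpa using h5.congr rfl (fun _ => rfl) (by simp) (fun q => by simp [Store.ent])
  · rintro s' hf ⟨h1, -⟩
    simp (disch := decide) [hf.reg, hf.arr, h1, Prog.run]
  · simp [Prog.bound, stepJ, appendProg, Term.cost, Test.cost]
    omega
  · rintro s' - ⟨⟨-, -, -, -, h⟩, -⟩
    exact h

theorem Appended.step {s₀ s s₁ s' : Store} {l l' : List Entry} (h : Appended s₀ s l)
    (h' : Appended s s₁ l') (hq : s'.reg ʀqp = s₁.reg ʀqp) (he : ∀ q, s'.ent q = s₁.ent q) :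
    Appended s₀ s' (l ++ l') :=
  h.append (h'.congr rfl (fun _ => rfl) hq he)

def stepI : Prog :=
  loopJ ;; ʀa2 ≔ 𝐑 ʀa2 + ᴀxAC⁅𝐑 ʀxi⁆ ;; ʀc2 ≔ 𝐑 ʀc2 + 𝐑 ʀcC ;; ʀt2 ≔ 𝐑 ʀt2 + κ 1 ;;
  ʀi ≔ 𝐑 ʀi + κ 1

def loopI : Prog :=
  (ʀa2 ≔ 𝐑 ʀa1 ;; ʀc2 ≔ 𝐑 ʀc1 ;; ʀt2 ≔ 𝐑 ʀt1 ;; ʀi ≔ κ 0) ;;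
  .loop (.lt (𝐑 ʀi) (ᴀxI⁅𝐑 ʀxi⁆ + κ 1)) stepI

/-- The entries for a fixed selection. -/
def entriesI (I J aC bC cC tlo thi a b c w e mk t : ℕ) : List Entry :=
  (List.range (I + 1)).flatMap fun i =>
    entriesJ J bC cC tlo thi (a + i * aC) b (c + i * cC) w e mk (t + i)

theorem loopI_spec (s : Store) :
    Runs loopI s (110 * ((s.arr ᴀxI (s.reg ʀxi) + 1) * (s.arr ᴀxJ (s.reg ʀxi) + 1)) + 20)
      (fun s' => Appended s s'
      (entriesI (s.arr ᴀxI (s.reg ʀxi)) (s.arr ᴀxJ (s.reg ʀxi)) (s.arr ᴀxAC (s.reg ʀxi))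
        (s.arr ᴀxBC (s.reg ʀxi)) (s.reg ʀcC) (s.reg ʀtlo)
        (s.reg ʀthi) (s.reg ʀa1) (s.reg ʀb1) (s.reg ʀc1) (s.reg ʀw1) (s.reg ʀe) (s.reg ʀmk)
        (s.reg ʀt1))) := by
  refine (Runs.flat_seq rfl (Runs.loop_const (s.arr ᴀxI (s.reg ʀxi) + 1) (fun i s' =>
      s'.reg ʀi = i ∧ s'.reg ʀa2 = s.reg ʀa1 + i * s.arr ᴀxAC (s.reg ʀxi) ∧
      s'.reg ʀc2 = s.reg ʀc1 + i * s.reg ʀcC ∧ s'.reg ʀt2 = s.reg ʀt1 + i ∧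
      Appended s s' ((List.range i).flatMap fun i =>
        entriesJ (s.arr ᴀxJ (s.reg ʀxi)) (s.arr ᴀxBC (s.reg ʀxi)) (s.reg ʀcC) (s.reg ʀtlo)
          (s.reg ʀthi) (s.reg ʀa1 + i * s.arr ᴀxAC (s.reg ʀxi)) (s.reg ʀb1)
          (s.reg ʀc1 + i * s.reg ʀcC) (s.reg ʀw1) (s.reg ʀe) (s.reg ʀmk) (s.reg ʀt1 + i)))
      (60 * (s.arr ᴀxJ (s.reg ʀxi) + 1) + 20 + 20) ?_ ?_ ?_)).mono ?_ ?_
  · simp [Prog.run]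
    exact Appended.nil (by simp) (fun q => by simp [Store.ent])
  · rintro j hj s' hf ⟨h1, h2, h3, h4, h5⟩
    refine ⟨?_, ?_⟩
    · simp (disch := decide) [hf.reg, hf.arr, h1, Prog.run]; omega
    · have hl := loopJ_spec s'
      simp (disch := decide) only [hf.reg, hf.arr, h2, h3, h4, Prog.run, Store.setReg_reg,
        Store.setReg_arr, reduceIte, Nat.reduceEqDiff] at hl
      refine hl.seq fun s₁ hf₁ h => ?_
      refine Runs.flat rfl ?_ ?_
      · simp [Prog.bound, Term.cost]
      rw [List.range_succ, List.flatMap_append, List.flatMap_singleton]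
      simp (disch := decide) [hf₁.reg, hf₁.arr, hf.reg, hf.arr, Prog.run, h1, h2, h3, h4, add_mul,
        add_assoc]
      exact h5.step h (by simp) (fun q => by simp [Store.ent])
  · rintro s' hf ⟨h1, -⟩
    simp (disch := decide) [hf.reg, hf.arr, h1, Prog.run]
  · simp [Prog.bound, Term.cost, Test.cost]
    nlinarith only []
  · rintro s' - ⟨⟨-, -, -, -, h⟩, -⟩
    exact h

def stepSel : Prog :=
  loopI ;; ʀa1 ≔ 𝐑 ʀa1 + ᴀxAS⁅𝐑 ʀxi⁆ ;; ʀb1 ≔ 𝐑 ʀb1 + ᴀxBS⁅𝐑 ʀxi⁆ ;; ʀc1 ≔ 𝐑 ʀc1 + 𝐑 ʀcS ;;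
  ʀt1 ≔ 𝐑 ʀt1 + 𝐑 ʀf ;; ʀw1 ≔ 𝐑 ʀw1 + 𝐑 ʀf ;; ʀmk ≔ 𝐑 ʀfm ;; ʀsel ≔ 𝐑 ʀsel + κ 1

def loopSel : Prog :=
  (ʀa1 ≔ ᴀqA⁅𝐑 ʀe⁆ ;; ʀb1 ≔ ᴀqB⁅𝐑 ʀe⁆ ;; ʀc1 ≔ ᴀqC⁅𝐑 ʀe⁆ ;; ʀw1 ≔ ᴀqW⁅𝐑 ʀe⁆ ;; ʀt1 ≔ κ 0 ;;
    ʀmk ≔ κ 0 ;; ʀsel ≔ κ 0) ;;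
  .loop (.lt (𝐑 ʀsel) (κ 2)) stepSel

/-- The data of the current vertex which determine how an entry is continued. -/
structure VertexData where
  I : ℕ
  J : ℕ
  aC : ℕ
  aS : ℕ
  bC : ℕ
  bS : ℕ
  cC : ℕ
  cS : ℕ
  tlo : ℕ
  thi : ℕ
  f : ℕ
  fm : ℕ

def Store.vertexData (s : Store) : VertexData :=
  ⟨s.arr ᴀxI (s.reg ʀxi), s.arr ᴀxJ (s.reg ʀxi), s.arr ᴀxAC (s.reg ʀxi), s.arr ᴀxAS (s.reg ʀxi),
    s.arr ᴀxBC (s.reg ʀxi), s.arr ᴀxBS (s.reg ʀxi), s.reg ʀcC, s.reg ʀcS, s.reg ʀtlo, s.reg ʀthi,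
    s.reg ʀf, s.reg ʀfm⟩

/-- The continuations of the entry `E` at position `e`. -/
def entriesSel (D : VertexData) (E : Entry) (e : ℕ) : List Entry :=
  (List.range 2).flatMap fun σ =>
    entriesI D.I D.J D.aC D.bC D.cC D.tlo D.thi (E.a + σ * D.aS) (E.b + σ * D.bS) (E.c + σ * D.cS)
      (E.w + σ * D.f) e (σ * D.fm) (σ * D.f)

theorem loopSel_spec (s : Store) :
    Runs loopSel s (400 * ((s.vertexData.I + 1) * (s.vertexData.J + 1)))
      (fun s' => Appended s s' (entriesSel s.vertexData (s.ent (s.reg ʀe)) (s.reg ʀe))) := by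
  refine (Runs.flat_seq rfl (Runs.loop_const 2 (fun σ s' =>
      s'.reg ʀsel = σ ∧ s'.reg ʀa1 = (s.ent (s.reg ʀe)).a + σ * s.vertexData.aS ∧
      s'.reg ʀb1 = (s.ent (s.reg ʀe)).b + σ * s.vertexData.bS ∧
      s'.reg ʀc1 = (s.ent (s.reg ʀe)).c + σ * s.vertexData.cS ∧
      s'.reg ʀt1 = σ * s.vertexData.f ∧
      s'.reg ʀw1 = (s.ent (s.reg ʀe)).w + σ * s.vertexData.f ∧
      -- The mark stays at `fm` after the last round instead of becoming `2 * fm`, so the clause is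
      -- restricted to the rounds that use it.
      (σ < 2 → s'.reg ʀmk = σ * s.vertexData.fm) ∧
      Appended s s' ((List.range σ).flatMap fun σ =>
        entriesI s.vertexData.I s.vertexData.J s.vertexData.aC s.vertexData.bC s.vertexData.cC
          s.vertexData.tlo s.vertexData.thi ((s.ent (s.reg ʀe)).a + σ * s.vertexData.aS)
          ((s.ent (s.reg ʀe)).b + σ * s.vertexData.bS)
          ((s.ent (s.reg ʀe)).c + σ * s.vertexData.cS)
          ((s.ent (s.reg ʀe)).w + σ * s.vertexData.f) (s.reg ʀe) (σ * s.vertexData.fm)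
          (σ * s.vertexData.f)))
      (110 * ((s.vertexData.I + 1) * (s.vertexData.J + 1)) + 20 + 40) ?_ ?_ ?_)).mono ?_ ?_
  · simp [Prog.run, Store.ent]
    exact Appended.nil (by simp) (fun q => by simp [Store.ent])
  · rintro j hj s' hf ⟨h1, h2, h3, h4, h5, h6, h7, h8⟩
    have h7 := h7 hj
    refine ⟨?_, ?_⟩
    · simp (disch := decide) [h1]; omega
    · have hl := loopI_spec s'
      simp (disch := decide) only [hf.reg, hf.arr, h2, h3, h4, h5, h6, h7, Prog.run,
        Store.setReg_reg, Store.setReg_arr, reduceIte, Nat.reduceEqDiff] at hl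
      refine hl.seq fun s₁ hf₁ h => ?_
      refine Runs.flat rfl ?_ ?_
      · simp [Prog.bound, Term.cost]
      rw [List.range_succ, List.flatMap_append, List.flatMap_singleton]
      simp (disch := decide) [hf₁.reg, hf₁.arr, hf.reg, hf.arr, Prog.run, h1, h2, h3, h4, h5, h6,
        add_mul, add_assoc, Store.vertexData]
      refine ⟨fun h => by simp [show j = 0 by omega], ?_⟩
      exact h8.step h (by simp) (fun q => by simp [Store.ent])
  · rintro s' hf ⟨h1, -⟩
    simp [h1]
  · simp [Prog.bound, Term.cost, Test.cost]
    nlinarith [Nat.zero_le (s.vertexData.I * s.vertexData.J)]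
  · rintro s' - ⟨⟨-, -, -, -, -, -, -, h⟩, -⟩
    exact h

def stepE : Prog := loopSel ;; ʀe ≔ 𝐑 ʀe + κ 1

def loopE : Prog :=
  (ʀe ≔ 𝐑 ʀlo) ;; .loop (.lt (𝐑 ʀe) (𝐑 ʀhi)) stepE ;; ʀlo ≔ 𝐑 ʀhi ;; ʀhi ≔ 𝐑 ʀqp

/-- The continuations of all entries of the current level. -/
def entriesE (s : Store) : List Entry :=
  (List.range (s.reg ʀhi - s.reg ʀlo)).flatMap fun r =>
    entriesSel s.vertexData (s.ent (s.reg ʀlo + r)) (s.reg ʀlo + r)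

/-- The queue serves as a sequence of levels: entries appended while the level from `lo` to `hi` is
read form the next level. -/
theorem loopE_spec (s : Store) (hlo : s.reg ʀlo ≤ s.reg ʀhi) (hhi : s.reg ʀhi = s.reg ʀqp) :
    Runs loopE s (420 * ((s.reg ʀhi - s.reg ʀlo) *
      ((s.vertexData.I + 1) * (s.vertexData.J + 1))) + 20)
      (fun s' => Appended s s' (entriesE s) ∧ s'.reg ʀlo = s.reg ʀhi ∧
        s'.reg ʀhi = s'.reg ʀqp) := by
  refine (Runs.flat_seq rfl ((Runs.loop_const (s.reg ʀhi - s.reg ʀlo) (fun r s' =>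
      s'.reg ʀe = s.reg ʀlo + r ∧
      Appended s s' ((List.range r).flatMap fun r =>
        entriesSel s.vertexData (s.ent (s.reg ʀlo + r)) (s.reg ʀlo + r)))
      (400 * ((s.vertexData.I + 1) * (s.vertexData.J + 1)) + 4) ?_ ?_ ?_).seq
      (B₂ := 4) ?_)).mono ?_ (fun _ _ h => h)
  · simp [Prog.run]
    exact Appended.nil (by simp) (fun q => by simp [Store.ent])
  · rintro j hj s' hf ⟨h1, h2⟩
    refine ⟨?_, ?_⟩
    · simp (disch := decide) [h1, hf.reg, Prog.run]; omega
    · have hl := loopSel_spec s'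
      have hv : s'.vertexData = s.vertexData := by
        simp (disch := decide) [Store.vertexData, hf.reg, hf.arr, Prog.run]
      rw [hv, h1, h2.old _ (by omega)] at hl
      refine hl.seq fun s₁ hf₁ h => ?_
      refine Runs.flat rfl ?_ ?_
      · simp [Prog.bound, Term.cost]
      rw [List.range_succ, List.flatMap_append, List.flatMap_singleton]
      simp (disch := decide) [hf₁.reg, Prog.run, h1, add_assoc]
      exact h2.step h (by simp) (fun q => by simp [Store.ent])
  · rintro s' hf ⟨h1, -⟩
    simp (disch := decide) [h1, hf.reg, Prog.run]; omega
  · rintro s' - ⟨⟨h1, h2⟩, hf⟩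
    refine Runs.flat rfl le_rfl ?_
    simp (disch := decide) [hf.reg, Prog.run]
    have := h2.step (l' := []) (s' := (ʀlo ≔ 𝐑 ʀhi ;; ʀhi ≔ 𝐑 ʀqp).run s')
      (Appended.nil (s := s') (s' := (ʀlo ≔ 𝐑 ʀhi ;; ʀhi ≔ 𝐑 ʀqp).run s') (by simp [Prog.run])
      (fun q => by simp [Store.ent, Prog.run])) rfl (fun _ => rfl)
    simpa (disch := decide) [hf.reg, Prog.run, entriesE] using this
  · simp [Prog.bound, Term.cost, Test.cost]
    nlinarith [Nat.zero_le ((s.reg ʀhi - s.reg ʀlo) * (s.vertexData.I * s.vertexData.J)),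
      Nat.zero_le ((s.reg ʀhi - s.reg ʀlo) * s.vertexData.I),
      Nat.zero_le ((s.reg ʀhi - s.reg ʀlo) * s.vertexData.J)]

end RAM

/-! ### Continuations of a queue entry, their predecessors, and the preparation of a vertex. -/

namespace RAM

theorem mem_entriesSel {D : VertexData} {E E' : Entry} {e : ℕ} :
    E' ∈ entriesSel D E e ↔ ∃ σ i j, σ ≤ 1 ∧ i ≤ D.I ∧ j ≤ D.J ∧
      D.tlo ≤ σ * D.f + i + j ∧ σ * D.f + i + j ≤ D.thi ∧
      E' = ⟨E.a + σ * D.aS + i * D.aC, E.b + σ * D.bS + j * D.bC,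
        E.c + σ * D.cS + i * D.cC + j * D.cC, E.w + σ * D.f, e, σ * D.fm⟩ := by
  simp only [entriesSel, entriesI, entriesJ, List.mem_flatMap, List.mem_range, Nat.lt_succ_iff,
    show (2 : ℕ) = 1 + 1 from rfl]
  constructor
  · rintro ⟨σ, hσ, i, hi, j, hj, h⟩
    split_ifs at h with hc
    · rw [List.mem_singleton] at h
      exact ⟨σ, i, j, hσ, hi, hj, hc.1, hc.2, h⟩
    · simp at h
  · rintro ⟨σ, i, j, hσ, hi, hj, h1, h2, rfl⟩
    refine ⟨σ, hσ, i, hi, j, hj, ?_⟩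
    rw [if_pos ⟨h1, h2⟩]
    simp

theorem length_flatMap_range_le {α : Type*} (f : ℕ → List α) (N K : ℕ)
    (h : ∀ i < N, (f i).length ≤ K) : ((List.range N).flatMap f).length ≤ N * K := by
  induction N with
  | zero => simp
  | succ N ih =>
    rw [List.range_succ, List.flatMap_append, List.flatMap_singleton, List.length_append, add_mul,
      one_mul]
    exact Nat.add_le_add (ih fun i hi => h i (by omega)) (h N (by omega))

theorem length_entriesSel_le (D : VertexData) (E : Entry) (e : ℕ) :
    (entriesSel D E e).length ≤ 2 * ((D.I + 1) * (D.J + 1)) := by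
  refine length_flatMap_range_le _ _ _ fun σ _ => ?_
  refine length_flatMap_range_le _ _ _ fun i _ => ?_
  refine (length_flatMap_range_le _ _ 1 fun j _ => ?_).trans (by simp)
  split_ifs <;> simp

/-! ### Walking back through the queue -/

/-- Following the predecessors from the entry at `q` one meets the marks of the vertices in `F`;
there are `z` entries on the way. -/
inductive Walk (ent : ℕ → Entry) (qb : ℕ) : ℕ → Finset ℕ → ℕ → Prop where
  | root {q : ℕ} : 0 < q → q < qb → (ent q).par = 0 → (ent q).mark = 0 → Walk ent qb q ∅ 1
  | step {q z : ℕ} {F : Finset ℕ} : q < qb → Walk ent qb (ent q).par F z → 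
      (ent q).par < q → Walk ent qb q
        (if (ent q).mark = 0 then F else insert ((ent q).mark - 1) F) (z + 1)

theorem Walk.mono {ent ent' : ℕ → Entry} {qb qb' q z : ℕ} {F : Finset ℕ} (h : Walk ent qb q F z)
    (hb : qb ≤ qb') (he : ∀ q < qb, ent' q = ent q) : Walk ent' qb' q F z := by
  induction h with
  | root h0 hq hp hm =>
    exact .root h0 (hq.trans_le hb) (by rw [he _ hq, hp]) (by rw [he _ hq, hm])
  | @step q z F hq hw hl ih =>
    have := Walk.step (ent := ent') (hq.trans_le hb) (by rw [he _ hq]; exact ih)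
      (by rw [he _ hq]; exact hl)
    rwa [he _ hq] at this

theorem Walk.pos {ent : ℕ → Entry} {qb q z : ℕ} {F : Finset ℕ} (h : Walk ent qb q F z) :
    0 < q ∧ q < qb := by
  cases h with
  | root h0 hq _ _ => exact ⟨h0, hq⟩
  | step hq _ hl => exact ⟨by omega, hq⟩

/-! ### Setting up a vertex -/

/-- Multiplication by repeated addition. It costs `M` rounds per kept vertex and is paid for by
`Inst.base_mul_le`. -/
def mulLoop : Prog :=
  (ʀcS ≔ κ 0 ;; ʀt ≔ κ 0) ;;
  .loop (.lt (𝐑 ʀt) (𝐑 ʀM)) (ʀcS ≔ 𝐑 ʀcS + 𝐑 ʀst ;; ʀt ≔ 𝐑 ʀt + κ 1)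

theorem mulLoop_spec (s : Store) : Runs mulLoop s (20 * s.reg ʀM + 10)
    (fun s' => s'.reg ʀcS = s.reg ʀM * s.reg ʀst) := by
  refine (Runs.flat_seq rfl (Runs.loop_const (s.reg ʀM) (fun t s' =>
      s'.reg ʀt = t ∧ s'.reg ʀcS = t * s.reg ʀst) 10 ?_ ?_ ?_)).mono ?_ ?_
  · simp [Prog.run]
  · rintro j hj s' hf ⟨h1, h2⟩
    refine ⟨?_, Runs.flat rfl (by simp [Prog.bound, Term.cost]) ?_⟩
    · simp (disch := decide) [h1, hf.reg, Prog.run]; omega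
    · simp (disch := decide) [h1, h2, hf.reg, Prog.run, add_mul]
  · rintro s' hf ⟨h1, -⟩
    simp (disch := decide) [h1, hf.reg, Prog.run]
  · simp [Prog.bound, Term.cost, Test.cost]; omega
  · rintro s' - ⟨⟨-, h⟩, -⟩
    exact h

/-- For a vertex about to be forgotten. Zero strides remove it from the new cell number, `f = 1`
lets its selection count both for the demand and for the weight, and `2 * ds + 1` is an upper end
that no total can exceed. The mark is shifted by one so that `0` can mean no mark. -/
def setupFull : Prog :=
  ʀcC ≔ κ 0 ;; ʀcS ≔ κ 0 ;; ʀf ≔ κ 1 ;; ʀtlo ≔ ᴀd⁅𝐑 ʀv⁆ ;; ʀthi ≔ 𝐑 ʀds + 𝐑 ʀds + κ 1 ;;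
  ʀfm ≔ 𝐑 ʀv + κ 1

/-- For a vertex that stays on the list. It takes the next digit of the new cell number, with
strides `st` for the count and `M * st` for the selection; its own selection is not counted, and the
total of the shares is capped by `ds`. -/
def setupKeep : Prog :=
  mulLoop ;; ʀcC ≔ 𝐑 ʀst ;; .setArr ᴀitV (𝐑 ʀip) (𝐑 ʀv) ;;
  .setArr ᴀitN (𝐑 ʀip) (ᴀxN⁅𝐑 ʀxi⁆) ;; .setArr ᴀitC (𝐑 ʀip) (𝐑 ʀst) ;;
  .setArr ᴀitS (𝐑 ʀip) (𝐑 ʀcS) ;; ʀip ≔ 𝐑 ʀip + κ 1 ;; ʀst ≔ 𝐑 ʀcS + 𝐑 ʀcS ;;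
  ʀf ≔ κ 0 ;; ʀtlo ≔ κ 0 ;; ʀthi ≔ 𝐑 ʀds ;; ʀfm ≔ κ 0

def setupX : Prog :=
  ʀv ≔ ᴀxV⁅𝐑 ʀxi⁆ ;; .ite (.eq (ᴀxN⁅𝐑 ʀxi⁆) (ᴀdeg⁅𝐑 ʀv⁆)) setupFull setupKeep

/-- An item of a vertex list: the vertex, its count, and its strides. -/
def Store.item (s : Store) (z : ℕ) : ℕ × ℕ × ℕ × ℕ :=
  (s.arr ᴀitV z, s.arr ᴀitN z, s.arr ᴀitC z, s.arr ᴀitS z)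

theorem setupX_spec (s : Store) : Runs setupX s
    ((if s.arr ᴀxN (s.reg ʀxi) = s.arr ᴀdeg (s.arr ᴀxV (s.reg ʀxi)) then 0 else 20 * s.reg ʀM) + 80)
    (fun s' =>
      if s.arr ᴀxN (s.reg ʀxi) = s.arr ᴀdeg (s.arr ᴀxV (s.reg ʀxi)) then
        s'.vertexData = { s.vertexData with
          cC := 0, cS := 0, f := 1, tlo := s.arr ᴀd (s.arr ᴀxV (s.reg ʀxi)),
          thi := s.reg ʀds + s.reg ʀds + 1, fm := s.arr ᴀxV (s.reg ʀxi) + 1 } ∧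
        s'.reg ʀip = s.reg ʀip ∧ s'.reg ʀst = s.reg ʀst ∧ ∀ z, s'.item z = s.item z
      else
        s'.vertexData = { s.vertexData with
          cC := s.reg ʀst, cS := s.reg ʀM * s.reg ʀst, f := 0, tlo := 0,
          thi := s.reg ʀds, fm := 0 } ∧
        s'.reg ʀip = s.reg ʀip + 1 ∧ s'.reg ʀst = 2 * s.reg ʀM * s.reg ʀst ∧
        (∀ z < s.reg ʀip, s'.item z = s.item z) ∧
        s'.item (s.reg ʀip) = (s.arr ᴀxV (s.reg ʀxi), s.arr ᴀxN (s.reg ʀxi), s.reg ʀst,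
          s.reg ʀM * s.reg ʀst)) := by
  have hite : ∀ B Q, (s.arr ᴀxN (s.reg ʀxi) = s.arr ᴀdeg (s.arr ᴀxV (s.reg ʀxi)) →
      Runs setupFull ((ʀv ≔ ᴀxV⁅𝐑 ʀxi⁆).run s) B Q) →
      (s.arr ᴀxN (s.reg ʀxi) ≠ s.arr ᴀdeg (s.arr ᴀxV (s.reg ʀxi)) →
      Runs setupKeep ((ʀv ≔ ᴀxV⁅𝐑 ʀxi⁆).run s) B Q) → Runs setupX s (B + 10) Q := by
    intro B Q h1 h2
    refine (Runs.flat_seq rfl (Runs.ite (fun h => h1 ?_) (fun h => h2 ?_))).mono ?_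
      (fun _ _ h => h)
    · simpa [Prog.run] using h
    · simpa [Prog.run] using h
    · simp [Prog.bound, Term.cost, Test.cost]; omega
  refine hite _ _ ?_ ?_
  · intro h
    refine Runs.flat rfl (by simp [Prog.bound, setupFull, Term.cost]) ?_
    simp [h, Store.vertexData, Store.item, setupFull, Prog.run]
  · intro h
    simp only [h, if_false]
    refine ((mulLoop_spec _).seq (B₂ := 50) ?_).mono ?_ (fun _ _ h => h)
    · intro s' hf h'
      refine Runs.flat rfl (by simp [Prog.bound, Term.cost]) ?_
      simp (disch := decide) [hf.reg, hf.arr, Prog.run, h', Store.vertexData]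
      refine ⟨by ring, ?_, ?_⟩
      · intro z hz
        simp (disch := decide) [Store.item, hz.ne, hf.arr, Prog.run]
      · simp (disch := decide) [Store.item]
    · simp [Prog.run]

end RAM

/-! ### The queue invariant of a join. -/

namespace RAM

/-- The data of a join: the instance, the two parts with their vertex lists and tables, the merged
vertex list `X`, and the positions at which the new table, the merged list, the new part of the
queue and the new vertex list begin. -/
structure JoinData where
  eu : ℕ → ℕ
  ev : ℕ → ℕ
  d : ℕ → ℕ
  m : ℕ
  ds : ℕ
  M : ℕ
  PA : Finset ℕ
  PB : Finset ℕ
  LA : List ℕ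
  LB : List ℕ
  X : List ℕ
  tA : ℕ
  tB : ℕ
  tC : ℕ
  xs : ℕ
  q0 : ℕ
  ip0 : ℕ

namespace JoinData

variable (J : JoinData)

def cA (v : ℕ) : ℕ := incCount J.eu J.ev J.PA v
def cB (v : ℕ) : ℕ := incCount J.eu J.ev J.PB v
def deg (v : ℕ) : ℕ := incCount J.eu J.ev (Finset.range J.m) v

/-- The admissible choices at a vertex. -/
abbrev Ch (v s i j : ℕ) : Prop := Choice J.eu J.ev J.d J.m J.ds J.PA J.PB v s i j

abbrev kp (X : List ℕ) : List ℕ := keep J.eu J.ev J.m J.PA J.PB X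

abbrev mks (X : List ℕ) (σ : ℕ → ℕ) : Finset ℕ := marks J.eu J.ev J.m J.PA J.PB X σ

/-- A bound for the number of choices at a vertex. -/
def choices (v : ℕ) : ℕ := 2 * ((min J.ds (J.cA v) + 1) * (min J.ds (J.cB v) + 1))

theorem two_le_choices (v : ℕ) : 2 ≤ J.choices v := by
  have : 1 ≤ (min J.ds (J.cA v) + 1) * (min J.ds (J.cB v) + 1) := Nat.mul_pos (by omega) (by omega)
  unfold choices; omega

/-- The partial cell number contributed by the vertices in `X`. -/
def psum (b : ℕ) (L X : List ℕ) (σ c : ℕ → ℕ) : ℕ :=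
  b + ∑ v ∈ X.toFinset, (σ v * J.M + c v) * stride J.M L v

variable {J} {b v : ℕ} {L X Y : List ℕ} {σ c i j σ' c' i' j' : ℕ → ℕ}

theorem psum_congr (h : ∀ v ∈ X, σ v = σ' v ∧ c v = c' v) :
    J.psum b L X σ c = J.psum b L X σ' c' := by
  rw [psum, psum]
  congr 1
  refine Finset.sum_congr rfl fun v hv => ?_
  rw [List.mem_toFinset] at hv
  rw [(h v hv).1, (h v hv).2]

theorem psum_append (hv : v ∉ X) : J.psum b L (X ++ [v]) σ c =
    J.psum b L X σ c + (σ v * J.M + c v) * stride J.M L v := by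
  have h1 : (X ++ [v]).toFinset = insert v X.toFinset := by ext; simp
  rw [psum, psum, h1, Finset.sum_insert (by simpa using hv)]
  ring

/-- Strides vanish outside `L`, so running through the longer merged list still addresses the right
cell of an old table. -/
theorem psum_eq_cellAt (h : ∀ v ∈ L, v ∈ X) : J.psum b L X σ c = cellAt J.M b L σ c := by
  rw [psum, cellAt]
  congr 1
  symm
  refine Finset.sum_subset (fun v hv => ?_) fun v _ hv => ?_
  · rw [List.mem_toFinset] at hv ⊢; exact h v hv
  · rw [List.mem_toFinset] at hv; simp [stride, hv]

theorem kp_append_full (h : J.cA v + J.cB v = J.deg v) : J.kp (X ++ [v]) = J.kp X := by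
  unfold cA cB deg at h
  simp [kp, keep, List.filter_append, h]

theorem kp_append_keep (h : J.cA v + J.cB v ≠ J.deg v) : J.kp (X ++ [v]) = J.kp X ++ [v] := by
  unfold cA cB deg at h
  simp [kp, keep, List.filter_append, h]

theorem mks_append_full (h : J.cA v + J.cB v = J.deg v) (h' : σ v = 1) :
    J.mks (X ++ [v]) σ = insert v (J.mks X σ) := by
  unfold cA cB deg at h
  ext w
  simp only [mks, mem_marks, Finset.mem_insert, List.mem_append, List.mem_singleton]
  constructor
  · rintro ⟨h1 | h1, h2⟩
    exacts [Or.inr ⟨h1, h2⟩, Or.inl h1]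
  · rintro (rfl | h1)
    exacts [⟨Or.inr rfl, h, h'⟩, ⟨Or.inl h1.1, h1.2⟩]

theorem mks_append (h : ¬ (J.cA v + J.cB v = J.deg v ∧ σ v = 1)) :
    J.mks (X ++ [v]) σ = J.mks X σ := by
  unfold cA cB deg at h
  ext w
  simp only [mks, mem_marks, List.mem_append, List.mem_singleton]
  constructor
  · rintro ⟨h1 | rfl, h2⟩
    exacts [⟨h1, h2⟩, absurd h2 h]
  · rintro h1
    exact ⟨Or.inl h1.1, h1.2⟩

theorem mks_congr (h : ∀ v ∈ X, σ v = σ' v) : J.mks X σ = J.mks X σ' := by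
  ext w
  simp only [mks, mem_marks]
  constructor
  · rintro ⟨h1, h2, h3⟩
    exact ⟨h1, h2, h w h1 ▸ h3⟩
  · rintro ⟨h1, h2, h3⟩
    exact ⟨h1, h2, (h w h1).trans h3⟩

variable (J) in
/-- The entry `E` represents the choices `σ`, `i`, `j` at the vertices in `X`. -/
structure EntryFor (X : List ℕ) (σ i j : ℕ → ℕ) (E : Entry) : Prop where
  a : E.a = J.psum J.tA J.LA X σ i
  b : E.b = J.psum J.tB J.LB X σ j
  c : E.c = cellAt J.M J.tC (J.kp X) σ (fun v => i v + j v)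
  w : E.w = (J.mks X σ).card

theorem EntryFor.congr {E : Entry} (h : J.EntryFor X σ i j E)
    (h' : ∀ v ∈ X, σ v = σ' v ∧ i v = i' v ∧ j v = j' v) : J.EntryFor X σ' i' j' E := by
  refine ⟨?_, ?_, ?_, ?_⟩
  · rw [h.a]; exact psum_congr fun v hv => ⟨(h' v hv).1, (h' v hv).2.1⟩
  · rw [h.b]; exact psum_congr fun v hv => ⟨(h' v hv).1, (h' v hv).2.2⟩
  · rw [h.c]; exact cellAt_congr fun v hv => by
      have := h' v (mem_keep.1 hv).1
      exact ⟨this.1, by rw [this.2.1, this.2.2]⟩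
  · rw [h.w, mks_congr fun v hv => (h' v hv).1]

variable (J) in
/-- The data of vertex `v` when the vertices in `X` have been dealt with. -/
def vdata (X : List ℕ) (v : ℕ) : VertexData where
  I := min J.ds (J.cA v)
  J := min J.ds (J.cB v)
  aC := stride J.M J.LA v
  aS := J.M * stride J.M J.LA v
  bC := stride J.M J.LB v
  bS := J.M * stride J.M J.LB v
  cC := if J.cA v + J.cB v = J.deg v then 0 else (2 * J.M) ^ (J.kp X).length
  cS := if J.cA v + J.cB v = J.deg v then 0 else J.M * (2 * J.M) ^ (J.kp X).length
  tlo := if J.cA v + J.cB v = J.deg v then J.d v else 0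
  thi := if J.cA v + J.cB v = J.deg v then J.ds + J.ds + 1 else J.ds
  f := if J.cA v + J.cB v = J.deg v then 1 else 0
  fm := if J.cA v + J.cB v = J.deg v then v + 1 else 0

/-- The window test of the loops is exactly admissibility: at a forgotten vertex the upper end is
never active, and at a kept vertex the lower end is zero and the selection is not counted. -/
theorem mem_entriesSel_vdata {E E' : Entry} {e : ℕ} :
    E' ∈ entriesSel (J.vdata X v) E e ↔ ∃ σ i j, J.Ch v σ i j ∧
      E' = ⟨E.a + σ * (J.vdata X v).aS + i * (J.vdata X v).aC,
        E.b + σ * (J.vdata X v).bS + j * (J.vdata X v).bC,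
        E.c + σ * (J.vdata X v).cS + i * (J.vdata X v).cC + j * (J.vdata X v).cC,
        E.w + σ * (J.vdata X v).f, e, σ * (J.vdata X v).fm⟩ := by
  rw [mem_entriesSel]
  refine exists_congr fun σ => exists_congr fun i => exists_congr fun j => ?_
  have hI : (J.vdata X v).I = min J.ds (J.cA v) := rfl
  have hJ : (J.vdata X v).J = min J.ds (J.cB v) := rfl
  have key : (σ ≤ 1 ∧ i ≤ (J.vdata X v).I ∧ j ≤ (J.vdata X v).J ∧
      (J.vdata X v).tlo ≤ σ * (J.vdata X v).f + i + j ∧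
      σ * (J.vdata X v).f + i + j ≤ (J.vdata X v).thi) ↔ J.Ch v σ i j := by
    rw [Ch, Choice]
    change _ ↔ σ ≤ 1 ∧ (i ≤ J.ds ∧ i ≤ J.cA v) ∧ (j ≤ J.ds ∧ j ≤ J.cB v) ∧
      if J.cA v + J.cB v = J.deg v then J.d v ≤ σ + i + j else i + j ≤ J.ds
    rw [hI, hJ, le_min_iff, le_min_iff]
    by_cases h : J.cA v + J.cB v = J.deg v
    · simp only [vdata, h, if_true]
      constructor
      · rintro ⟨h1, h2, h3, h4, h5⟩
        exact ⟨h1, h2, h3, by omega⟩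
      · rintro ⟨h1, h2, h3, h4⟩
        exact ⟨h1, h2, h3, by omega, by omega⟩
    · simp only [vdata, h, if_false]
      constructor
      · rintro ⟨h1, h2, h3, h4, h5⟩
        exact ⟨h1, h2, h3, by omega⟩
      · rintro ⟨h1, h2, h3, h4⟩
        exact ⟨h1, h2, h3, by omega, by omega⟩
  rw [← key]
  tauto

theorem EntryFor.extend {E : Entry} {e : ℕ} (h : J.EntryFor X σ i j E) (hv : v ∉ X)
    (hσ : σ v ≤ 1) : J.EntryFor (X ++ [v]) σ i j
      ⟨E.a + σ v * (J.vdata X v).aS + i v * (J.vdata X v).aC,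
        E.b + σ v * (J.vdata X v).bS + j v * (J.vdata X v).bC,
        E.c + σ v * (J.vdata X v).cS + i v * (J.vdata X v).cC + j v * (J.vdata X v).cC,
        E.w + σ v * (J.vdata X v).f, e, σ v * (J.vdata X v).fm⟩ := by
  refine ⟨?_, ?_, ?_, ?_⟩
  · rw [psum_append hv, ← h.a]; simp only [vdata]; ring
  · rw [psum_append hv, ← h.b]; simp only [vdata]; ring
  · by_cases hf : J.cA v + J.cB v = J.deg v
    · rw [kp_append_full hf, ← h.c]; simp [vdata, hf]
    · rw [kp_append_keep hf, cellAt_append (fun h' => hv (mem_keep.1 h').1), ← h.c]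
      simp only [vdata, hf, if_false]; ring
  · by_cases hf : J.cA v + J.cB v = J.deg v
    · rcases Nat.le_one_iff_eq_zero_or_eq_one.1 hσ with h0 | h1
      · rw [mks_append (by omega), ← h.w]; simp [h0]
      · rw [mks_append_full hf h1, Finset.card_insert_of_notMem (fun h' => hv (mem_marks.1 h').1),
          ← h.w]
        simp [h1, vdata, hf]
    · rw [mks_append (by tauto), ← h.w]; simp [vdata, hf]

variable (J) in
/-- The state of a join when the vertices in `X` have been dealt with. -/
structure Level (s₀ s : Store) (X : List ℕ) : Prop where
  lo_le : s.reg ʀlo ≤ s.reg ʀhi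
  hi_eq : s.reg ʀhi = s.reg ʀqp
  le_lo : J.q0 ≤ s.reg ʀlo
  sound : ∀ q, s.reg ʀlo ≤ q → q < s.reg ʀhi → ∃ σ i j : ℕ → ℕ,
    (∀ v ∈ X, J.Ch v (σ v) (i v) (j v)) ∧ J.EntryFor X σ i j (s.ent q) ∧
    Walk s.ent (s.reg ʀqp) q (J.mks X σ) (X.length + 1)
  complete : ∀ σ i j : ℕ → ℕ, (∀ v ∈ X, J.Ch v (σ v) (i v) (j v)) →
    ∃ q, s.reg ʀlo ≤ q ∧ q < s.reg ʀhi ∧ J.EntryFor X σ i j (s.ent q)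
  count : s.reg ʀhi - s.reg ʀlo ≤ (X.map J.choices).prod
  st : s.reg ʀst = (2 * J.M) ^ (J.kp X).length
  ip : s.reg ʀip = J.ip0 + (J.kp X).length
  items : ∀ i (h : i < (J.kp X).length), s.item (J.ip0 + i) =
    ((J.kp X)[i], J.cA (J.kp X)[i] + J.cB (J.kp X)[i], (2 * J.M) ^ i, J.M * (2 * J.M) ^ i)
  old_items : ∀ z < J.ip0, s.item z = s₀.item z
  old_ent : ∀ q < J.q0, s.ent q = s₀.ent q

variable (J) in
/-- The merged vertex list and the constants are in place. -/
structure XData (s : Store) : Prop where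
  M : s.reg ʀM = J.M
  ds : s.reg ʀds = J.ds
  xp : s.reg ʀxp = J.xs + J.X.length
  x : ∀ i (h : i < J.X.length),
    s.arr ᴀxV (J.xs + i) = J.X[i] ∧
    s.arr ᴀxN (J.xs + i) = J.cA J.X[i] + J.cB J.X[i] ∧
    s.arr ᴀxI (J.xs + i) = min J.ds (J.cA J.X[i]) ∧
    s.arr ᴀxJ (J.xs + i) = min J.ds (J.cB J.X[i]) ∧
    s.arr ᴀxAC (J.xs + i) = stride J.M J.LA J.X[i] ∧
    s.arr ᴀxAS (J.xs + i) = J.M * stride J.M J.LA J.X[i] ∧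
    s.arr ᴀxBC (J.xs + i) = stride J.M J.LB J.X[i] ∧
    s.arr ᴀxBS (J.xs + i) = J.M * stride J.M J.LB J.X[i]
  deg : ∀ v ∈ J.X, s.arr ᴀdeg v = J.deg v
  d : ∀ v ∈ J.X, s.arr ᴀd v = J.d v
  nodup : J.X.Nodup

end JoinData

def stepX : Prog := setupX ;; loopE ;; ʀxi ≔ 𝐑 ʀxi + κ 1

namespace JoinData

variable {J : JoinData}

/-- One vertex is dealt with. The counts of the choices multiply, and each new entry prolongs the
walk of its predecessor by one mark or none. -/
theorem stepX_spec {s₀ s : Store} {k : ℕ} (hk : k < J.X.length) (hX : J.XData s)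
    (hxi : s.reg ʀxi = J.xs + k) (h : J.Level s₀ s (J.X.take k)) :
    Runs stepX s ((if J.cA J.X[k] + J.cB J.X[k] = J.deg J.X[k] then 0 else 20 * J.M) +
        210 * ((J.X.take (k + 1)).map J.choices).prod + 120)
      (fun s' => J.Level s₀ s' (J.X.take (k + 1)) ∧ s'.reg ʀxi = J.xs + (k + 1)) := by
  obtain ⟨xV, xN, xI, xJ, xAC, xAS, xBC, xBS⟩ := hX.x k hk
  have hmem : J.X[k] ∈ J.X := List.getElem_mem hk
  have hv : J.X[k] ∉ J.X.take k := by
    intro h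
    obtain ⟨i, hi, he⟩ := List.getElem_of_mem h
    rw [List.length_take] at hi
    rw [List.getElem_take] at he
    have := (hX.nodup.getElem_inj_iff).1 he
    omega
  set v := J.X[k] with hvdef
  set Y := J.X.take k with hY
  have htake : J.X.take (k + 1) = Y ++ [v] := by rw [List.take_add_one, List.getElem?_eq_getElem hk]; rfl
  have hdeg := hX.deg v hmem
  have hd := hX.d v hmem
  rw [htake]
  have hcond : (s.arr ᴀxN (s.reg ʀxi) = s.arr ᴀdeg (s.arr ᴀxV (s.reg ʀxi))) ↔
      J.cA v + J.cB v = J.deg v := by rw [hxi, xV, xN, hdeg]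
  have hset : Runs setupX s ((if J.cA v + J.cB v = J.deg v then 0 else 20 * J.M) + 80)
      (fun s' => s'.vertexData = J.vdata Y v ∧
        s'.reg ʀip = J.ip0 + (J.kp (Y ++ [v])).length ∧
        s'.reg ʀst = (2 * J.M) ^ (J.kp (Y ++ [v])).length ∧
        (∀ i (h : i < (J.kp (Y ++ [v])).length), s'.item (J.ip0 + i) =
          ((J.kp (Y ++ [v]))[i], J.cA (J.kp (Y ++ [v]))[i] + J.cB (J.kp (Y ++ [v]))[i],
            (2 * J.M) ^ i, J.M * (2 * J.M) ^ i)) ∧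
        ∀ z < J.ip0, s'.item z = s₀.item z) := by
    have := setupX_spec s
    simp only [hcond] at this
    refine this.mono (by rw [hX.M]) fun s' _ h' => ?_
    have hvd : s.vertexData = { s.vertexData with
        I := min J.ds (J.cA v), J := min J.ds (J.cB v), aC := stride J.M J.LA v,
        aS := J.M * stride J.M J.LA v, bC := stride J.M J.LB v,
        bS := J.M * stride J.M J.LB v } := by
      simp [Store.vertexData, hxi, xI, xJ, xAC, xAS, xBC, xBS]
    by_cases hf : J.cA v + J.cB v = J.deg v
    · simp only [hf, if_true] at h'
      obtain ⟨h1, h2, h3, h4⟩ := h'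
      simp only [kp_append_full hf]
      refine ⟨?_, by rw [h2, h.ip], by rw [h3, h.st], fun i hi => by rw [h4, h.items i hi],
        fun z hz => by rw [h4, h.old_items z hz]⟩
      rw [h1, hvd, vdata]
      simp [hf, hxi, xV, hd, hX.ds]
    · simp only [hf, if_false] at h'
      obtain ⟨h1, h2, h3, h4, h5⟩ := h'
      simp only [kp_append_keep hf, List.length_append, List.length_singleton]
      refine ⟨?_, by rw [h2, h.ip, add_assoc], by rw [h3, h.st, hX.M, pow_succ]; ring, ?_,
        fun z hz => by rw [h4 z (by rw [h.ip]; omega), h.old_items z hz]⟩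
      · rw [h1, hvd, vdata]
        simp [hf, hX.ds, h.st, hX.M]
      · intro i hi
        rcases Nat.lt_succ_iff_lt_or_eq.1 hi with hi | rfl
        · rw [h4 _ (by rw [h.ip]; omega), h.items i hi, List.getElem_append_left hi]
        · rw [← h.ip, h5, hxi, xV, xN, h.st, hX.M]
          simp
  refine (hset.seq fun s₁ hf₁ h₁ => (((loopE_spec s₁ ?_ ?_).mono
    (B' := 210 * ((Y ++ [v]).map J.choices).prod + 20) ?_ (fun _ _ h => h)).seq (B₂ := 5) ?_)).mono
    (by omega) (fun _ _ h => h)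
  · simp (disch := decide) only [hf₁.reg, h.lo_le]
  · simp (disch := decide) only [hf₁.reg, h.hi_eq]
  · have r1 : s₁.reg ʀlo = s.reg ʀlo := hf₁.reg _ (by decide)
    have r2 : s₁.reg ʀhi = s.reg ʀhi := hf₁.reg _ (by decide)
    -- The factor two for the selection belongs to `choices` but not to the bound of `loopE_spec`,
    -- so `420` per entry becomes `210` per choice.
    have hvd1 : ((s.reg ʀhi - s.reg ʀlo) * ((min J.ds (J.cA v) + 1) * (min J.ds (J.cB v) + 1))) * 2
        ≤ ((Y ++ [v]).map J.choices).prod := by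
      rw [List.map_append, List.prod_append, List.map_singleton, List.prod_singleton, mul_assoc,
        mul_comm _ 2]
      exact Nat.mul_le_mul_right _ h.count
    rw [h₁.1, r1, r2]
    simp only [vdata]
    omega
  · rintro s₂ hf₂ ⟨ha, hlo, hhi⟩
    refine Runs.flat rfl (by simp [Prog.bound, Term.cost]) ?_
    obtain ⟨hvd, hip, hst, hit, hold⟩ := h₁
    have hent : s₁.ent = s.ent := by
      funext q; simp (disch := decide) [Store.ent, hf₁.arr]
    have hitem : ∀ s' z, s' = (ʀxi ≔ 𝐑 ʀxi + κ 1).run s₂ → s'.item z = s₁.item z := by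
      rintro s' z rfl; simp (disch := decide) [Store.item, hf₂.arr, Prog.run]
    have hent' : ∀ s', s' = (ʀxi ≔ 𝐑 ʀxi + κ 1).run s₂ → s'.ent = s₂.ent := by
      rintro s' rfl; rfl
    have r0 : s₁.reg ʀqp = s.reg ʀqp := hf₁.reg _ (by decide)
    have r1 : s₁.reg ʀlo = s.reg ʀlo := hf₁.reg _ (by decide)
    have r2 : s₁.reg ʀhi = s.reg ʀhi := hf₁.reg _ (by decide)
    have r3 : s₂.reg ʀip = s₁.reg ʀip := hf₂.reg _ (by decide)
    have r4 : s₂.reg ʀst = s₁.reg ʀst := hf₂.reg _ (by decide)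
    have r5 : s₂.reg ʀxi = s.reg ʀxi := by rw [hf₂.reg _ (by decide), hf₁.reg _ (by decide)]
    have hE : ∀ E', E' ∈ entriesE s₁ ↔ ∃ q, s.reg ʀlo ≤ q ∧ q < s.reg ʀhi ∧
        E' ∈ entriesSel (J.vdata Y v) (s.ent q) q := by
      intro E'
      rw [entriesE, List.mem_flatMap, hvd, hent, r1, r2]
      constructor
      · rintro ⟨r, hr, h'⟩
        rw [List.mem_range] at hr
        exact ⟨_, Nat.le_add_right _ r, by omega, h'⟩
      · rintro ⟨q, hq, hq', h'⟩
        obtain ⟨r, rfl⟩ := Nat.exists_eq_add_of_le hq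
        exact ⟨r, List.mem_range.2 (by omega), h'⟩
    have hqle : s.reg ʀqp ≤ s₂.reg ʀqp := by rw [ha.reg, r0]; omega
    have hhq := h.hi_eq
    generalize hs' : (ʀxi ≔ 𝐑 ʀxi + κ 1).run s₂ = s'
    have e1 := hent' s' hs'.symm
    have e2 := fun z => hitem s' z hs'.symm
    have q1 : s'.reg ʀlo = s₂.reg ʀlo := by rw [← hs']; simp [Prog.run]
    have q2 : s'.reg ʀhi = s₂.reg ʀhi := by rw [← hs']; simp [Prog.run]
    have q3 : s'.reg ʀqp = s₂.reg ʀqp := by rw [← hs']; simp [Prog.run]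
    have q4 : s'.reg ʀip = s₂.reg ʀip := by rw [← hs']; simp [Prog.run]
    have q5 : s'.reg ʀst = s₂.reg ʀst := by rw [← hs']; simp [Prog.run]
    have q6 : s'.reg ʀxi = J.xs + (k + 1) := by rw [← hs']; simp [Prog.run, r5, hxi]; omega
    refine ⟨⟨?_, ?_, ?_, ?_, ?_, ?_, ?_, ?_, ?_, ?_, ?_⟩, q6⟩
    · rw [q1, q2, hhi, hlo, r2, hhq]; exact hqle
    · rw [q2, q3, hhi]
    · rw [q1, hlo, r2]; exact h.le_lo.trans h.lo_le
    · intro q hq hq'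
      rw [q1, hlo, r2] at hq
      rw [q2, hhi] at hq'
      have hm := ha.ent_mem (by rw [r0, ← hhq]; exact hq) hq'
      rw [hE] at hm
      obtain ⟨p, hp, hp', hm⟩ := hm
      rw [mem_entriesSel_vdata] at hm
      obtain ⟨σv, iv, jv, hch, he⟩ := hm
      obtain ⟨σ, i, j, hc, hent, hw⟩ := h.sound p hp hp'
      have hne : ∀ w ∈ Y, w ≠ v := fun w hw e => hv (e ▸ hw)
      -- The choice functions of the predecessor are changed at the new vertex only; no earlier
      -- vertex notices.
      refine ⟨Function.update σ v σv, Function.update i v iv, Function.update j v jv, ?_, ?_, ?_⟩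
      · intro w hw
        rw [List.mem_append, List.mem_singleton] at hw
        rcases hw with hw | rfl
        · simp only [Function.update_of_ne (hne w hw)]; exact hc w hw
        · simp only [Function.update_self]; exact hch
      · rw [e1, he]
        have := (hent.congr (σ' := Function.update σ v σv) (i' := Function.update i v iv)
          (j' := Function.update j v jv) fun w hw => by
            simp [Function.update_of_ne (hne w hw)]).extend (e := p) hv (by simp [hch.1])
        simpa only [Function.update_self] using this
      · have hw' : Walk s'.ent (s'.reg ʀqp) p (J.mks Y σ) (Y.length + 1) := by
          refine hw.mono (by rw [q3]; exact hqle) fun q hq => ?_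
          rw [e1, ha.old q (by rw [r0]; exact hq)]
          exact congrFun ‹s₁.ent = s.ent› q
        have hmk : J.mks Y (Function.update σ v σv) = J.mks Y σ :=
          mks_congr fun w hw => by simp [Function.update_of_ne (hne w hw)]
        have hent' : s'.ent q = s₂.ent q := congrFun e1 q
        have hp1 : (s'.ent q).par = p := by rw [hent', he]
        have hp2 : (s'.ent q).mark = σv * (J.vdata Y v).fm := by rw [hent', he]
        have := Walk.step (ent := s'.ent) (qb := s'.reg ʀqp) (q := q) (by omega)
          (hp1 ▸ hw') (by omega)
        rw [List.length_append, List.length_singleton]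
        convert this using 1
        rw [hp2]
        by_cases hf : J.cA v + J.cB v = J.deg v
        · rcases Nat.le_one_iff_eq_zero_or_eq_one.1 hch.1 with h0 | h1
          · rw [mks_append (by simp [h0]), hmk, h0]; simp
          · rw [mks_append_full hf (by simp [h1]), hmk, h1]; simp [vdata, hf]
        · rw [mks_append (by tauto), hmk]; simp [vdata, hf]
    · intro σ i j hc
      obtain ⟨p, hp, hp', he⟩ := h.complete σ i j fun w hw => hc w (by simp [hw])
      have hcv := hc v (by simp)
      obtain ⟨q, hq, hq', he'⟩ := ha.mem ((hE _).2 ⟨p, hp, hp', mem_entriesSel_vdata.2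
        ⟨σ v, i v, j v, hcv, rfl⟩⟩)
      refine ⟨q, by omega, by omega, ?_⟩
      rw [e1, he']
      exact he.extend hv hcv.1
    · have : (entriesE s₁).length ≤ (s.reg ʀhi - s.reg ʀlo) * J.choices v := by
        rw [entriesE, r1, r2]
        refine length_flatMap_range_le _ _ _ fun r _ => ?_
        rw [hvd]
        exact length_entriesSel_le _ _ _
      have h2 := ha.reg
      rw [List.map_append, List.prod_append, List.map_singleton, List.prod_singleton]
      have h3 := Nat.mul_le_mul_right (J.choices v) h.count
      omega
    · rw [q5, r4, hst]
    · rw [q4, r3, hip]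
    · intro i hi; rw [e2, hit i hi]
    · intro z hz; rw [e2, hold z hz]
    · intro q hq
      have := h.le_lo.trans h.lo_le
      rw [e1, ha.old q (by omega), hent, h.old_ent q hq]

end JoinData
end RAM

namespace RAM

/-! ### Merging two vertex lists -/

/-- A row of the merged list. -/
structure Row where
  V : ℕ
  N : ℕ
  I : ℕ
  J : ℕ
  AC : ℕ
  AS : ℕ
  BC : ℕ
  BS : ℕ

def Store.row (s : Store) (z : ℕ) : Row :=
  ⟨s.arr ᴀxV z, s.arr ᴀxN z, s.arr ᴀxI z, s.arr ᴀxJ z, s.arr ᴀxAC z, s.arr ᴀxAS z, s.arr ᴀxBC z,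
    s.arr ᴀxBS z⟩

/-- With truncated subtraction `ds - (ds - n)` is the minimum of `ds` and `n`. -/
def mergeStepA : Prog :=
  ʀv ≔ ᴀitV⁅𝐑 ʀz⁆ ;; .setArr ᴀxV (𝐑 ʀxp) (𝐑 ʀv) ;; .setArr ᴀxN (𝐑 ʀxp) (ᴀitN⁅𝐑 ʀz⁆) ;;
  .setArr ᴀxI (𝐑 ʀxp) (𝐑 ʀds - (𝐑 ʀds - ᴀitN⁅𝐑 ʀz⁆)) ;; .setArr ᴀxJ (𝐑 ʀxp) (κ 0) ;;
  .setArr ᴀxAC (𝐑 ʀxp) (ᴀitC⁅𝐑 ʀz⁆) ;; .setArr ᴀxAS (𝐑 ʀxp) (ᴀitS⁅𝐑 ʀz⁆) ;;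
  .setArr ᴀxBC (𝐑 ʀxp) (κ 0) ;; .setArr ᴀxBS (𝐑 ʀxp) (κ 0) ;; .setArr ᴀpos (𝐑 ʀv) (𝐑 ʀxp) ;;
  ʀxp ≔ 𝐑 ʀxp + κ 1 ;; ʀz ≔ 𝐑 ʀz + κ 1

def newRow : Prog :=
  .setArr ᴀxV (𝐑 ʀxp) (𝐑 ʀv) ;; .setArr ᴀxN (𝐑 ʀxp) (κ 0) ;;
  .setArr ᴀxI (𝐑 ʀxp) (κ 0) ;; .setArr ᴀxJ (𝐑 ʀxp) (κ 0) ;;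
  .setArr ᴀxAC (𝐑 ʀxp) (κ 0) ;; .setArr ᴀxAS (𝐑 ʀxp) (κ 0) ;;
  .setArr ᴀxBC (𝐑 ʀxp) (κ 0) ;; .setArr ᴀxBS (𝐑 ʀxp) (κ 0) ;; .setArr ᴀpos (𝐑 ʀv) (𝐑 ʀxp) ;;
  ʀxp ≔ 𝐑 ʀxp + κ 1

def addB : Prog :=
  ʀy ≔ ᴀpos⁅𝐑 ʀv⁆ ;; .setArr ᴀxN (𝐑 ʀy) (ᴀxN⁅𝐑 ʀy⁆ + ᴀitN⁅𝐑 ʀz⁆) ;;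
  .setArr ᴀxJ (𝐑 ʀy) (𝐑 ʀds - (𝐑 ʀds - ᴀitN⁅𝐑 ʀz⁆)) ;;
  .setArr ᴀxBC (𝐑 ʀy) (ᴀitC⁅𝐑 ʀz⁆) ;; .setArr ᴀxBS (𝐑 ʀy) (ᴀitS⁅𝐑 ʀz⁆) ;; ʀz ≔ 𝐑 ʀz + κ 1

/-- Merged lists occupy ever higher positions, so a value of `pos` below `xs` is left over from an
earlier join and means that the vertex is new. Hence `pos` never has to be cleared, and each item is
merged in constant time. -/
def mergeStepB : Prog :=
  ʀv ≔ ᴀitV⁅𝐑 ʀz⁆ ;; .ite (.lt (ᴀpos⁅𝐑 ʀv⁆) (𝐑 ʀxs)) newRow .skip ;; addB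

def mergeA : Prog :=
  (ʀxs ≔ 𝐑 ʀxp ;; ʀz ≔ ᴀLS⁅𝐑 ʀp⁆ ;; ʀze ≔ ᴀLE⁅𝐑 ʀp⁆) ;; .loop (.lt (𝐑 ʀz) (𝐑 ʀze)) mergeStepA

def mergeB : Prog :=
  (ʀz ≔ ᴀLS⁅𝐑 ʀx⁆ ;; ʀze ≔ ᴀLE⁅𝐑 ʀx⁆) ;; .loop (.lt (𝐑 ʀz) (𝐑 ʀze)) mergeStepB

/-- The vertex list `L` with counts `N` is stored from position `z` on. -/
def ItemsAt (s : Store) (M z : ℕ) (L : List ℕ) (N : ℕ → ℕ) : Prop :=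
  ∀ i (h : i < L.length), s.item (z + i) = (L[i], N L[i], (2 * M) ^ i, M * (2 * M) ^ i)

namespace JoinData

variable (J : JoinData)

/-- The row of `v` when the items in `YA` and `YB` have been merged. -/
def rowOf (YA YB : List ℕ) (v : ℕ) : Row where
  V := v
  N := (if v ∈ YA then J.cA v else 0) + (if v ∈ YB then J.cB v else 0)
  I := if v ∈ YA then min J.ds (J.cA v) else 0
  J := if v ∈ YB then min J.ds (J.cB v) else 0
  AC := if v ∈ YA then stride J.M J.LA v else 0
  AS := if v ∈ YA then J.M * stride J.M J.LA v else 0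
  BC := if v ∈ YB then stride J.M J.LB v else 0
  BS := if v ∈ YB then J.M * stride J.M J.LB v else 0

/-- The merged list `Y` when the items in `YA` and `YB` have been merged. -/
structure Merged (s : Store) (Y YA YB : List ℕ) : Prop where
  nodup : Y.Nodup
  subA : ∀ v ∈ YA, v ∈ Y
  subB : ∀ v ∈ YB, v ∈ Y
  xs : s.reg ʀxs = J.xs
  xp : s.reg ʀxp = J.xs + Y.length
  row : ∀ i (h : i < Y.length), s.row (J.xs + i) = J.rowOf YA YB Y[i]
  pos : ∀ i (h : i < Y.length), s.arr ᴀpos Y[i] = J.xs + i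
  pos_lt : ∀ v, v ∉ Y → s.arr ᴀpos v < J.xs

variable {J}

theorem stride_getElem {M : ℕ} {L : List ℕ} (hL : L.Nodup) {i : ℕ} (h : i < L.length) :
    stride M L L[i] = (2 * M) ^ i := by
  rw [stride, if_pos (List.getElem_mem h), hL.idxOf_getElem]

theorem Merged.addA {s : Store} {Y YB : List ℕ} {v : ℕ} (h : J.Merged s Y Y YB) (hv : v ∉ Y)
    (hds : s.reg ʀds = J.ds)
    (hit : s.item (s.reg ʀz) = (v, J.cA v, stride J.M J.LA v, J.M * stride J.M J.LA v)) :
    J.Merged (mergeStepA.run s) (Y ++ [v]) (Y ++ [v]) YB := by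
  simp only [Store.item, Prod.mk.injEq] at hit
  obtain ⟨i1, i2, i3, i4⟩ := hit
  have hvB : v ∉ YB := fun h' => hv (h.subB v h')
  refine ⟨?_, fun _ h => h, fun w hw => by simp [h.subB w hw], ?_, ?_, ?_, ?_, ?_⟩
  · simpa [List.nodup_append] using ⟨h.nodup, fun a ha e => hv (e ▸ ha)⟩
  · simp [mergeStepA, Prog.run, h.xs]
  · simp [mergeStepA, Prog.run, h.xp, add_assoc]
  · intro i hi
    rw [List.length_append, List.length_singleton] at hi
    rcases Nat.lt_succ_iff_lt_or_eq.1 hi with hi | rfl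
    · rw [List.getElem_append_left hi]
      have hne : Y[i] ≠ v := fun e => hv (e ▸ List.getElem_mem hi)
      have : (mergeStepA.run s).row (J.xs + i) = s.row (J.xs + i) := by
        simp [mergeStepA, Prog.run, Store.row, h.xp, hi.ne]
      rw [this, h.row i hi]
      simp [rowOf, hne]
    · simp [mergeStepA, Prog.run, Store.row, h.xp, rowOf, i1, i2, i3, i4, hvB, hds]
      omega
  · intro i hi
    rw [List.length_append, List.length_singleton] at hi
    rcases Nat.lt_succ_iff_lt_or_eq.1 hi with hi | rfl
    · rw [List.getElem_append_left hi]
      have hne : Y[i] ≠ v := fun e => hv (e ▸ List.getElem_mem hi)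
      simp [mergeStepA, Prog.run, i1, hne, h.pos i hi]
    · simp [mergeStepA, Prog.run, i1, h.xp]
  · intro w hw
    simp only [List.mem_append, List.mem_singleton, not_or] at hw
    simp [mergeStepA, Prog.run, i1, hw.2, h.pos_lt w hw.1]

theorem Merged.newRow {s : Store} {Y YA YB : List ℕ} (h : J.Merged s Y YA YB)
    (hv : s.reg ʀv ∉ Y) :
    J.Merged (newRow.run s) (Y ++ [s.reg ʀv]) YA YB := by
  have hvA : s.reg ʀv ∉ YA := fun h' => hv (h.subA _ h')
  have hvB : s.reg ʀv ∉ YB := fun h' => hv (h.subB _ h')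
  refine ⟨?_, fun w hw => by simp [h.subA w hw], fun w hw => by simp [h.subB w hw],
    ?_, ?_, ?_, ?_, ?_⟩
  · simpa [List.nodup_append] using ⟨h.nodup, fun a ha e => hv (e ▸ ha)⟩
  · simp [RAM.newRow, Prog.run, h.xs]
  · simp [RAM.newRow, Prog.run, h.xp, add_assoc]
  · intro i hi
    rw [List.length_append, List.length_singleton] at hi
    rcases Nat.lt_succ_iff_lt_or_eq.1 hi with hi | rfl
    · rw [List.getElem_append_left hi]
      rw [← h.row i hi]
      simp [RAM.newRow, Prog.run, Store.row, h.xp, hi.ne]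
    · simp [RAM.newRow, Prog.run, Store.row, h.xp, rowOf, hvA, hvB]
  · intro i hi
    rw [List.length_append, List.length_singleton] at hi
    rcases Nat.lt_succ_iff_lt_or_eq.1 hi with hi | rfl
    · rw [List.getElem_append_left hi]
      have hne : Y[i] ≠ s.reg ʀv := fun e => hv (e ▸ List.getElem_mem hi)
      simp [RAM.newRow, Prog.run, hne, h.pos i hi]
    · simp [RAM.newRow, Prog.run, h.xp]
  · intro w hw
    simp only [List.mem_append, List.mem_singleton, not_or] at hw
    simp [RAM.newRow, Prog.run, hw.2, h.pos_lt w hw.1]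

theorem Merged.addB {s : Store} {Y YA YB : List ℕ} {v : ℕ} (h : J.Merged s Y YA YB) (hv : v ∈ Y)
    (hv' : v ∉ YB) (hr : s.reg ʀv = v) (hds : s.reg ʀds = J.ds)
    (hit : s.item (s.reg ʀz) = (v, J.cB v, stride J.M J.LB v, J.M * stride J.M J.LB v)) :
    J.Merged (addB.run s) Y YA (YB ++ [v]) := by
  simp only [Store.item, Prod.mk.injEq] at hit
  obtain ⟨i1, i2, i3, i4⟩ := hit
  obtain ⟨k, hk, rfl⟩ := List.getElem_of_mem hv
  have hp := h.pos k hk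
  refine ⟨h.nodup, h.subA, ?_, ?_, ?_, ?_, ?_, ?_⟩
  · intro w hw
    rw [List.mem_append, List.mem_singleton] at hw
    rcases hw with hw | rfl
    exacts [h.subB w hw, hv]
  · simp [RAM.addB, Prog.run, h.xs]
  · simp [RAM.addB, Prog.run, h.xp]
  · intro i hi
    have hrow := h.row i hi
    by_cases hik : i = k
    · subst hik
      simp only [Store.row, rowOf, Row.mk.injEq, hv', if_false] at hrow
      simp [RAM.addB, Prog.run, Store.row, hr, hp, i2, i3, i4, hds, rowOf, hrow]
      omega
    · have hne : Y[i] ≠ Y[k] := fun e => hik (h.nodup.getElem_inj_iff.1 e)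
      have : (RAM.addB.run s).row (J.xs + i) = s.row (J.xs + i) := by
        simp [RAM.addB, Prog.run, Store.row, hr, hp, hik]
      rw [this, hrow]
      simp [rowOf, hne]
  · intro i hi
    simp [RAM.addB, Prog.run, h.pos i hi]
  · intro w hw
    simp [RAM.addB, Prog.run, h.pos_lt w hw]

theorem mergeA_spec {s : Store} (hA : J.LA.Nodup) (hds : s.reg ʀds = J.ds)
    (hls : s.arr ᴀLE (s.reg ʀp) = s.arr ᴀLS (s.reg ʀp) + J.LA.length)
    (hit : ItemsAt s J.M (s.arr ᴀLS (s.reg ʀp)) J.LA J.cA) (hxs : s.reg ʀxp = J.xs)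
    (hpos : ∀ v, s.arr ᴀpos v < J.xs) :
    Runs mergeA s (60 * J.LA.length + 20) (fun s' => J.Merged s' J.LA J.LA []) := by
  refine (Runs.flat_seq rfl (Runs.loop_const J.LA.length (fun i s' =>
      s'.reg ʀz = s.arr ᴀLS (s.reg ʀp) + i ∧
      J.Merged s' (J.LA.take i) (J.LA.take i) []) mergeStepA.bound ?_ ?_ ?_)).mono ?_ ?_
  · refine ⟨by simp [Prog.run], by simp, by simp, by simp, ?_, ?_, by simp, by simp, ?_⟩
    · simp [Prog.run, hxs]
    · simp [Prog.run, hxs]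
    · simpa [Prog.run] using hpos
  · rintro i hi s' hf ⟨h1, h2⟩
    refine ⟨?_, Runs.flat rfl le_rfl ⟨?_, ?_⟩⟩
    · simp (disch := decide) [h1, hf.reg, Prog.run, hls]; omega
    · simp [mergeStepA, Prog.run, h1, add_assoc]
    · have htake : J.LA.take (i + 1) = J.LA.take i ++ [J.LA[i]] := by
        rw [List.take_add_one, List.getElem?_eq_getElem hi]; rfl
      rw [htake]
      refine h2.addA ?_ ?_ ?_
      · intro h
        obtain ⟨j, hj, he⟩ := List.getElem_of_mem h
        rw [List.length_take] at hj
        rw [List.getElem_take] at he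
        have := hA.getElem_inj_iff.1 he
        omega
      · simp (disch := decide) [hf.reg, Prog.run, hds]
      · rw [h1, stride_getElem hA hi, ← hit i hi]
        simp (disch := decide) [Store.item, hf.arr, Prog.run]
  · rintro s' hf ⟨h1, -⟩
    simp (disch := decide) [h1, hf.reg, Prog.run, hls]
  · simp [Prog.bound, mergeStepA, Term.cost, Test.cost]; omega
  · rintro s' - ⟨⟨-, h⟩, -⟩
    simpa using h

/-- The merged vertex list. -/
def merged (LA LB : List ℕ) : List ℕ := LA ++ LB.filter (· ∉ LA)

theorem mem_merged {LA LB : List ℕ} {v : ℕ} : v ∈ merged LA LB ↔ v ∈ LA ∨ v ∈ LB := by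
  simp only [merged, List.mem_append, List.mem_filter, decide_eq_true_eq]; tauto

theorem mergeB_spec {s : Store} (hB : J.LB.Nodup) (hds : s.reg ʀds = J.ds)
    (hls : s.arr ᴀLE (s.reg ʀx) = s.arr ᴀLS (s.reg ʀx) + J.LB.length)
    (hit : ItemsAt s J.M (s.arr ᴀLS (s.reg ʀx)) J.LB J.cB)
    (h : J.Merged s J.LA J.LA []) :
    Runs mergeB s (80 * J.LB.length + 20)
      (fun s' => J.Merged s' (merged J.LA J.LB) J.LA J.LB) := by
  refine (Runs.flat_seq rfl (Runs.loop_const J.LB.length (fun i s' =>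
      s'.reg ʀz = s.arr ᴀLS (s.reg ʀx) + i ∧
      J.Merged s' (merged J.LA (J.LB.take i)) J.LA (J.LB.take i)) mergeStepB.bound
      ?_ ?_ ?_)).mono ?_ ?_
  · refine ⟨by simp [Prog.run], ?_⟩
    simp only [merged, List.take_zero, List.filter_nil, List.append_nil]
    exact ⟨h.nodup, h.subA, h.subB, by simpa [Prog.run] using h.xs,
      by simpa [Prog.run] using h.xp, h.row, h.pos, h.pos_lt⟩
  · rintro i hi s' hf ⟨h1, h2⟩
    refine ⟨?_, Runs.flat rfl le_rfl ?_⟩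
    · simp (disch := decide) [h1, hf.reg, Prog.run, hls]; omega
    · have htake : J.LB.take (i + 1) = J.LB.take i ++ [J.LB[i]] := by
        rw [List.take_add_one, List.getElem?_eq_getElem hi]; rfl
      have hnew : J.LB[i] ∉ J.LB.take i := by
        intro h
        obtain ⟨j, hj, he⟩ := List.getElem_of_mem h
        rw [List.length_take] at hj
        rw [List.getElem_take] at he
        have := hB.getElem_inj_iff.1 he
        omega
      set v := J.LB[i] with hv
      have hitem : s'.item (s'.reg ʀz) =
          (v, J.cB v, stride J.M J.LB v, J.M * stride J.M J.LB v) := by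
        rw [h1, hv, stride_getElem hB hi, ← hit i hi]
        simp (disch := decide) [Store.item, hf.arr, Prog.run]
      have hvz : s'.arr ᴀitV (s'.reg ʀz) = v := congrArg Prod.fst hitem
      generalize hs₁ : (ʀv ≔ ᴀitV⁅𝐑 ʀz⁆).run s' = s₁
      have hv₁ : s₁.reg ʀv = v := by rw [← hs₁]; simp [Prog.run, hvz]
      have hz₁ : s₁.reg ʀz = s.arr ᴀLS (s.reg ʀx) + i := by rw [← hs₁]; simp [Prog.run, h1]
      have hds₁ : s₁.reg ʀds = J.ds := by
        rw [← hs₁]; simp (disch := decide) [Prog.run, hf.reg, hds]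
      have hit₁ : s₁.item (s₁.reg ʀz) = (v, J.cB v, stride J.M J.LB v, J.M * stride J.M J.LB v) := by
        rw [hz₁, ← h1, ← hitem, ← hs₁]; simp [Store.item, Prog.run]
      have h₁ : J.Merged s₁ (merged J.LA (J.LB.take i)) J.LA (J.LB.take i) := by
        rw [← hs₁]
        exact ⟨h2.nodup, h2.subA, h2.subB, by simpa [Prog.run] using h2.xs,
          by simpa [Prog.run] using h2.xp, h2.row, h2.pos, h2.pos_lt⟩
      rw [htake]
      by_cases hm : v ∈ merged J.LA (J.LB.take i)
      · have hrun : mergeStepB.run s' = addB.run s₁ := by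
          obtain ⟨k, hk, he⟩ := List.getElem_of_mem hm
          have hp := h₁.pos k hk
          rw [he] at hp
          have hc : ¬ (Test.lt (ᴀpos⁅𝐑 ʀv⁆) (𝐑 ʀxs)).holds s₁ := by
            simp [hv₁, hp, h₁.xs]
          rw [← hs₁] at hc ⊢
          simp only [Prog.run] at hc
          simp only [mergeStepB, Prog.run, hc, if_false]
        have hmem : merged J.LA (J.LB.take i ++ [v]) = merged J.LA (J.LB.take i) := by
          have : v ∈ J.LA := (mem_merged.1 hm).resolve_right hnew
          simp [merged, List.filter_append, this]
        rw [hrun, hmem]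
        exact ⟨by simp [addB, Prog.run, hz₁, add_assoc], h₁.addB hm hnew hv₁ hds₁ hit₁⟩
      · have hrun : mergeStepB.run s' = addB.run (newRow.run s₁) := by
          have hp := h₁.pos_lt v hm
          have hc : (Test.lt (ᴀpos⁅𝐑 ʀv⁆) (𝐑 ʀxs)).holds s₁ := by
            simpa [hv₁, h₁.xs] using hp
          rw [← hs₁] at hc ⊢
          simp only [Prog.run] at hc
          simp only [mergeStepB, Prog.run, hc, if_true]
        have hmem : merged J.LA (J.LB.take i ++ [v]) = merged J.LA (J.LB.take i) ++ [v] := by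
          have : v ∉ J.LA := fun h => hm (mem_merged.2 (Or.inl h))
          simp [merged, List.filter_append, this]
        rw [hrun, hmem]
        have h₂ := h₁.newRow (by rw [hv₁]; exact hm)
        rw [hv₁] at h₂
        refine ⟨by simp [addB, newRow, Prog.run, hz₁, add_assoc], h₂.addB (by simp) hnew ?_ ?_ ?_⟩
        · simp [newRow, Prog.run, hv₁]
        · simp [newRow, Prog.run, hds₁]
        · rw [← hit₁]; simp [newRow, Prog.run, Store.item]
  · rintro s' hf ⟨h1, -⟩
    simp (disch := decide) [h1, hf.reg, Prog.run, hls]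
  · simp [Prog.bound, mergeStepB, newRow, addB, Term.cost, Test.cost]; omega
  · rintro s' - ⟨⟨-, h⟩, -⟩
    simpa using h

end JoinData
end RAM

/-! ### Recovery of solutions, the queue loop and the filling of the new table. -/

namespace RAM

/-- The solution `S` can be recovered from the table cell `q` in `z` steps. -/
inductive Rec (ent : ℕ → Entry) (bp : ℕ → ℕ) (qb cb : ℕ) : ℕ → Finset ℕ → ℕ → Prop where
  | base {q : ℕ} : q < cb → bp q = 0 → Rec ent bp qb cb q ∅ 1
  | step {q zF zA zB : ℕ} {F SA SB : Finset ℕ} : q < cb → Walk ent qb (bp q) F zF →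
      Rec ent bp qb cb (ent (bp q)).a SA zA → Rec ent bp qb cb (ent (bp q)).b SB zB →
      Rec ent bp qb cb q (F ∪ (SA ∪ SB)) (zF + zA + zB + 1)

theorem Rec.mono {ent ent' : ℕ → Entry} {bp bp' : ℕ → ℕ} {qb qb' cb cb' q z : ℕ} {S : Finset ℕ}
    (h : Rec ent bp qb cb q S z) (hq : qb ≤ qb') (hc : cb ≤ cb') (he : ∀ q < qb, ent' q = ent q)
    (hb : ∀ q < cb, bp' q = bp q) : Rec ent' bp' qb' cb' q S z := by
  induction h with
  | base h0 h1 => exact .base (h0.trans_le hc) (by rw [hb _ h0, h1])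
  | step h0 hw _ _ ihA ihB =>
    have e1 := hb _ h0
    have e2 := he _ hw.pos.2
    refine .step (h0.trans_le hc) ?_ ?_ ?_
    · rw [e1]; exact hw.mono hq he
    · rw [e1, e2]; exact ihA
    · rw [e1, e2]; exact ihB

/-- The first level is a single entry at which all three cell numbers are the starts of their
tables. Its predecessor is `0`, a position that is never used for an entry. -/
def initQ : Prog :=
  .setArr ᴀqA (𝐑 ʀqp) (ᴀTB⁅𝐑 ʀp⁆) ;; .setArr ᴀqB (𝐑 ʀqp) (ᴀTB⁅𝐑 ʀx⁆) ;;
  .setArr ᴀqC (𝐑 ʀqp) (𝐑 ʀcp) ;; .setArr ᴀqW (𝐑 ʀqp) (κ 0) ;; .setArr ᴀqP (𝐑 ʀqp) (κ 0) ;;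
  .setArr ᴀqM (𝐑 ʀqp) (κ 0) ;; ʀlo ≔ 𝐑 ʀqp ;; ʀqp ≔ 𝐑 ʀqp + κ 1 ;; ʀhi ≔ 𝐑 ʀqp ;; ʀst ≔ κ 1 ;;
  ʀcs ≔ 𝐑 ʀip ;; ʀxi ≔ 𝐑 ʀxs

def loopX : Prog := .loop (.lt (𝐑 ʀxi) (𝐑 ʀxp)) stepX

def updateCell : Prog := .setArr ᴀval (𝐑 ʀy) (𝐑 ʀw) ;; .setArr ᴀbp (𝐑 ʀy) (𝐑 ʀe)

theorem Prog.run_frame (p : Prog) (h : p.flat = true) (s : Store) : Frame p s (p.run s) := by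
  obtain ⟨t, s', he, -, rfl⟩ := Runs.ofFlat p s h
  exact he.frame

/-- Stored values exceed cardinalities by one, hence the correction by `1` in the sum; the value `0`
means that there is no solution. -/
def evalCell : Prog :=
  (ʀa1 ≔ ᴀval⁅ᴀqA⁅𝐑 ʀe⁆⁆ ;; ʀb1 ≔ ᴀval⁅ᴀqB⁅𝐑 ʀe⁆⁆ ;; ʀy ≔ ᴀqC⁅𝐑 ʀe⁆ ;;
    ʀw ≔ 𝐑 ʀa1 + 𝐑 ʀb1 - κ 1 + ᴀqW⁅𝐑 ʀe⁆) ;;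
  .ite (.eq (𝐑 ʀa1) (κ 0)) .skip (.ite (.eq (𝐑 ʀb1) (κ 0)) .skip
    (.ite (.eq (ᴀval⁅𝐑 ʀy⁆) (κ 0)) updateCell
      (.ite (.lt (𝐑 ʀw) (ᴀval⁅𝐑 ʀy⁆)) updateCell .skip)))

def stepFin : Prog := evalCell ;; ʀe ≔ 𝐑 ʀe + κ 1

def loopFin : Prog := (ʀe ≔ 𝐑 ʀlo) ;; .loop (.lt (𝐑 ʀe) (𝐑 ʀhi)) stepFin

def finish : Prog :=
  .setArr ᴀLS (𝐑 ʀp) (𝐑 ʀcs) ;; .setArr ᴀLE (𝐑 ʀp) (𝐑 ʀip) ;; .setArr ᴀTB (𝐑 ʀp) (𝐑 ʀcp) ;;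
  ʀcp ≔ 𝐑 ʀcp + 𝐑 ʀst

def joinProg : Prog := mergeA ;; mergeB ;; initQ ;; loopX ;; loopFin ;; finish

theorem one_le_prod_map {g : ℕ → ℕ} (hg : ∀ v, 2 ≤ g v) (X : List ℕ) : 1 ≤ (X.map g).prod := by
  induction X with
  | nil => simp
  | cons v X ih =>
    rw [List.map_cons, List.prod_cons]
    exact Nat.mul_pos (by have := hg v; omega) ih

/-- Every vertex at least doubles the product, so the sum over all levels is at most twice the last
term. For the same reason the product bounds the length of the list, which pays for all costs linear
in it. -/
theorem sum_prod_take_le {g : ℕ → ℕ} (hg : ∀ v, 2 ≤ g v) (X : List ℕ) (N : ℕ)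
    (hN : N ≤ X.length) :
    ∑ k ∈ Finset.range N, ((X.take (k + 1)).map g).prod ≤ 2 * ((X.take N).map g).prod ∧
      N < ((X.take N).map g).prod + 1 := by
  induction N with
  | zero => simp
  | succ N ih =>
    obtain ⟨h1, h2⟩ := ih (by omega)
    have ht : X.take (N + 1) = X.take N ++ [X[N]] := by
      rw [List.take_add_one, List.getElem?_eq_getElem (by omega)]; rfl
    have h3 : 2 * ((X.take N).map g).prod ≤ ((X.take (N + 1)).map g).prod := by
      rw [ht, List.map_append, List.prod_append, List.map_singleton, List.prod_singleton, mul_comm]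
      exact Nat.mul_le_mul_left _ (hg _)
    rw [Finset.sum_range_succ]
    refine ⟨by omega, ?_⟩
    have h4 := one_le_prod_map hg (X.take N)
    omega

namespace JoinData

variable {J : JoinData}

/-- Only kept vertices pay for a multiplication. The default of `getD` is never read, as the index
stays below the length. -/
theorem sum_keep_length (K : ℕ) (X : List ℕ) (N : ℕ) (hN : N ≤ X.length) :
    ∑ k ∈ Finset.range N, (if J.cA (X.getD k 0) + J.cB (X.getD k 0) = J.deg (X.getD k 0) then 0
      else K) = K * (J.kp (X.take N)).length := by
  induction N with
  | zero => simp [kp, keep]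
  | succ N ih =>
    have ht : X.take (N + 1) = X.take N ++ [X[N]] := by
      rw [List.take_add_one, List.getElem?_eq_getElem (by omega)]; rfl
    have hd : X.getD N 0 = X[N] := List.getD_eq_getElem _ _ _
    rw [Finset.sum_range_succ, ih (by omega), ht, hd]
    by_cases h : J.cA X[N] + J.cB X[N] = J.deg X[N]
    · rw [kp_append_full h, if_pos h, add_zero]
    · rw [kp_append_keep h, if_neg h, List.length_append, List.length_singleton]; ring

theorem XData.congr {s s' : Store} (h : J.XData s) (hf : Frame stepX s s') : J.XData s' := by
  have hx := h.x
  refine ⟨?_, ?_, ?_, ?_, ?_, ?_, h.nodup⟩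
  · rw [hf.reg _ (by decide), h.M]
  · rw [hf.reg _ (by decide), h.ds]
  · rw [hf.reg _ (by decide), h.xp]
  · intro i hi
    simp (disch := decide) only [hf.arr]
    exact hx i hi
  · intro v hv; rw [hf.arr _ (by decide), h.deg v hv]
  · intro v hv; rw [hf.arr _ (by decide), h.d v hv]

theorem loopX_spec {s₀ s : Store} (hX : J.XData s) (hxi : s.reg ʀxi = J.xs)
    (h : J.Level s₀ s []) :
    Runs loopX s (20 * J.M * (J.kp J.X).length + 600 * (J.X.map J.choices).prod)
      (J.Level s₀ · J.X) := by
  have := Runs.loop_sum (c := .lt (𝐑 ʀxi) (𝐑 ʀxp)) (p := stepX) (s₀ := s) J.X.length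
    (fun k s' => J.Level s₀ s' (J.X.take k) ∧ s'.reg ʀxi = J.xs + k)
    (fun k => (if J.cA (J.X.getD k 0) + J.cB (J.X.getD k 0) = J.deg (J.X.getD k 0) then 0
      else 20 * J.M) + 210 * ((J.X.take (k + 1)).map J.choices).prod + 120)
    (by simpa using ⟨h, hxi⟩) ?_ ?_
  · refine this.mono ?_ (fun s' _ h' => by simpa using h'.1.1)
    have h1 := sum_prod_take_le J.two_le_choices J.X J.X.length le_rfl
    have h2 := J.sum_keep_length (20 * J.M) J.X J.X.length le_rfl
    rw [List.take_length] at h1 h2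
    simp only [Finset.sum_add_distrib, ← Finset.mul_sum, h2, Finset.sum_const, Finset.card_range,
      smul_eq_mul, Test.cost, Term.cost]
    have h3 := one_le_prod_map J.two_le_choices J.X
    omega
  · rintro k hk s' hf ⟨h1, h2⟩
    have hX' := hX.congr hf
    refine ⟨by simp [h2, hX'.xp, hk], ?_⟩
    rw [List.getD_eq_getElem _ _ hk]
    exact stepX_spec hk hX' h2 h1
  · rintro s' hf ⟨-, h2⟩
    simp [h2, (hX.congr hf).xp]

end JoinData

/-- The value which the entry at `q` yields for its cell of the new table. -/
def Store.cand (s : Store) (q : ℕ) : ℕ :=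
  s.arr ᴀval (s.ent q).a + s.arr ᴀval (s.ent q).b - 1 + (s.ent q).w

def Store.Valid (s : Store) (q : ℕ) : Prop :=
  s.arr ᴀval (s.ent q).a ≠ 0 ∧ s.arr ᴀval (s.ent q).b ≠ 0

/-- The new table, when the entries before `e` have been evaluated. -/
structure Filled (s s' : Store) (tC lo e : ℕ) : Prop where
  old_val : ∀ z < tC, s'.arr ᴀval z = s.arr ᴀval z
  old_bp : ∀ z < tC, s'.arr ᴀbp z = s.arr ᴀbp z
  sound : ∀ z, tC ≤ z → s'.arr ᴀval z ≠ 0 → ∃ q, lo ≤ q ∧ q < e ∧ s.Valid q ∧ (s.ent q).c = z ∧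
    s'.arr ᴀval z = s.cand q ∧ s'.arr ᴀbp z = q
  complete : ∀ q, lo ≤ q → q < e → s.Valid q → s'.arr ᴀval (s.ent q).c ≠ 0 ∧
    s'.arr ᴀval (s.ent q).c ≤ s.cand q

/-- By `hent` the entries read cells below `tC` and write cells from `tC` on, so the old tables do
not change while the new one is being filled. -/
theorem loopFin_spec {s : Store} {tC : ℕ} (hlo : s.reg ʀlo ≤ s.reg ʀhi)
    (hfresh : ∀ z, tC ≤ z → s.arr ᴀval z = 0)
    (hent : ∀ q, s.reg ʀlo ≤ q → q < s.reg ʀhi →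
      (s.ent q).a < tC ∧ (s.ent q).b < tC ∧ tC ≤ (s.ent q).c) :
    Runs loopFin s (70 * (s.reg ʀhi - s.reg ʀlo) + 20)
      (fun s' => Filled s s' tC (s.reg ʀlo) (s.reg ʀhi)) := by
  refine (Runs.flat_seq rfl (Runs.loop_const (s.reg ʀhi - s.reg ʀlo) (fun r s' =>
      s'.reg ʀe = s.reg ʀlo + r ∧ Filled s s' tC (s.reg ʀlo) (s.reg ʀlo + r)) stepFin.bound
      ?_ ?_ ?_)).mono ?_ ?_
  · refine ⟨by simp [Prog.run], ⟨fun _ _ => rfl, fun _ _ => rfl, fun z hz h => ?_,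
      fun q hq hq' => by omega⟩⟩
    exact absurd (hfresh z hz) h
  · rintro r hr s' hf ⟨h1, h2⟩
    refine ⟨?_, Runs.flat rfl le_rfl ?_⟩
    · simp (disch := decide) [h1, hf.reg, Prog.run]; omega
    obtain ⟨ha, hb, hc⟩ := hent (s.reg ʀlo + r) (by omega) (by omega)
    set q := s.reg ʀlo + r with hq
    have e1 : s'.arr ᴀqA q = (s.ent q).a := by rw [hf.arr _ (by decide)]; rfl
    have e2 : s'.arr ᴀqB q = (s.ent q).b := by rw [hf.arr _ (by decide)]; rfl
    have e3 : s'.arr ᴀqC q = (s.ent q).c := by rw [hf.arr _ (by decide)]; rfl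
    have e4 : s'.arr ᴀqW q = (s.ent q).w := by rw [hf.arr _ (by decide)]; rfl
    have va := h2.old_val _ ha
    have vb := h2.old_val _ hb
    have hq1 : s.reg ʀlo + (r + 1) = q + 1 := by omega
    rw [hq1]
    -- A round ends in one of two ways: the cell stays, or it is overwritten. The five branches of
    -- the program reduce to these.
    have keepCase : s'.arr ᴀval = (stepFin.run s').arr ᴀval →
        s'.arr ᴀbp = (stepFin.run s').arr ᴀbp →
        (s.Valid q → s'.arr ᴀval (s.ent q).c ≠ 0 ∧ s'.arr ᴀval (s.ent q).c ≤ s.cand q) →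
        Filled s (stepFin.run s') tC (s.reg ʀlo) (q + 1) := by
      intro hv hbp hcomp
      refine ⟨fun z hz => by rw [← hv, h2.old_val z hz], fun z hz => by rw [← hbp, h2.old_bp z hz],
        fun z hz hne => ?_, fun p hp hp' hval => ?_⟩
      · rw [← hv] at hne ⊢
        rw [← hbp]
        obtain ⟨p, h3, h4, h5⟩ := h2.sound z hz hne
        exact ⟨p, h3, by omega, h5⟩
      · rw [← hv]
        rcases Nat.lt_succ_iff_lt_or_eq.1 hp' with h | rfl
        exacts [h2.complete p hp h hval, hcomp hval]
    have updCase : (stepFin.run s').arr ᴀval = Function.update (s'.arr ᴀval) (s.ent q).c (s.cand q) →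
        (stepFin.run s').arr ᴀbp = Function.update (s'.arr ᴀbp) (s.ent q).c q →
        s.Valid q → (s'.arr ᴀval (s.ent q).c ≠ 0 → s.cand q ≤ s'.arr ᴀval (s.ent q).c) →
        Filled s (stepFin.run s') tC (s.reg ʀlo) (q + 1) := by
      intro hv hbp hvalid hle
      have hpos : s.cand q ≠ 0 := by
        have h3 := hvalid.1; have h4 := hvalid.2
        unfold Store.cand; omega
      refine ⟨fun z hz => ?_, fun z hz => ?_, fun z hz hne => ?_, fun p hp hp' hval => ?_⟩
      · rw [hv, Function.update_of_ne (by omega), h2.old_val z hz]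
      · rw [hbp, Function.update_of_ne (by omega), h2.old_bp z hz]
      · by_cases hz' : z = (s.ent q).c
        · subst hz'
          exact ⟨q, by omega, by omega, hvalid, rfl, by rw [hv, Function.update_self],
            by rw [hbp, Function.update_self]⟩
        · rw [hv, Function.update_of_ne hz'] at hne ⊢
          rw [hbp, Function.update_of_ne hz']
          obtain ⟨p, h3, h4, h5⟩ := h2.sound z hz hne
          exact ⟨p, h3, by omega, h5⟩
      · rw [hv]
        by_cases hz' : (s.ent p).c = (s.ent q).c
        · rw [hz', Function.update_self]
          refine ⟨hpos, ?_⟩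
          rcases Nat.lt_succ_iff_lt_or_eq.1 hp' with h | rfl
          · have := h2.complete p hp h hval
            rw [hz'] at this
            exact (hle this.1).trans this.2
          · exact le_rfl
        · rw [Function.update_of_ne hz']
          rcases Nat.lt_succ_iff_lt_or_eq.1 hp' with h | rfl
          exacts [h2.complete p hp h hval, absurd rfl hz']
    have hreg : (stepFin.run s').reg ʀe = q + 1 := by
      rw [← h1, ← (evalCell.run_frame rfl s').reg ʀe (by decide)]
      simp [stepFin, Prog.run]
    refine ⟨hreg, ?_⟩
    by_cases c1 : s.arr ᴀval (s.ent q).a = 0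
    · refine keepCase ?_ ?_ (fun h => absurd c1 h.1)
      · simp [stepFin, evalCell, Prog.run, h1, e1, va, c1]
      · simp [stepFin, evalCell, Prog.run, h1, e1, va, c1]
    by_cases c2 : s.arr ᴀval (s.ent q).b = 0
    · refine keepCase ?_ ?_ (fun h => absurd c2 h.2)
      · simp [stepFin, evalCell, Prog.run, h1, e1, va, c1, e2, vb, c2]
      · simp [stepFin, evalCell, Prog.run, h1, e1, va, c1, e2, vb, c2]
    by_cases c3 : s'.arr ᴀval (s.ent q).c = 0
    · refine updCase ?_ ?_ ⟨c1, c2⟩ (fun h => absurd c3 h)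
      · simp [stepFin, evalCell, Prog.run, h1, e1, va, c1, e2, vb, c2, e3, c3, e4, updateCell,
          Store.setArr_arr, Store.cand]
      · simp [stepFin, evalCell, Prog.run, h1, e1, va, c1, e2, vb, c2, e3, c3, e4, updateCell,
          Store.setArr_arr]
    by_cases c4 : s.cand q < s'.arr ᴀval (s.ent q).c
    · have c4' := c4
      unfold Store.cand at c4'
      refine updCase ?_ ?_ ⟨c1, c2⟩ (fun _ => c4.le)
      · simp [stepFin, evalCell, Prog.run, h1, e1, va, c1, e2, vb, c2, e3, c3, e4, c4', updateCell,
          Store.setArr_arr, Store.cand]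
      · simp [stepFin, evalCell, Prog.run, h1, e1, va, c1, e2, vb, c2, e3, c3, e4, c4', updateCell,
          Store.setArr_arr]
    · have c4' := c4
      unfold Store.cand at c4'
      refine keepCase ?_ ?_ (fun _ => ⟨c3, not_lt.1 c4⟩)
      · simp [stepFin, evalCell, Prog.run, h1, e1, va, c1, e2, vb, c2, e3, c3, e4, c4']
      · simp [stepFin, evalCell, Prog.run, h1, e1, va, c1, e2, vb, c2, e3, c3, e4, c4']
  · rintro s' hf ⟨h1, -⟩
    simp (disch := decide) [h1, hf.reg, Prog.run]; omega
  · simp [Prog.bound, stepFin, evalCell, updateCell, Term.cost, Test.cost]; omega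
  · rintro s' - ⟨⟨-, h⟩, -⟩
    rwa [Nat.add_sub_cancel' hlo] at h

end RAM

/-! ### Objects in memory and the specification of a complete join. -/

namespace RAM

/-- The instance: the ends of the edges, the demands, the number of edges, the maximum demand, and
the base `M` of the tables. -/
structure Inst where
  eu : ℕ → ℕ
  ev : ℕ → ℕ
  d : ℕ → ℕ
  m : ℕ
  ds : ℕ
  M : ℕ
  le_ds : ∀ v, d v ≤ ds
  ds_lt : ds < M

def Inst.inc (I : Inst) (P : Finset ℕ) (v : ℕ) : ℕ := incCount I.eu I.ev P v

def Inst.deg (I : Inst) (v : ℕ) : ℕ := I.inc (Finset.range I.m) v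

/-- The recovery relation of a store. -/
def Store.Rec (s : Store) : ℕ → Finset ℕ → ℕ → Prop :=
  RAM.Rec s.ent (s.arr ᴀbp) (s.reg ʀqp) (s.reg ʀcp)

/-- The data which all joins share. -/
structure Heap (I : Inst) (s : Store) : Prop where
  M : s.reg ʀM = I.M
  ds : s.reg ʀds = I.ds
  deg : ∀ v, s.arr ᴀdeg v = I.deg v
  d : ∀ v, s.arr ᴀd v = I.d v
  pos : ∀ v, s.arr ᴀpos v < s.reg ʀxp
  qp : 0 < s.reg ʀqp
  fresh : ∀ z, s.reg ʀcp ≤ z → s.arr ᴀval z = 0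

/-- Node `y` carries the vertex list `L` and a correct table for the part `P`. -/
structure Obj (I : Inst) (s : Store) (y : ℕ) (P : Finset ℕ) (L : List ℕ) (Z : ℕ) : Prop where
  list : BoundaryList I.eu I.ev I.m P L
  le : s.arr ᴀLE y = s.arr ᴀLS y + L.length
  le_ip : s.arr ᴀLE y ≤ s.reg ʀip
  items : ItemsAt s I.M (s.arr ᴀLS y) L (I.inc P)
  le_cp : s.arr ᴀTB y + (2 * I.M) ^ L.length ≤ s.reg ʀcp
  table : TableFor I.eu I.ev I.d I.M I.ds P L (s.arr ᴀTB y) (s.arr ᴀval) s.Rec Z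

/-- The data of `s` are still present in `s'`. -/
structure Extends (s s' : Store) : Prop where
  items : ∀ z < s.reg ʀip, s'.item z = s.item z
  ent : ∀ q < s.reg ʀqp, s'.ent q = s.ent q
  val : ∀ z < s.reg ʀcp, s'.arr ᴀval z = s.arr ᴀval z
  bp : ∀ z < s.reg ʀcp, s'.arr ᴀbp z = s.arr ᴀbp z
  ip : s.reg ʀip ≤ s'.reg ʀip
  qp : s.reg ʀqp ≤ s'.reg ʀqp
  cp : s.reg ʀcp ≤ s'.reg ʀcp

theorem Extends.recover {s s' : Store} (h : Extends s s') {q z : ℕ} {S : Finset ℕ}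
    (hr : s.Rec q S z) : s'.Rec q S z :=
  Rec.mono hr h.qp h.cp h.ent h.bp

/-- Memory only grows: list, table and recovery data of an object lie below the allocation pointers,
where `Extends` preserves everything. -/
theorem Obj.mono {I : Inst} {s s' : Store} {y Z : ℕ} {P : Finset ℕ} {L : List ℕ}
    (h : Obj I s y P L Z) (he : Extends s s') (h1 : s'.arr ᴀLS y = s.arr ᴀLS y)
    (h2 : s'.arr ᴀLE y = s.arr ᴀLE y) (h3 : s'.arr ᴀTB y = s.arr ᴀTB y) : Obj I s' y P L Z := by
  have hM : 0 < I.M := (Nat.zero_le _).trans_lt I.ds_lt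
  refine ⟨h.list, by rw [h1, h2, h.le], by rw [h2]; exact h.le_ip.trans he.ip, ?_,
    by rw [h3]; exact h.le_cp.trans he.cp, ?_, ?_⟩
  · intro i hi
    have := h.le; have := h.le_ip
    rw [h1, he.items _ (by omega), h.items i hi]
  · intro σ c hσ hc hv
    have hlt := (cellAt_lt (b := s.arr ᴀTB y) h.list.nodup hσ
      (fun v hv => (hc v hv).1.trans_lt I.ds_lt)).trans_le h.le_cp
    rw [h3] at hv ⊢
    rw [he.val _ hlt] at hv ⊢
    obtain ⟨S, z, hr, h'⟩ := h.table.sound σ c hσ hc hv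
    exact ⟨S, z, he.recover hr, h'⟩
  · intro g c hg hc hf
    have hlt := (cellAt_lt (b := s.arr ᴀTB y) h.list.nodup (fun v _ => hg v)
      (fun v _ => (hc v).trans_lt I.ds_lt)).trans_le h.le_cp
    rw [h3, he.val _ hlt]
    exact h.table.complete g c hg hc hf

/-- The data of the join of the objects at `p` and `x` in the store `s`. -/
def Inst.joinData (I : Inst) (s : Store) (PA PB : Finset ℕ) (LA LB : List ℕ) : JoinData where
  eu := I.eu
  ev := I.ev
  d := I.d
  m := I.m
  ds := I.ds
  M := I.M
  PA := PA
  PB := PB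
  LA := LA
  LB := LB
  X := JoinData.merged LA LB
  tA := s.arr ᴀTB (s.reg ʀp)
  tB := s.arr ᴀTB (s.reg ʀx)
  tC := s.reg ʀcp
  xs := s.reg ʀxp
  q0 := s.reg ʀqp
  ip0 := s.reg ʀip

/-- The cost of a join. -/
def Inst.joinCost (I : Inst) (PA PB : Finset ℕ) (LA LB : List ℕ) : ℕ :=
  ((JoinData.merged LA LB).map fun v =>
    2 * ((min I.ds (I.inc PA v) + 1) * (min I.ds (I.inc PB v) + 1))).prod

theorem nodup_merged {LA LB : List ℕ} (hA : LA.Nodup) (hB : LB.Nodup) :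
    (JoinData.merged LA LB).Nodup := by
  rw [JoinData.merged, List.nodup_append]
  refine ⟨hA, hB.filter _, fun a ha b hb e => ?_⟩
  rw [List.mem_filter] at hb
  subst e
  simp [ha] at hb

theorem merged_length_le {LA LB : List ℕ} :
    LA.length ≤ (JoinData.merged LA LB).length := by
  simp [JoinData.merged]

theorem merged_length_le' {LA LB : List ℕ} (hA : LA.Nodup) (hB : LB.Nodup) :
    LB.length ≤ (JoinData.merged LA LB).length := by
  rw [← List.toFinset_card_of_nodup hB, ← List.toFinset_card_of_nodup (nodup_merged hA hB)]
  refine Finset.card_le_card fun v hv => ?_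
  rw [List.mem_toFinset] at hv ⊢
  exact JoinData.mem_merged.2 (Or.inr hv)

/-- The machine meets the hypotheses of `TableFor.join`: soundness of the last queue level together
with that of the filled table gives `h1`, the two completeness statements give `h2`. -/
theorem joinProg_spec {I : Inst} {s : Store} {PA PB : Finset ℕ} {LA LB : List ℕ} {ZA ZB : ℕ}
    (hH : Heap I s) (hA : Obj I s (s.reg ʀp) PA LA ZA) (hB : Obj I s (s.reg ʀx) PB LB ZB)
    (hAB : Disjoint PA PB) :
    Runs joinProg s (20 * I.M * (keep I.eu I.ev I.m PA PB (JoinData.merged LA LB)).length +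
      1000 * I.joinCost PA PB LA LB)
      (fun s' => Heap I s' ∧ Extends s s' ∧
        Obj I s' (s.reg ʀp) (PA ∪ PB) (keep I.eu I.ev I.m PA PB (JoinData.merged LA LB))
          (ZA + ZB + (JoinData.merged LA LB).length + 2) ∧
        ∀ y, y ≠ s.reg ʀp → s'.arr ᴀLS y = s.arr ᴀLS y ∧ s'.arr ᴀLE y = s.arr ᴀLE y ∧
          s'.arr ᴀTB y = s.arr ᴀTB y) := by
  have hM : 0 < I.M := (Nat.zero_le _).trans_lt I.ds_lt
  set J := I.joinData s PA PB LA LB with hJ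
  have hXnd : J.X.Nodup := nodup_merged hA.list.nodup hB.list.nodup
  have hXmem : ∀ v, v ∈ J.X ↔ v ∈ LA ∨ v ∈ LB := fun v => JoinData.mem_merged
  have hprod : I.joinCost PA PB LA LB = (J.X.map J.choices).prod := rfl
  have hlen : J.X.length ≤ I.joinCost PA PB LA LB := by
    have := (sum_prod_take_le J.two_le_choices J.X J.X.length le_rfl).2
    rw [List.take_length] at this
    rw [hprod]; omega
  have hlenA : LA.length ≤ J.X.length := merged_length_le
  have hlenB : LB.length ≤ J.X.length := merged_length_le' hA.list.nodup hB.list.nodup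
  have hpos : 1 ≤ I.joinCost PA PB LA LB := one_le_prod_map J.two_le_choices J.X
  have r1 := JoinData.mergeA_spec (J := J) (s := s) hA.list.nodup hH.ds hA.le hA.items rfl hH.pos
  refine (r1.seq fun s₁ f₁ h₁ => (JoinData.mergeB_spec (J := J) hB.list.nodup
    (by rw [f₁.reg _ (by decide), hH.ds]; rfl) ?_ ?_ h₁).seq fun s₂ f₂ h₂ =>
    (Runs.flat (p := initQ) (B := initQ.bound) (Q := fun s' => s' = initQ.run s₂) rfl le_rfl
      rfl).seq fun s₃ f₃ h₃ => (JoinData.loopX_spec (J := J) (s₀ := s) ?_ ?_ ?_).seq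
      fun s₄ f₄ h₄ => ((loopFin_spec (s := s₄) (tC := J.tC) h₄.lo_le ?_ ?_).mono
      (B' := 70 * (J.X.map J.choices).prod + 20) ?_ (fun _ _ h => h)).seq fun s₅ f₅ h₅ =>
      Runs.flat (B := finish.bound) rfl le_rfl ?_).mono ?_ (fun _ _ h => h)
  · simp (disch := decide) [f₁.reg, f₁.arr]; exact hB.le
  · have := hB.items
    intro i hi
    have h := this i hi
    simp (disch := decide) [Store.item, f₁.reg, f₁.arr] at h ⊢
    exact h
  · have zA : ∀ v ∈ J.X, v ∉ LA → J.cA v = 0 := fun v hv h =>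
      hA.list.incCount_eq_zero hAB hB.list h (((hXmem v).1 hv).resolve_left h)
    have zB : ∀ v ∈ J.X, v ∉ LB → J.cB v = 0 := fun v hv h =>
      hB.list.incCount_eq_zero hAB.symm hA.list h (((hXmem v).1 hv).resolve_right h)
    refine ⟨?_, ?_, ?_, ?_, ?_, ?_, hXnd⟩
    · simp (disch := decide) [f₁.reg, f₂.reg, f₃.reg]; exact hH.M
    · simp (disch := decide) [f₁.reg, f₂.reg, f₃.reg]; exact hH.ds
    · rw [f₃.reg _ (by decide)]; exact h₂.xp
    · intro i hi
      have hr := h₂.row i hi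
      have hmem : J.X[i] ∈ J.X := List.getElem_mem hi
      change s₂.row (J.xs + i) = J.rowOf LA LB J.X[i] at hr
      simp only [Store.row, JoinData.rowOf, Row.mk.injEq] at hr
      obtain ⟨g1, g2, g3, g4, g5, g6, g7, g8⟩ := hr
      simp (disch := decide) only [f₃.arr]
      have eA : (if J.X[i] ∈ LA then J.cA J.X[i] else 0) = J.cA J.X[i] := by
        split_ifs with h
        exacts [rfl, (zA _ hmem h).symm]
      have eB : (if J.X[i] ∈ LB then J.cB J.X[i] else 0) = J.cB J.X[i] := by
        split_ifs with h
        exacts [rfl, (zB _ hmem h).symm]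
      have sA : stride J.M J.LA J.X[i] = if J.X[i] ∈ LA then stride J.M J.LA J.X[i] else 0 := by
        split_ifs with h
        exacts [rfl, if_neg h]
      have sB : stride J.M J.LB J.X[i] = if J.X[i] ∈ LB then stride J.M J.LB J.X[i] else 0 := by
        split_ifs with h
        exacts [rfl, if_neg h]
      refine ⟨g1, by rw [g2, eA, eB], ?_, ?_, by rw [g5, ← sA], ?_, by rw [g7, ← sB], ?_⟩
      · rw [g3, ← eA]; split_ifs <;> simp
      · rw [g4, ← eB]; split_ifs <;> simp
      · rw [g6, sA]; split_ifs <;> simp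
      · rw [g8, sB]; split_ifs <;> simp
    · intro v _
      simp (disch := decide) only [f₁.arr, f₂.arr, f₃.arr]; exact hH.deg v
    · intro v _
      simp (disch := decide) only [f₁.arr, f₂.arr, f₃.arr]; exact hH.d v
  · rw [h₃]
    simpa [initQ, Prog.run] using h₂.xs
  · have q2 : s₂.reg ʀqp = s.reg ʀqp := by
      simp (disch := decide) only [f₁.reg, f₂.reg]
    have ip2 : s₂.reg ʀip = s.reg ʀip := by
      simp (disch := decide) only [f₁.reg, f₂.reg]
    have hroot : s₃.ent (s.reg ʀqp) = ⟨J.tA, J.tB, J.tC, 0, 0, 0⟩ := by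
      rw [h₃]
      simp (disch := decide) [initQ, Prog.run, Store.ent, q2, f₁.reg, f₂.reg, f₁.arr, f₂.arr]
      exact ⟨rfl, rfl, rfl⟩
    have hlo : s₃.reg ʀlo = s.reg ʀqp := by rw [h₃]; simp [initQ, Prog.run, q2]
    have hhi : s₃.reg ʀhi = s.reg ʀqp + 1 := by rw [h₃]; simp [initQ, Prog.run, q2]
    have hqp : s₃.reg ʀqp = s.reg ʀqp + 1 := by rw [h₃]; simp [initQ, Prog.run, q2]
    have hE : ∀ σ i j, J.EntryFor [] σ i j (s₃.ent (s.reg ʀqp)) := fun σ i j => by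
      rw [hroot]
      exact ⟨by simp [JoinData.psum], by simp [JoinData.psum], by simp [JoinData.kp, keep, cellAt],
        by simp [JoinData.mks, marks]⟩
    refine ⟨by omega, by omega, hlo.symm.le, ?_, ?_, by simp [hlo, hhi], ?_, ?_, ?_, ?_, ?_⟩
    · intro q hq hq'
      obtain rfl : q = s.reg ʀqp := by omega
      refine ⟨0, 0, 0, by simp, hE _ _ _, ?_⟩
      have : J.mks [] 0 = ∅ := by simp [JoinData.mks, marks]
      rw [this]
      exact .root hH.qp (by omega) (by rw [hroot]) (by rw [hroot])
    · exact fun σ i j _ => ⟨s.reg ʀqp, by omega, by omega, hE σ i j⟩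
    · rw [h₃]; simp [initQ, Prog.run, JoinData.kp, keep]
    · rw [f₃.reg _ (by decide), ip2]; simp [JoinData.kp, keep]; rfl
    · intro i hi; simp [JoinData.kp, keep] at hi
    · intro z _
      simp (disch := decide) only [Store.item, f₁.arr, f₂.arr, f₃.arr]
    · intro q hq
      change q < s.reg ʀqp at hq
      rw [h₃]
      simp (disch := decide) [initQ, Prog.run, Store.ent, q2, hq.ne, f₁.arr, f₂.arr]
  · intro z hz
    simp (disch := decide) only [f₁.arr, f₂.arr, f₃.arr, f₄.arr]
    exact hH.fresh z hz
  · intro q hq hq'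
    obtain ⟨σ, i, j, hch, hE, -⟩ := h₄.sound q hq hq'
    refine ⟨?_, ?_, by rw [hE.c]; exact Nat.le_add_right _ _⟩
    · rw [hE.a, JoinData.psum_eq_cellAt (J := J) (L := J.LA) fun v hv => (hXmem v).2 (Or.inl hv)]
      refine (cellAt_lt hA.list.nodup (fun v hv => (hch v ((hXmem v).2 (Or.inl hv))).1)
        fun v hv => (hch v ((hXmem v).2 (Or.inl hv))).2.1.1.trans_lt I.ds_lt).trans_le hA.le_cp
    · rw [hE.b, JoinData.psum_eq_cellAt (J := J) (L := J.LB) fun v hv => (hXmem v).2 (Or.inr hv)]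
      refine (cellAt_lt hB.list.nodup (fun v hv => (hch v ((hXmem v).2 (Or.inr hv))).1)
        fun v hv => (hch v ((hXmem v).2 (Or.inr hv))).2.2.1.1.trans_lt I.ds_lt).trans_le hB.le_cp
  · have := h₄.count; omega
  · have f₆ : Frame finish s₅ (finish.run s₅) := Prog.run_frame finish rfl s₅
    have hp : s₅.reg ʀp = s.reg ʀp := by
      simp (disch := decide) only [f₁.reg, f₂.reg, f₃.reg, f₄.reg, f₅.reg]
    have hLS : ∀ a ∈ [ᴀLS, ᴀLE, ᴀTB], s₅.arr a = s.arr a := by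
      intro a ha
      simp only [List.mem_cons, List.not_mem_nil, or_false] at ha
      rcases ha with rfl | rfl | rfl <;>
        simp (disch := decide) only [f₁.arr, f₂.arr, f₃.arr, f₄.arr, f₅.arr]
    have hcs : s₅.reg ʀcs = s.reg ʀip := by
      rw [f₅.reg _ (by decide), f₄.reg _ (by decide), h₃]
      simp (disch := decide) [initQ, Prog.run, f₁.reg, f₂.reg]
    have hcp : s₅.reg ʀcp = s.reg ʀcp := by
      simp (disch := decide) only [f₁.reg, f₂.reg, f₃.reg, f₄.reg, f₅.reg]
    have hip : s₅.reg ʀip = s.reg ʀip + (J.kp J.X).length := by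
      rw [f₅.reg _ (by decide)]; exact h₄.ip
    have hst : s₅.reg ʀst = (2 * I.M) ^ (J.kp J.X).length := by
      rw [f₅.reg _ (by decide)]; exact h₄.st
    have hqp : s₅.reg ʀqp = s₄.reg ʀqp := f₅.reg _ (by decide)
    have hval : (finish.run s₅).arr ᴀval = s₅.arr ᴀval := f₆.arr _ (by decide)
    have hbp : (finish.run s₅).arr ᴀbp = s₅.arr ᴀbp := f₆.arr _ (by decide)
    have hval₄ : s₄.arr ᴀval = s.arr ᴀval := by
      simp (disch := decide) only [f₁.arr, f₂.arr, f₃.arr, f₄.arr]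
    have hbp₄ : s₄.arr ᴀbp = s.arr ᴀbp := by
      simp (disch := decide) only [f₁.arr, f₂.arr, f₃.arr, f₄.arr]
    have hitem : ∀ z, (finish.run s₅).item z = s₄.item z := fun z => by
      simp (disch := decide) only [Store.item, f₅.arr, f₆.arr]
    have hent : ∀ q, (finish.run s₅).ent q = s₄.ent q := fun q => by
      simp (disch := decide) only [Store.ent, f₅.arr, f₆.arr]
    have hpos : (finish.run s₅).arr ᴀpos = s₂.arr ᴀpos := by
      simp (disch := decide) only [f₃.arr, f₄.arr, f₅.arr, f₆.arr]
    have hxp : (finish.run s₅).reg ʀxp = s₂.reg ʀxp := by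
      simp (disch := decide) only [f₃.reg, f₄.reg, f₅.reg, f₆.reg]
    have hM' : (finish.run s₅).reg ʀM = s.reg ʀM := by
      simp (disch := decide) only [f₁.reg, f₂.reg, f₃.reg, f₄.reg, f₅.reg, f₆.reg]
    have hds' : (finish.run s₅).reg ʀds = s.reg ʀds := by
      simp (disch := decide) only [f₁.reg, f₂.reg, f₃.reg, f₄.reg, f₅.reg, f₆.reg]
    have hdeg' : (finish.run s₅).arr ᴀdeg = s.arr ᴀdeg := by
      simp (disch := decide) only [f₁.arr, f₂.arr, f₃.arr, f₄.arr, f₅.arr, f₆.arr]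
    have hd' : (finish.run s₅).arr ᴀd = s.arr ᴀd := by
      simp (disch := decide) only [f₁.arr, f₂.arr, f₃.arr, f₄.arr, f₅.arr, f₆.arr]
    have hcp' : (finish.run s₅).reg ʀcp = s.reg ʀcp + (2 * I.M) ^ (J.kp J.X).length := by
      rw [← hcp, ← hst]; simp [finish, Prog.run]
    have hip' : (finish.run s₅).reg ʀip = s.reg ʀip + (J.kp J.X).length := by
      rw [f₆.reg _ (by decide), hip]
    have hqp' : (finish.run s₅).reg ʀqp = s₄.reg ʀqp := by rw [f₆.reg _ (by decide), hqp]
    have hLS' : (finish.run s₅).arr ᴀLS = Function.update (s.arr ᴀLS) (s.reg ʀp) (s.reg ʀip) := by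
      rw [← hLS ᴀLS (by simp), ← hp, ← hcs]; simp [finish, Prog.run, Store.setArr_arr]
    have hLE' : (finish.run s₅).arr ᴀLE = Function.update (s.arr ᴀLE) (s.reg ʀp)
        (s.reg ʀip + (J.kp J.X).length) := by
      rw [← hLS ᴀLE (by simp), ← hp, ← hip]; simp [finish, Prog.run, Store.setArr_arr]
    have hTB' : (finish.run s₅).arr ᴀTB = Function.update (s.arr ᴀTB) (s.reg ʀp) (s.reg ʀcp) := by
      rw [← hLS ᴀTB (by simp), ← hp, ← hcp]; simp [finish, Prog.run, Store.setArr_arr]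
    have hq₄ : s.reg ʀqp ≤ s₄.reg ʀlo ∧ s₄.reg ʀlo ≤ s₄.reg ʀqp :=
      ⟨h₄.le_lo, h₄.hi_eq ▸ h₄.lo_le⟩
    have hExt : Extends s (finish.run s₅) := by
      refine ⟨fun z hz => ?_, fun q hq => ?_, fun z hz => ?_, fun z hz => ?_, by omega, by omega,
        by omega⟩
      · rw [hitem]; exact h₄.old_items z hz
      · rw [hent]; exact h₄.old_ent q hq
      · rw [hval, h₅.old_val z hz, hval₄]
      · rw [hbp, h₅.old_bp z hz, hbp₄]
    have hlist := BoundaryList.join hAB hA.list hB.list hXnd hXmem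
    refine ⟨⟨by rw [hM', hH.M], by rw [hds', hH.ds], fun v => by rw [hdeg', hH.deg],
      fun v => by rw [hd', hH.d], ?_, by have := hH.qp; omega, ?_⟩, hExt,
      ⟨hlist, ?_, ?_, ?_, ?_, ?_⟩, ?_⟩
    · intro v
      rw [hpos, hxp, h₂.xp]
      by_cases hv : v ∈ JoinData.merged J.LA J.LB
      · obtain ⟨i, hi, rfl⟩ := List.getElem_of_mem hv
        rw [h₂.pos i hi]; omega
      · have := h₂.pos_lt v hv; omega
    · intro z hz
      rw [hval]
      -- A nonzero cell stems from a queue entry, and by `cellAt_lt` its cell lies inside the new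
      -- table; beyond it, memory is still zero. This is why no table needs initialising.
      by_contra hne
      obtain ⟨q, hq, hq', -, hc, -⟩ := h₅.sound z (by rw [hcp'] at hz; exact (Nat.le_add_right _ _).trans hz) hne
      obtain ⟨σ, i, j, hch, hE, -⟩ := h₄.sound q hq hq'
      have := cellAt_lt (M := I.M) (b := s.reg ʀcp) (L := J.kp J.X) (σ := σ)
        (c := fun v => i v + j v) hlist.nodup
        (fun v hv => (hch v (mem_keep.1 hv).1).1) (fun v hv => by
          have := (hch v (mem_keep.1 hv).1).2.2.2
          rw [if_neg (mem_keep.1 hv).2] at this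
          exact this.trans_lt I.ds_lt)
      rw [hE.c] at hc
      change cellAt I.M (s.reg ʀcp) _ _ _ = z at hc
      omega
    · rw [hLS', hLE', Function.update_self, Function.update_self]; rfl
    · rw [hLE', Function.update_self, hip']
    · intro i hi
      rw [hLS', Function.update_self, hitem]
      rw [Inst.inc, incCount, nbSum_union hAB]
      exact h₄.items i hi
    · rw [hTB', Function.update_self, hcp']; exact le_rfl
    · rw [hTB', Function.update_self]
      refine TableFor.join (tA := J.tA) (tB := J.tB) (val := s.arr ᴀval) (Rec := s.Rec) I.le_ds
        I.ds_lt hAB hA.list hB.list hXnd hXmem hA.table hB.table ?_ ?_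
      · intro q hq hne
        rw [hval] at hne ⊢
        obtain ⟨e, he, he', hv, hc, hcand, hb⟩ := h₅.sound q hq hne
        obtain ⟨σ, i, j, hch, hE, hw⟩ := h₄.sound e he he'
        have ea : (s₄.ent e).a = cellAt I.M J.tA LA σ i := by
          rw [hE.a]; exact JoinData.psum_eq_cellAt fun v hv => (hXmem v).2 (Or.inl hv)
        have eb : (s₄.ent e).b = cellAt I.M J.tB LB σ j := by
          rw [hE.b]; exact JoinData.psum_eq_cellAt fun v hv => (hXmem v).2 (Or.inr hv)
        have hv1 := hv.1
        have hv2 := hv.2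
        rw [hval₄, ea] at hv1
        rw [hval₄, eb] at hv2
        refine ⟨σ, i, j, hch, by rw [← hc, hE.c]; rfl, hv1, hv2, ?_, ?_⟩
        · rw [hcand, Store.cand, hval₄, ea, eb, hE.w]; rfl
        · intro SA zA SB zB rA rB hzA hzB
          -- The walk through the queue meets one entry per merged vertex and the root.
          refine ⟨J.X.length + 1 + zA + zB + 1, ?_, ?_⟩
          · change _ ≤ ZA + ZB + J.X.length + 2
            omega
          · refine Rec.step (q := q) (zF := J.X.length + 1) (zA := zA) (zB := zB) ?_ ?_ ?_ ?_
            · rw [hcp', ← hc, hE.c]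
              refine cellAt_lt hlist.nodup (fun v hv => (hch v (mem_keep.1 hv).1).1) (fun v hv => ?_)
              have := (hch v (mem_keep.1 hv).1).2.2.2
              rw [if_neg (mem_keep.1 hv).2] at this
              exact this.trans_lt I.ds_lt
            · rw [hbp, hb]
              exact hw.mono hqp'.symm.le fun q _ => hent q
            · rw [hbp, hb, hent, ea]
              exact hExt.recover rA
            · rw [hbp, hb, hent, eb]
              exact hExt.recover rB
      · intro σ i j hch hv1 hv2
        obtain ⟨e, he, he', hE⟩ := h₄.complete σ i j hch
        have ea : (s₄.ent e).a = cellAt I.M J.tA LA σ i := by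
          rw [hE.a]; exact JoinData.psum_eq_cellAt fun v hv => (hXmem v).2 (Or.inl hv)
        have eb : (s₄.ent e).b = cellAt I.M J.tB LB σ j := by
          rw [hE.b]; exact JoinData.psum_eq_cellAt fun v hv => (hXmem v).2 (Or.inr hv)
        have := h₅.complete e he he' ⟨by rw [hval₄, ea]; exact hv1, by rw [hval₄, eb]; exact hv2⟩
        rw [Store.cand, hval₄, ea, eb, hE.w, hE.c] at this
        rw [hval]
        exact this
    · intro y hy
      rw [hLS', hLE', hTB']
      simp [hy]
  · simp [Prog.bound, Term.cost, initQ, finish]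
    rw [hprod] at *
    change 60 * LA.length + 20 + (80 * LB.length + 20 + (34 +
      (20 * I.M * (keep I.eu I.ev I.m PA PB (JoinData.merged LA LB)).length + _ + _))) ≤ _
    omega

end RAM

/-! ### Edge lists -/

section EdgeLists

/-- In a simple graph every neighbour is reached through exactly one index and in exactly one
orientation, since the ends of an edge differ. -/
theorem EdgeList.sum_neighbors {V : Type*} [Fintype V] [DecidableEq V] {G : SimpleGraph V}
    [DecidableRel G.Adj] {m : ℕ} (E : EdgeList G m) (g : V → ℕ) (v : V) :
    ∑ i, ((if E.fst i = v then g (E.snd i) else 0) + (if E.snd i = v then g (E.fst i) else 0)) =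
      ∑ w ∈ Finset.univ.filter (G.Adj v), g w := by
  have key : ∀ w, (if G.Adj v w then g w else 0) =
      ∑ i, ((if E.fst i = v ∧ E.snd i = w then g w else 0) +
        (if E.snd i = v ∧ E.fst i = w then g w else 0)) := by
    intro w
    have hs : ∀ i, (E.fst i = v ∧ E.snd i = w) ∨ (E.snd i = v ∧ E.fst i = w) ↔
        (E.edge i : Sym2 V) = s(v, w) := fun i => by
      rw [E.edge_eq, Sym2.eq_iff]; tauto
    by_cases h : G.Adj v w
    · rw [if_pos h]
      have hne := h.ne
      set i₀ := E.edge.symm ⟨s(v, w), h⟩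
      have h₀ : (E.edge i₀ : Sym2 V) = s(v, w) := by simp [i₀]
      rw [Finset.sum_eq_single i₀]
      · rcases (hs i₀).2 h₀ with ⟨h1, h2⟩ | ⟨h1, h2⟩
        · simp [h1, h2, hne.symm]
        · simp [h1, h2, hne.symm]
      · intro i _ hi
        have : ¬ ((E.edge i : Sym2 V) = s(v, w)) := fun h' => hi <| by
          rw [← E.edge.symm_apply_apply i]
          congr 1
          exact Subtype.ext h'
        rw [← hs i, not_or] at this
        simp [this.1, this.2]
      · simp
    · rw [if_neg h, eq_comm, Finset.sum_eq_zero_iff]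
      intro i _
      have : ¬ ((E.edge i : Sym2 V) = s(v, w)) := fun h' => h <| by
        have := (E.edge i).2; rw [h'] at this; exact this
      rw [← hs i, not_or] at this
      simp [this.1, this.2]
  rw [Finset.sum_filter]
  simp_rw [key]
  rw [Finset.sum_comm]
  refine Finset.sum_congr rfl fun i _ => ?_
  rw [Finset.sum_add_distrib]
  congr 1
  · by_cases h : E.fst i = v <;> simp [h]
  · by_cases h : E.snd i = v <;> simp [h]

end EdgeLists

/-! ### Contracting a tree -/

/-- A set of nodes which no edge leaves contains everything or nothing. -/
theorem closed_of_reachable {N : Type*} {H : SimpleGraph N} {D : Set N} (hD : ∀ a b, H.Adj a b → a ∈ D → b ∈ D)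
    {a b : N} (hr : H.Reachable a b) (ha : a ∈ D) : b ∈ D := by
  obtain ⟨w⟩ := hr
  induction w with
  | nil => exact ha
  | cons h _ ih => exact ih (hD _ _ h ha)

section Contraction

variable {N : Type*} [DecidableEq N] {T : SimpleGraph N} [DecidableRel T.Adj]

/-- Contracting leaves, the nodes of `T` have been merged into the nodes in `R`; `own` tells into
which one. -/
structure Contraction (T : SimpleGraph N) [DecidableRel T.Adj] (R : Finset N) (own : N → N) :
    Prop where
  mem : ∀ y, own y ∈ R
  self : ∀ y ∈ R, own y = y
  adj : ∀ y z, T.Adj y z → own y ≠ own z → y ∈ R ∧ z ∈ R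
  count : ∑ y ∈ R, (R.filter (T.Adj y)).card + 2 = 2 * R.card

variable {R : Finset N} {own : N → N} {x p y : N}

/-- Stated for arbitrary `g` because two sums are maintained: the degrees with `g = 1`, and the sums
of neighbour indices from which a unique neighbour is read off. -/
theorem sum_filter_erase (hx : x ∈ R) (hp : R.filter (T.Adj x) = {p}) (g : N → ℕ) (hy : y ∈ R) :
    ∑ z ∈ (R.erase x).filter (T.Adj y), g z + (if y = p then g x else 0) =
      ∑ z ∈ R.filter (T.Adj y), g z := by
  have hiff : T.Adj y x ↔ y = p := by
    have := Finset.ext_iff.1 hp y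
    simp only [Finset.mem_filter, hy, true_and, Finset.mem_singleton] at this
    rw [T.adj_comm]; exact this
  rw [Finset.filter_erase]
  by_cases h : y = p
  · rw [if_pos h, Finset.sum_erase_add]
    exact Finset.mem_filter.2 ⟨hx, hiff.2 h⟩
  · rw [if_neg h, add_zero, Finset.erase_eq_of_notMem]
    exact fun h' => h (hiff.1 (Finset.mem_filter.1 h').2)

/-- Since `p` is the only remaining neighbour of `x`, every edge between the nodes of `x` and other
nodes is the edge `xp` itself. The degree sum falls by two and the number of nodes by one, which
preserves `count`. -/
theorem Contraction.step (h : Contraction T R own) (hx : x ∈ R) (hp : R.filter (T.Adj x) = {p}) :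
    Contraction T (R.erase x) (fun y => if own y = x then p else own y) := by
  have hp' : p ∈ R ∧ T.Adj x p := Finset.mem_filter.1 (hp ▸ Finset.mem_singleton_self p)
  have hne : p ≠ x := hp'.2.ne'
  have key : ∀ y z, T.Adj y z → own y = x → own z ≠ x → own z = p := by
    intro y z ha h1 h2
    have := h.adj y z ha (by rw [h1]; exact h2.symm)
    have ey := h.self y this.1
    have ez := h.self z this.2
    rw [ey] at h1
    rw [h1] at ha
    rw [ez]
    exact Finset.mem_singleton.1 (hp ▸ Finset.mem_filter.2 ⟨this.2, ha⟩)
  refine ⟨fun y => ?_, fun y hy => ?_, fun y z ha hyz => ?_, ?_⟩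
  · split_ifs with h1
    · exact Finset.mem_erase.2 ⟨hne, hp'.1⟩
    · exact Finset.mem_erase.2 ⟨h1, h.mem y⟩
  · rw [Finset.mem_erase] at hy
    rw [h.self y hy.2, if_neg hy.1]
  · split_ifs at hyz with h1 h2 h2
    · exact absurd rfl hyz
    · exact absurd (key y z ha h1 h2).symm hyz
    · exact absurd (key z y ha.symm h2 h1) hyz
    · obtain ⟨h3, h4⟩ := h.adj y z ha hyz
      rw [h.self y h3] at h1
      rw [h.self z h4] at h2
      exact ⟨Finset.mem_erase.2 ⟨h1, h3⟩, Finset.mem_erase.2 ⟨h2, h4⟩⟩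
  · have h1 := h.count
    have h2 : ∑ y ∈ R.erase x, (R.filter (T.Adj y)).card + 1 = ∑ y ∈ R, (R.filter (T.Adj y)).card := by
      rw [← Finset.sum_erase_add _ _ hx, hp, Finset.card_singleton]
    have h3 : ∑ y ∈ R.erase x, ((R.erase x).filter (T.Adj y)).card + 1 =
        ∑ y ∈ R.erase x, (R.filter (T.Adj y)).card := by
      have h4 : ∑ y ∈ R.erase x, (((R.erase x).filter (T.Adj y)).card + if y = p then 1 else 0) =
          ∑ y ∈ R.erase x, (R.filter (T.Adj y)).card := by
        refine Finset.sum_congr rfl fun y hy => ?_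
        have := sum_filter_erase hx hp (fun _ => 1) (Finset.mem_of_mem_erase hy)
        rwa [← Finset.card_eq_sum_ones, ← Finset.card_eq_sum_ones] at this
      rw [Finset.sum_add_distrib, Finset.sum_ite_eq', if_pos (Finset.mem_erase.2 ⟨hne, hp'.1⟩)] at h4
      exact h4
    have h5 := Finset.card_erase_add_one hx
    omega

theorem Contraction.own_eq_of_isolated (h : Contraction T R own) (hT : T.Connected) (hy : y ∈ R)
    (h0 : R.filter (T.Adj y) = ∅) (z : N) : own z = y := by
  refine closed_of_reachable (D := {z | own z = y}) (fun a b hab ha => ?_)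
    (hT.preconnected y z) (h.self y hy)
  by_contra hb
  simp only [Set.mem_ofPred_eq] at ha hb
  obtain ⟨h1, h2⟩ := h.adj a b hab (by rw [ha]; exact fun e => hb e.symm)
  rw [h.self a h1] at ha
  subst ha
  exact Finset.notMem_empty b (h0 ▸ Finset.mem_filter.2 ⟨h2, hab⟩)

/-- By `count` the average degree is below two. Without a node of degree one there is therefore an
isolated node, and by connectedness it has absorbed everything. -/
theorem Contraction.exists_leaf (h : Contraction T R own) (hT : T.Connected)
    (hn : ∀ y ∈ R, (R.filter (T.Adj y)).card ≠ 1) (hy : y ∈ R) (z : N) : own z = y := by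
  by_cases h0 : R.filter (T.Adj y) = ∅
  · exact h.own_eq_of_isolated hT hy h0 z
  have h2 : ∀ y ∈ R, 2 ≤ (R.filter (T.Adj y)).card := by
    intro w hw
    have := hn w hw
    rcases Nat.eq_zero_or_pos (R.filter (T.Adj w)).card with h1 | h1
    · rw [Finset.card_eq_zero] at h1
      have hyw := h.own_eq_of_isolated hT hw h1 y
      rw [h.self y hy] at hyw
      exact absurd (hyw ▸ h1) h0
    · omega
  have := Finset.sum_le_sum h2
  rw [Finset.sum_const, smul_eq_mul] at this
  have := h.count
  omega

end Contraction

namespace BranchDecomposition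

variable {V N : Type*} [Finite N] {G : SimpleGraph V}

theorem ncard_orderFun_le (B : BranchDecomposition G N) {f : Sym2 N} (hf : f ∈ B.tree.edgeSet) :
    (B.orderFun f).ncard ≤ B.width :=
  le_ciSup (f := fun f : B.tree.edgeSet => (B.orderFun f).ncard) (Set.finite_range _).bddAbove
    ⟨f, hf⟩

variable [Finite V]

/-- If at most one edge of the tree leaves `D`, then at most `B.width` vertices are incident to
edges on both sides. -/
theorem ncard_le_width (B : BranchDecomposition G N) (D : Set N)
    (hD : ∀ a b a' b', B.tree.Adj a b → a ∈ D → b ∉ D → B.tree.Adj a' b' → a' ∈ D → b' ∉ D →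
      s(a, b) = s(a', b')) :
    {v | ∃ e e' : G.edgeSet, v ∈ (e : Sym2 V) ∧ v ∈ (e' : Sym2 V) ∧
      (B.leafOf e : N) ∈ D ∧ (B.leafOf e' : N) ∉ D}.ncard ≤ B.width := by
  classical
  by_cases h : ∃ a b, B.tree.Adj a b ∧ a ∈ D ∧ b ∉ D
  · obtain ⟨a, b, hab, ha, hb⟩ := h
    refine le_trans (Set.ncard_le_ncard ?_ (Set.toFinite _))
      (B.ncard_orderFun_le (f := s(a, b)) hab)
    rintro v ⟨e, e', he, he', h1, h2⟩
    refine ⟨e, e', he, he', fun hr => h2 ?_⟩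
    refine closed_of_reachable (fun c c' hc hcD => ?_) hr h1
    by_contra hc'
    rw [SimpleGraph.deleteEdges_adj] at hc
    exact hc.2 (hD c c' a b hc.1 hcD hc' hab ha hb)
  · push Not at h
    refine le_of_eq_of_le ?_ (Nat.zero_le _)
    rw [Set.ncard_eq_zero (Set.toFinite _), Set.eq_empty_iff_forall_notMem]
    rintro v ⟨e, e', -, -, h1, h2⟩
    exact h2 (closed_of_reachable (fun a b hab ha => h a b hab ha)
      (B.isTree.connected.preconnected _ _) h1)

/-- The boundary of a part which arises by contracting the tree is at most the width. -/
theorem boundary_le_width [DecidableEq N] (B : BranchDecomposition G N) [DecidableRel B.tree.Adj]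
    {R : Finset N} {own : N → N} (h : Contraction B.tree R own) {y : N} (hy : y ∈ R) :
    {v | ∃ e e' : G.edgeSet, v ∈ (e : Sym2 V) ∧ v ∈ (e' : Sym2 V) ∧
      own (B.leafOf e) = y ∧ own (B.leafOf e') ≠ y}.ncard ≤ B.width := by
  have cross : ∀ a b, B.tree.Adj a b → own a = y → own b ≠ y → a = y ∧ b ∈ R := by
    intro a b hab ha hb
    obtain ⟨h1, h2⟩ := h.adj a b hab (by rw [ha]; exact hb.symm)
    exact ⟨by rw [← h.self a h1, ha], h2⟩
  -- With at most one remaining neighbour, a single tree edge leaves the nodes merged into `y`, and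
  -- its order function covers the boundary.
  by_cases h1 : (R.filter (B.tree.Adj y)).card ≤ 1
  · refine B.ncard_le_width {z | own z = y} fun a b a' b' hab ha hb hab' ha' hb' => ?_
    obtain ⟨rfl, hbR⟩ := cross a b hab ha hb
    obtain ⟨rfl, hbR'⟩ := cross a' b' hab' ha' hb'
    rw [Finset.card_le_one] at h1
    rw [h1 b (Finset.mem_filter.2 ⟨hbR, hab⟩) b' (Finset.mem_filter.2 ⟨hbR', hab'⟩)]
  · rw [not_le, Finset.one_lt_card] at h1
    obtain ⟨r, hr, r', hr', hne⟩ := h1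
    rw [Finset.mem_filter] at hr hr'
    have hleaf : ¬ IsLeaf B.tree y := fun hl => by
      rw [IsLeaf, Set.encard_le_one_iff] at hl
      exact hne (hl r r' hr.2 hr'.2)
    have h3 := B.degree_eq_three y hleaf
    -- As `y` has two remaining neighbours it is not a leaf and carries no graph edge, so it may be
    -- removed from its class. It has degree three, which leaves at most one edge between `y` and
    -- the rest of the class; that edge is the cut.
    have hleaf' : ∀ e : G.edgeSet, (B.leafOf e : N) ≠ y := fun e he => hleaf (he ▸ (B.leafOf e).2)
    refine le_trans (Set.ncard_le_ncard ?_ (Set.toFinite _))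
      (B.ncard_le_width {z | own z = y ∧ z ≠ y} ?_)
    · rintro v ⟨e, e', he, he', h4, h5⟩
      exact ⟨e, e', he, he', ⟨h4, hleaf' e⟩, fun h6 => h5 h6.1⟩
    · have out : ∀ a b, B.tree.Adj a b → (own a = y ∧ a ≠ y) → ¬ (own b = y ∧ b ≠ y) →
          b = y ∧ a ∉ R := by
        intro a b hab ha hb
        have hby : b = y := by
          by_contra hne
          exact ha.2 (cross a b hab ha.1 fun h => hb ⟨h, hne⟩).1
        exact ⟨hby, fun haR => ha.2 (by rw [← h.self a haR, ha.1])⟩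
      intro a b a' b' hab ha hb hab' ha' hb'
      obtain ⟨rfl, haR⟩ := out a b hab ha hb
      obtain ⟨rfl, haR'⟩ := out a' b' hab' ha' hb'
      by_contra hne'
      have hne' : a ≠ a' := fun h => hne' (by rw [h])
      have hsub : (({a, a', r, r'} : Finset N) : Set N) ⊆ B.tree.neighborSet b' := by
        intro z hz
        simp only [Finset.coe_insert, Finset.coe_singleton, Set.mem_insert_iff,
          Set.mem_singleton_iff] at hz
        rcases hz with rfl | rfl | rfl | rfl
        exacts [hab.symm, hab'.symm, hr.2, hr'.2]
      have hcard : ({a, a', r, r'} : Finset N).card = 4 := by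
        have e1 : a ≠ r := fun h => haR (h ▸ hr.1)
        have e2 : a ≠ r' := fun h => haR (h ▸ hr'.1)
        have e3 : a' ≠ r := fun h => haR' (h ▸ hr.1)
        have e4 : a' ≠ r' := fun h => haR' (h ▸ hr'.1)
        simp [hne, hne', e1, e2, e3, e4]
      have := Set.encard_le_encard hsub
      rw [Set.encard_coe_eq_coe_finsetCard, hcard, h3] at this
      exact absurd this (by decide)

end BranchDecomposition

section Counting

theorem Contraction.refl {N : Type*} [Fintype N] [DecidableEq N] {T : SimpleGraph N}
    [DecidableRel T.Adj] (hT : T.IsTree) : Contraction T Finset.univ id where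
  mem _ := Finset.mem_univ _
  self _ _ := rfl
  adj _ _ _ _ := ⟨Finset.mem_univ _, Finset.mem_univ _⟩
  count := by
    have h1 := T.sum_degrees_eq_twice_card_edges
    have h2 := hT.card_edgeFinset
    have h3 : ∑ y, (Finset.univ.filter (T.Adj y)).card = ∑ y, T.degree y :=
      Finset.sum_congr rfl fun y _ => by
        rw [← T.card_neighborFinset_eq_degree, T.neighborFinset_eq_filter]
    rw [h3, h1, Finset.card_univ]
    omega

theorem EdgeList.length_add_one {k l : ℕ} {T : SimpleGraph (Fin k)} (hT : T.IsTree)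
    (F : EdgeList T l) : l + 1 = k := by
  classical
  have h1 := hT.card_edgeFinset
  have h2 := Fintype.card_congr F.edge
  rw [Fintype.card_fin] at h1 h2
  rw [← h1, h2, SimpleGraph.edgeFinset, Set.toFinset_card]

/-- The degrees sum to `2 * k - 2`, and all nodes but the `m` leaves contribute three. -/
theorem BranchDecomposition.card_nodes_le {V : Type*} {G : SimpleGraph V} {m k : ℕ}
    (B : BranchDecomposition G (Fin k)) (E : EdgeList G m) : k + 2 ≤ 3 * m := by
  classical
  have hc := (Contraction.refl B.isTree).count
  rw [Finset.card_univ, Fintype.card_fin] at hc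
  have hdeg : ∀ y, ((Finset.univ.filter (B.tree.Adj y)).card : ℕ∞) =
      (B.tree.neighborSet y).encard := fun y => by
    rw [← Set.encard_coe_eq_coe_finsetCard]
    congr 1
    ext z
    simp
  have hl : (Finset.univ.filter (IsLeaf B.tree)).card = m := by
    have := Fintype.card_congr (E.edge.trans B.leafOf)
    rw [Fintype.card_fin, Fintype.card_subtype] at this
    exact this.symm
  have hs : ∑ y : Fin k, 3 ≤ ∑ y, ((Finset.univ.filter (B.tree.Adj y)).card +
      if IsLeaf B.tree y then 3 else 0) := by
    refine Finset.sum_le_sum fun y _ => ?_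
    split_ifs with h
    · omega
    · have := B.degree_eq_three y h
      rw [← hdeg] at this
      have : (Finset.univ.filter (B.tree.Adj y)).card = 3 := by exact_mod_cast this
      omega
  rw [Finset.sum_add_distrib, ← Finset.sum_filter, Finset.sum_const, Finset.sum_const, hl] at hs
  simp only [Finset.card_univ, Fintype.card_fin, smul_eq_mul] at hs
  omega

theorem EdgeList.card_le {n m : ℕ} {G : SimpleGraph (Fin n)} (E : EdgeList G m) :
    n ≤ 2 * m + {v : Fin n | ∀ u : Fin n, ¬ G.Adj v u}.ncard := by
  classical
  have h : (Finset.univ : Finset (Fin n)) ⊆ (Finset.univ.image E.fst ∪ Finset.univ.image E.snd) ∪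
      Finset.univ.filter fun v : Fin n => ∀ u : Fin n, ¬ G.Adj v u := by
    intro v _
    by_cases hv : ∀ u : Fin n, ¬ G.Adj v u
    · exact Finset.mem_union_right _ (Finset.mem_filter.2 ⟨Finset.mem_univ _, hv⟩)
    · push Not at hv
      obtain ⟨u, hu⟩ := hv
      have h1 := E.edge_eq (E.edge.symm ⟨s(v, u), hu⟩)
      rw [Equiv.apply_symm_apply, eq_comm, Sym2.eq_iff] at h1
      refine Finset.mem_union_left _ ?_
      rcases h1 with h1 | h1
      · exact Finset.mem_union_left _ (Finset.mem_image.2 ⟨_, Finset.mem_univ _, h1.1⟩)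
      · exact Finset.mem_union_right _ (Finset.mem_image.2 ⟨_, Finset.mem_univ _, h1.2⟩)
  have h1 := Finset.card_le_card h
  have h2 := Finset.card_union_le (Finset.univ.image E.fst ∪ Finset.univ.image E.snd)
    (Finset.univ.filter fun v : Fin n => ∀ u : Fin n, ¬ G.Adj v u)
  have h3 := Finset.card_union_le (Finset.univ.image E.fst) (Finset.univ.image E.snd)
  have h4 := Finset.card_image_le (s := Finset.univ) (f := E.fst)
  have h5 := Finset.card_image_le (s := Finset.univ) (f := E.snd)
  have h6 : {v : Fin n | ∀ u : Fin n, ¬ G.Adj v u}.ncard =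
      (Finset.univ.filter fun v : Fin n => ∀ u : Fin n, ¬ G.Adj v u).card := by
    rw [← Set.ncard_coe_finset]; congr 1; ext; simp
  rw [Finset.card_univ, Fintype.card_fin] at h1 h4 h5
  omega

end Counting

/-! ### The cost of a join in terms of the width. -/

namespace RAM

/-- The boundary of the part `P`. -/
def Inst.bdry (I : Inst) (P : Finset ℕ) : Finset ℕ :=
  (P.image I.eu ∪ P.image I.ev).filter fun v => I.inc P v < I.deg v

theorem Inst.mem_bdry {I : Inst} {P : Finset ℕ} {v : ℕ} :
    v ∈ I.bdry P ↔ 0 < I.inc P v ∧ I.inc P v < I.deg v := by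
  rw [Inst.bdry, Finset.mem_filter, ← incCount_pos]; rfl

/-- The list `L` consists of the boundary of the part `P` and at most two vertices of degree one. -/
structure Inst.Clean (I : Inst) (P : Finset ℕ) (L : List ℕ) : Prop where
  junk : ∀ v ∈ L, I.inc P v < I.deg v ∨ I.deg v = 1
  few : (L.toFinset.filter fun v => I.deg v = 1).card ≤ 2

/-- The number of states of a table for a boundary of size `3b/2`. -/
def Inst.size (I : Inst) (b : ℕ) : ℕ := 2 ^ (3 * b / 2) * (I.ds + 1) ^ (2 * b)

theorem Inst.one_le_size (I : Inst) (b : ℕ) : 1 ≤ I.size b :=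
  Nat.mul_pos (by positivity) (by positivity)

variable {I : Inst} {PA PB : Finset ℕ} {LA LB : List ℕ} {b : ℕ}

/-- The product over the merged list is split by whether a vertex has degree one. Such vertices can
be superfluous members of a list, but they are few and give the constant; the others obey the
three-boundaries count that produces the exponents. -/
theorem Inst.joinCost_le (hA : BoundaryList I.eu I.ev I.m PA LA)
    (hB : BoundaryList I.eu I.ev I.m PB LB) (hAB : Disjoint PA PB) (cA : I.Clean PA LA)
    (cB : I.Clean PB LB) (bA : (I.bdry PA).card ≤ b) (bB : (I.bdry PB).card ≤ b)
    (bC : (I.bdry (PA ∪ PB)).card ≤ b) : I.joinCost PA PB LA LB ≤ 256 * I.size b := by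
  have hX := nodup_merged hA.nodup hB.nodup
  have hmem : ∀ v, v ∈ (JoinData.merged LA LB).toFinset ↔ v ∈ LA ∨ v ∈ LB := fun v => by
    rw [List.mem_toFinset]; exact JoinData.mem_merged
  have hle : ∀ v, I.inc PA v + I.inc PB v ≤ I.deg v :=
    incCount_add_le (eu := I.eu) (ev := I.ev) hAB hA.sub hB.sub
  have hinc : ∀ v, I.inc (PA ∪ PB) v = I.inc PA v + I.inc PB v := fun v => by
    rw [Inst.inc, incCount, nbSum_union hAB]; rfl
  have zA : ∀ v, v ∉ LA → v ∈ LB → I.inc PA v = 0 := fun v h h' =>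
    hA.incCount_eq_zero hAB hB h h'
  have zB : ∀ v, v ∉ LB → v ∈ LA → I.inc PB v = 0 := fun v h h' =>
    hB.incCount_eq_zero hAB.symm hA h h'
  rw [Inst.joinCost, ← List.prod_toFinset _ hX,
    ← Finset.prod_filter_mul_prod_filter_not _ (fun v => I.deg v = 1)]
  set X := (JoinData.merged LA LB).toFinset
  set f : ℕ → ℕ := fun v => 2 * ((min I.ds (I.inc PA v) + 1) * (min I.ds (I.inc PB v) + 1))
  refine Nat.mul_le_mul ?_ ?_
  · have h1 : (X.filter fun v => I.deg v = 1).card ≤ 4 := by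
      have : (X.filter fun v => I.deg v = 1) ⊆ (LA.toFinset.filter fun v => I.deg v = 1) ∪
          (LB.toFinset.filter fun v => I.deg v = 1) := by
        intro v hv
        rw [Finset.mem_filter, hmem] at hv
        simp only [Finset.mem_union, Finset.mem_filter, List.mem_toFinset]
        tauto
      have h2 := Finset.card_le_card this
      have h3 := Finset.card_union_le (LA.toFinset.filter fun v => I.deg v = 1)
        (LB.toFinset.filter fun v => I.deg v = 1)
      have := cA.few
      have := cB.few
      omega
    -- The single edge at such a vertex lies in at most one of the parts, so it allows at most four
    -- choices; at most two such vertices come from each list, whence `4 ^ 4 = 256`.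
    calc ∏ v ∈ X.filter fun v => I.deg v = 1, f v
        ≤ ∏ v ∈ X.filter fun v => I.deg v = 1, 4 := by
          refine Finset.prod_le_prod' fun v hv => ?_
          have h2 := hle v
          rw [(Finset.mem_filter.1 hv).2] at h2
          have h3 := Nat.mul_le_mul (Nat.succ_le_succ (min_le_right I.ds (I.inc PA v)))
            (Nat.succ_le_succ (min_le_right I.ds (I.inc PB v)))
          have h4 : (I.inc PA v + 1) * (I.inc PB v + 1) ≤ 2 := by
            rcases (by omega : I.inc PA v = 0 ∨ I.inc PB v = 0) with h | h <;> rw [h] <;> omega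
          simp only [Nat.succ_eq_add_one] at h3
          change 2 * _ ≤ 4
          omega
      _ ≤ 4 ^ 4 := by
          rw [Finset.prod_const]
          exact Nat.pow_le_pow_right (by norm_num) h1
      _ = 256 := by norm_num
  · set Y := X.filter fun v => ¬ I.deg v = 1
    have hY : ∀ v ∈ Y, (v ∈ LA ∨ v ∈ LB) ∧ I.inc PA v < I.deg v ∧ I.inc PB v < I.deg v := by
      intro v hv
      rw [Finset.mem_filter, hmem] at hv
      refine ⟨hv.1, ?_, ?_⟩
      · by_cases h : v ∈ LA
        · exact (cA.junk v h).resolve_right hv.2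
        · have h1 := hv.1.resolve_left h
          have : 0 < I.inc PB v := hB.pos v h1
          have := zA v h h1
          have := hle v
          omega
      · by_cases h : v ∈ LB
        · exact (cB.junk v h).resolve_right hv.2
        · have h1 := hv.1.resolve_right h
          have : 0 < I.inc PA v := hA.pos v h1
          have := zB v h h1
          have := hle v
          omega
    have hpos : ∀ v ∈ Y, 0 < I.inc PA v ∨ 0 < I.inc PB v := fun v hv =>
      (hY v hv).1.imp (fun h => hA.pos v h) (fun h => hB.pos v h)
    have h2 : 2 * Y.card ≤ 3 * b := by
      -- Every vertex of `Y` lies in two of the three boundaries: if it meets both parts, in those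
      -- of `PA` and `PB`; if it meets only one, in that part's boundary and in that of the union.
      have h3 : ∑ v ∈ Y, 2 ≤ ∑ v ∈ Y, ((if v ∈ I.bdry PA then 1 else 0) +
          (if v ∈ I.bdry PB then 1 else 0) + (if v ∈ I.bdry (PA ∪ PB) then 1 else 0)) := by
        refine Finset.sum_le_sum fun v hv => ?_
        have h4 := hY v hv
        have h5 := hpos v hv
        have h6 := hle v
        simp only [Inst.mem_bdry, hinc, h4.2.1, h4.2.2, and_true]
        split_ifs <;> omega
      rw [Finset.sum_add_distrib, Finset.sum_add_distrib, Finset.sum_ite_mem, Finset.sum_ite_mem,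
        Finset.sum_ite_mem, ← Finset.card_eq_sum_ones, ← Finset.card_eq_sum_ones,
        ← Finset.card_eq_sum_ones, Finset.sum_const, smul_eq_mul] at h3
      have := Finset.card_le_card (Finset.inter_subset_right (s₁ := Y) (s₂ := I.bdry PA))
      have := Finset.card_le_card (Finset.inter_subset_right (s₁ := Y) (s₂ := I.bdry PB))
      have := Finset.card_le_card (Finset.inter_subset_right (s₁ := Y) (s₂ := I.bdry (PA ∪ PB)))
      omega
    -- Outside the boundary of a part a vertex of `Y` has no edge in this part, so the corresponding
    -- share has only the value `0`.
    calc ∏ v ∈ Y, f v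
        ≤ ∏ v ∈ Y, (2 * ((if v ∈ I.bdry PA then I.ds + 1 else 1) *
            (if v ∈ I.bdry PB then I.ds + 1 else 1))) := by
          refine Finset.prod_le_prod' fun v hv => Nat.mul_le_mul_left _ (Nat.mul_le_mul ?_ ?_)
          · have := (hY v hv).2.1
            simp only [Inst.mem_bdry, this, and_true]
            split_ifs <;> omega
          · have := (hY v hv).2.2
            simp only [Inst.mem_bdry, this, and_true]
            split_ifs <;> omega
      _ = 2 ^ Y.card * ((I.ds + 1) ^ (Y ∩ I.bdry PA).card *
            (I.ds + 1) ^ (Y ∩ I.bdry PB).card) := by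
          rw [Finset.prod_mul_distrib, Finset.prod_mul_distrib, Finset.prod_ite_mem,
            Finset.prod_ite_mem, Finset.prod_const, Finset.prod_const, Finset.prod_const]
      _ ≤ I.size b := by
          rw [Inst.size, two_mul b, pow_add]
          refine Nat.mul_le_mul (Nat.pow_le_pow_right (by norm_num) (by omega))
            (Nat.mul_le_mul (Nat.pow_le_pow_right (by omega) ?_)
              (Nat.pow_le_pow_right (by omega) ?_))
          · exact (Finset.card_le_card Finset.inter_subset_right).trans bA
          · exact (Finset.card_le_card Finset.inter_subset_right).trans bB

theorem Inst.inc_lt_of_mem_keep (hA : BoundaryList I.eu I.ev I.m PA LA)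
    (hB : BoundaryList I.eu I.ev I.m PB LB) (hAB : Disjoint PA PB) :
    ∀ v ∈ keep I.eu I.ev I.m PA PB (JoinData.merged LA LB), I.inc (PA ∪ PB) v < I.deg v := by
  intro v hv
  rw [Inst.inc, incCount, nbSum_union hAB]
  exact lt_of_le_of_ne (incCount_add_le (eu := I.eu) (ev := I.ev) hAB hA.sub hB.sub v)
    (mem_keep.1 hv).2

theorem Inst.keep_length_le (hA : BoundaryList I.eu I.ev I.m PA LA)
    (hB : BoundaryList I.eu I.ev I.m PB LB) (hAB : Disjoint PA PB)
    (bC : (I.bdry (PA ∪ PB)).card ≤ b) :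
    (keep I.eu I.ev I.m PA PB (JoinData.merged LA LB)).length ≤ b := by
  have hl := BoundaryList.join hAB hA hB (nodup_merged hA.nodup hB.nodup)
    fun v => JoinData.mem_merged
  rw [← List.toFinset_card_of_nodup hl.nodup]
  refine (Finset.card_le_card fun v hv => ?_).trans bC
  rw [List.mem_toFinset] at hv
  exact Inst.mem_bdry.2 ⟨hl.pos v hv, Inst.inc_lt_of_mem_keep hA hB hAB v hv⟩

/-- Pays for the repeated additions of `mulLoop`, one run for each kept vertex: unless `b = 0`, both
`b ≤ 2 ^ (3b/2)` and `ds + 1 ≤ (ds + 1) ^ (2b)` hold. -/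
theorem Inst.base_mul_le (I : Inst) (hM : I.M = I.ds + 2) {b j : ℕ} (h : j ≤ b) :
    I.M * j ≤ 2 * I.size b := by
  rcases Nat.eq_zero_or_pos j with rfl | h0
  · simp
  have h1 : b ≤ 2 ^ (3 * b / 2) :=
    (Nat.lt_two_pow_self (n := b)).le.trans (Nat.pow_le_pow_right (by norm_num) (by omega))
  have h2 : I.ds + 1 ≤ (I.ds + 1) ^ (2 * b) := Nat.le_self_pow (by omega) _
  have h3 := Nat.mul_le_mul (h.trans h1) h2
  rw [← Inst.size] at h3
  have h4 : I.M * j ≤ 2 * (j * (I.ds + 1)) := by rw [hM]; nlinarith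
  omega

theorem Inst.Clean.of_lt {P : Finset ℕ} {L : List ℕ} (hP : ∀ v ∈ L, I.inc P v < I.deg v)
    (hpos : ∀ v ∈ L, 0 < I.inc P v) : I.Clean P L := by
  refine ⟨fun v hv => Or.inl (hP v hv), ?_⟩
  rw [Finset.card_eq_zero.2]
  · omega
  · rw [Finset.filter_eq_empty_iff]
    intro v hv
    have := hP v (List.mem_toFinset.1 hv)
    have := hpos v (List.mem_toFinset.1 hv)
    omega

end RAM

/-! ### Joins with all costs expressed by the width, and the parts of a contraction. -/

namespace RAM

notation "ʀn" => 0
notation "ʀm" => 1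
notation "ʀk" => 2
notation "ʀl" => 3
notation "ʀnd" => 13
notation "ʀbad" => 14
notation "ʀlast" => 15
notation "ᴀeu" => 1
notation "ᴀev" => 2
notation "ᴀta" => 3
notation "ᴀtb" => 4
notation "ᴀlf" => 5
notation "ᴀout" => 7
notation "ᴀtdeg" => 8
notation "ᴀtsum" => 9

theorem Obj.weaken {I : Inst} {s : Store} {y Z Z' : ℕ} {P : Finset ℕ} {L : List ℕ}
    (h : Obj I s y P L Z) (hZ : Z ≤ Z') : Obj I s y P L Z' := by
  refine ⟨h.list, h.le, h.le_ip, h.items, h.le_cp, fun σ c h1 h2 h3 => ?_, h.table.complete⟩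
  obtain ⟨S, z, h4, h5, h6⟩ := h.table.sound σ c h1 h2 h3
  exact ⟨S, z, h4, h5.trans hZ, h6⟩

theorem Extends.of_frame {p : Prog} {s s' : Store} (f : Frame p s s')
    (hr : ∀ r ∈ [ʀip, ʀqp, ʀcp], r ∉ p.regs)
    (ha : ∀ a ∈ [ᴀitV, ᴀitN, ᴀitC, ᴀitS, ᴀqA, ᴀqB, ᴀqC, ᴀqW, ᴀqP, ᴀqM, ᴀval, ᴀbp], a ∉ p.arrs) :
    Extends s s' := by
  have h : ∀ a ∈ [ᴀitV, ᴀitN, ᴀitC, ᴀitS, ᴀqA, ᴀqB, ᴀqC, ᴀqW, ᴀqP, ᴀqM, ᴀval, ᴀbp],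
      s'.arr a = s.arr a := fun a h => f.arr a (ha a h)
  have h' : ∀ r ∈ [ʀip, ʀqp, ʀcp], s'.reg r = s.reg r := fun r h => f.reg r (hr r h)
  simp only [List.forall_mem_cons, List.not_mem_nil, false_imp_iff, implies_true, and_true] at h h'
  obtain ⟨a1, a2, a3, a4, a5, a6, a7, a8, a9, a10, a11, a12⟩ := h
  refine ⟨fun z _ => ?_, fun q _ => ?_, fun z _ => by rw [a11], fun z _ => by rw [a12],
    h'.1.symm.le, h'.2.1.symm.le, h'.2.2.symm.le⟩
  · simp only [Store.item, a1, a2, a3, a4]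
  · simp only [Store.ent, a5, a6, a7, a8, a9, a10]

theorem Heap.of_frame {I : Inst} {p : Prog} {s s' : Store} (h : Heap I s) (f : Frame p s s')
    (hr : ∀ r ∈ [ʀM, ʀds, ʀxp, ʀqp, ʀcp], r ∉ p.regs)
    (ha : ∀ a ∈ [ᴀdeg, ᴀd, ᴀpos, ᴀval], a ∉ p.arrs) : Heap I s' := by
  have ha' : ∀ a ∈ [ᴀdeg, ᴀd, ᴀpos, ᴀval], s'.arr a = s.arr a := fun a h => f.arr a (ha a h)
  have hr' : ∀ r ∈ [ʀM, ʀds, ʀxp, ʀqp, ʀcp], s'.reg r = s.reg r := fun r h => f.reg r (hr r h)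
  simp only [List.forall_mem_cons, List.not_mem_nil, false_imp_iff, implies_true, and_true]
    at ha' hr'
  obtain ⟨a1, a2, a3, a4⟩ := ha'
  obtain ⟨r1, r2, r3, r4, r5⟩ := hr'
  exact ⟨by rw [r1, h.M], by rw [r2, h.ds], by rw [a1]; exact h.deg, by rw [a2]; exact h.d,
    by rw [a3, r3]; exact h.pos, by rw [r4]; exact h.qp, by rw [a4, r5]; exact h.fresh⟩

/-- After a join the list is exactly the boundary of the union, so superfluous vertices occur only
in the lists of single edges. -/
theorem joinProg_runs {I : Inst} {s : Store} {PA PB : Finset ℕ} {LA LB : List ℕ} {ZA ZB b : ℕ}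
    (hM : I.M = I.ds + 2)
    (hH : Heap I s) (hA : Obj I s (s.reg ʀp) PA LA ZA) (hB : Obj I s (s.reg ʀx) PB LB ZB)
    (hAB : Disjoint PA PB) (cA : I.Clean PA LA) (cB : I.Clean PB LB)
    (bA : (I.bdry PA).card ≤ b) (bB : (I.bdry PB).card ≤ b) (bC : (I.bdry (PA ∪ PB)).card ≤ b) :
    Runs joinProg s (300000 * I.size b) (fun s' => Heap I s' ∧
      (∃ L, Obj I s' (s.reg ʀp) (PA ∪ PB) L (ZA + ZB + 300 * I.size b) ∧ I.Clean (PA ∪ PB) L ∧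
        ∀ v ∈ L, I.inc (PA ∪ PB) v < I.deg v) ∧
      ∀ y ≠ s.reg ʀp, ∀ P L Z, Obj I s y P L Z → Obj I s' y P L Z) := by
  have h1 := Inst.joinCost_le hA.list hB.list hAB cA cB bA bB bC
  have h2 := I.base_mul_le hM (Inst.keep_length_le hA.list hB.list hAB bC)
  have h3 := I.one_le_size b
  have h4 : (JoinData.merged LA LB).length ≤ I.joinCost PA PB LA LB := by
    set J := I.joinData s PA PB LA LB
    have := (sum_prod_take_le J.two_le_choices J.X J.X.length le_rfl).2
    rw [List.take_length] at this
    change _ < I.joinCost PA PB LA LB + 1 at this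
    change J.X.length ≤ _
    omega
  refine (joinProg_spec hH hA hB hAB).mono ?_ ?_
  · rw [mul_assoc 20]; omega
  · rintro s' - ⟨g1, g2, g3, g4⟩
    refine ⟨g1, ⟨_, g3.weaken (by omega), Inst.Clean.of_lt (Inst.inc_lt_of_mem_keep hA.list hB.list hAB) g3.list.pos,
      Inst.inc_lt_of_mem_keep hA.list hB.list hAB⟩, fun y hy P L Z ho => ?_⟩
    obtain ⟨e1, e2, e3⟩ := g4 y hy
    exact ho.mono g2 e1 e2 e3

/-! ### The parts of a contraction -/

section Parts

variable {m k : ℕ} {leaf : Fin m → Fin k} {own : Fin k → Fin k} {x p y : Fin k}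

/-- The edges whose leaves have been merged into `y`. -/
def part (leaf : Fin m → Fin k) (own : Fin k → Fin k) (y : Fin k) : Finset ℕ :=
  (Finset.univ.filter fun e => own (leaf e) = y).map Fin.valEmbedding

theorem mem_part {i : ℕ} : i ∈ part leaf own y ↔ ∃ h : i < m, own (leaf ⟨i, h⟩) = y := by
  simp only [part, Finset.mem_map, Finset.mem_filter, Finset.mem_univ, true_and,
    Fin.valEmbedding_apply]
  constructor
  · rintro ⟨e, he, rfl⟩
    exact ⟨e.2, he⟩
  · rintro ⟨h, he⟩
    exact ⟨⟨i, h⟩, he, rfl⟩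

theorem disjoint_part (h : x ≠ y) : Disjoint (part leaf own x) (part leaf own y) := by
  refine Finset.disjoint_left.2 fun i hi hi' => ?_
  obtain ⟨h1, h2⟩ := mem_part.1 hi
  obtain ⟨_, h3⟩ := mem_part.1 hi'
  exact h (h2.symm.trans h3)

theorem part_merge_self (h : p ≠ x) :
    part leaf (fun y => if own y = x then p else own y) p = part leaf own p ∪ part leaf own x := by
  ext i
  simp only [Finset.mem_union, mem_part]
  constructor
  · rintro ⟨h1, h2⟩
    split_ifs at h2 with h3
    exacts [Or.inr ⟨h1, h3⟩, Or.inl ⟨h1, h2⟩]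
  · rintro (⟨h1, h2⟩ | ⟨h1, h2⟩)
    · exact ⟨h1, by rw [h2, if_neg h]⟩
    · exact ⟨h1, by rw [h2, if_pos rfl]⟩

theorem part_merge_of_ne (h : y ≠ p) (h' : y ≠ x) :
    part leaf (fun y => if own y = x then p else own y) y = part leaf own y := by
  ext i
  simp only [mem_part]
  refine exists_congr fun h1 => ?_
  split_ifs with h3
  · simp [h3, h.symm, h'.symm]
  · rfl

/-- The number of nodes merged into `y`. -/
def fiber (own : Fin k → Fin k) (y : Fin k) : ℕ := (Finset.univ.filter fun z => own z = y).card

theorem fiber_merge_self (h : p ≠ x) :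
    fiber (fun y => if own y = x then p else own y) p = fiber own p + fiber own x := by
  rw [fiber, fiber, fiber, ← Finset.card_union_of_disjoint]
  · congr 1
    ext z
    simp only [Finset.mem_filter, Finset.mem_union, Finset.mem_univ, true_and]
    split_ifs with h3
    · simp [h3]
    · simp [h3]
  · refine Finset.disjoint_left.2 fun z h1 h2 => h ?_
    rw [← (Finset.mem_filter.1 h1).2, (Finset.mem_filter.1 h2).2]

theorem fiber_merge_of_ne (h : y ≠ p) (h' : y ≠ x) :
    fiber (fun y => if own y = x then p else own y) y = fiber own y := by
  rw [fiber, fiber]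
  congr 1
  ext z
  simp only [Finset.mem_filter, Finset.mem_univ, true_and]
  split_ifs with h3
  · simp [h3, h.symm, h'.symm]
  · rfl

theorem fiber_pos (h : own y = y) : 0 < fiber own y :=
  Finset.card_pos.2 ⟨y, Finset.mem_filter.2 ⟨Finset.mem_univ _, h⟩⟩

end Parts

theorem arrayOf_apply {k : ℕ} (f : Fin k → ℕ) (i : Fin k) : arrayOf f i = f i := by
  simp [arrayOf]

section Instance

variable {n m k : ℕ} {G : SimpleGraph (Fin n)} (d : Fin n → ℕ) (E : EdgeList G m)
  (B : BranchDecomposition G (Fin k))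

/-- The instance given by a list of edges and demands. -/
def instOf : Inst where
  eu := arrayOf fun i => (E.fst i : ℕ)
  ev := arrayOf fun i => (E.snd i : ℕ)
  d := arrayOf d
  m := m
  ds := maxDemand d
  M := maxDemand d + 2
  le_ds v := by
    rw [arrayOf]
    split_ifs
    · exact Finset.le_sup (f := d) (Finset.mem_univ _)
    · exact Nat.zero_le _
  ds_lt := by omega

/-- The leaf of the edge with index `i`. -/
def leafAt (i : Fin m) : Fin k := B.leafOf (E.edge i)

variable {d E B}

theorem instOf_eu (i : Fin m) : (instOf d E).eu i = E.fst i :=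
  arrayOf_apply (fun i => (E.fst i : ℕ)) i

theorem instOf_ev (i : Fin m) : (instOf d E).ev i = E.snd i :=
  arrayOf_apply (fun i => (E.snd i : ℕ)) i

theorem inc_pos_iff {P : Finset ℕ} (hP : ∀ i ∈ P, i < m) {v : ℕ} :
    0 < (instOf d E).inc P v ↔ ∃ i : Fin m, (i : ℕ) ∈ P ∧ ∃ w ∈ (E.edge i : Sym2 (Fin n)), ↑w = v := by
  rw [Inst.inc, incCount_pos]
  simp only [Finset.mem_union, Finset.mem_image, E.edge_eq]
  constructor
  · rintro (⟨i, hi, h⟩ | ⟨i, hi, h⟩)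
    · refine ⟨⟨i, hP i hi⟩, hi, E.fst ⟨i, hP i hi⟩, by simp, ?_⟩
      rw [← h]; exact (instOf_eu (⟨i, hP i hi⟩ : Fin m)).symm
    · refine ⟨⟨i, hP i hi⟩, hi, E.snd ⟨i, hP i hi⟩, by simp, ?_⟩
      rw [← h]; exact (instOf_ev (⟨i, hP i hi⟩ : Fin m)).symm
  · rintro ⟨i, hi, w, hw, rfl⟩
    rw [Sym2.mem_iff] at hw
    rcases hw with rfl | rfl
    · exact Or.inl ⟨i, hi, instOf_eu i⟩
    · exact Or.inr ⟨i, hi, instOf_ev i⟩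

/-- A boundary vertex of a part is incident to an edge whose leaf has been merged into `y` and to
one whose leaf has not, which is the situation of `boundary_le_width`. -/
theorem card_bdry_part_le [DecidableRel B.tree.Adj] {R : Finset (Fin k)} {own : Fin k → Fin k}
    (h : Contraction B.tree R own) {y : Fin k} (hy : y ∈ R) :
    ((instOf d E).bdry (part (leafAt E B) own y)).card ≤ B.width := by
  refine le_trans ?_ (B.boundary_le_width h hy)
  set S := {v : Fin n | ∃ e e' : G.edgeSet, v ∈ (e : Sym2 (Fin n)) ∧ v ∈ (e' : Sym2 (Fin n)) ∧
      own (B.leafOf e) = y ∧ own (B.leafOf e') ≠ y}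
  rw [← Set.ncard_image_of_injective S Fin.val_injective, ← Set.ncard_coe_finset]
  refine Set.ncard_le_ncard ?_ (Set.toFinite _)
  intro v hv
  rw [Finset.mem_coe, Inst.mem_bdry] at hv
  set P := part (leafAt E B) own y with hP
  have hsub : P ⊆ Finset.range m := fun i hi => Finset.mem_range.2 (mem_part.1 hi).1
  have h2 : 0 < (instOf d E).inc (Finset.range m \ P) v := by
    have h3 : (instOf d E).deg v = (instOf d E).inc P v +
        (instOf d E).inc (Finset.range m \ P) v := by
      have h4 := nbSum_union (eu := (instOf d E).eu) (ev := (instOf d E).ev) (g := fun _ => 1)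
        (v := v) (Finset.disjoint_sdiff (s := P) (t := Finset.range m))
      rw [Finset.union_sdiff_of_subset hsub] at h4
      exact h4
    omega
  obtain ⟨i, hi, w, hw, rfl⟩ := (inc_pos_iff fun i hi => Finset.mem_range.1 (hsub hi)).1 hv.1
  obtain ⟨i', hi', w', hw', he⟩ := (inc_pos_iff fun i hi =>
    Finset.mem_range.1 (Finset.mem_sdiff.1 hi).1).1 h2
  obtain rfl := Fin.ext he
  refine ⟨w', ⟨E.edge i, E.edge i', hw, hw', (mem_part.1 hi).2, fun h => ?_⟩, rfl⟩
  exact (Finset.mem_sdiff.1 hi').2 (mem_part.2 ⟨i'.2, h⟩)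

end Instance

end RAM

/-! ### The contraction loop. -/

namespace RAM

def unlink : Prog :=
  .setArr ᴀtdeg (𝐑 ʀx) (κ 0) ;; .setArr ᴀtdeg (𝐑 ʀp) (ᴀtdeg⁅𝐑 ʀp⁆ - κ 1) ;;
  .setArr ᴀtsum (𝐑 ʀp) (ᴀtsum⁅𝐑 ʀp⁆ - 𝐑 ʀx) ;; ʀlast ≔ 𝐑 ʀp ;; ʀx ≔ 𝐑 ʀp

/-- A scan as for Prüfer codes: nodes are inspected in increasing order, but after a contraction the
scan first follows the parent, which may just have become a leaf. Hence among the nodes up to `nd`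
only the current one can have degree one, and no queue of leaves is needed. -/
def contractStep : Prog :=
  .ite (.eq (ᴀtdeg⁅𝐑 ʀx⁆) (κ 1)) (ʀp ≔ ᴀtsum⁅𝐑 ʀx⁆ ;; joinProg ;; unlink)
    (ʀnd ≔ 𝐑 ʀnd + κ 1 ;; ʀx ≔ 𝐑 ʀnd)

def contractLoop : Prog := .loop (.lt (𝐑 ʀnd) (𝐑 ʀk)) contractStep

variable {n m k : ℕ} {G : SimpleGraph (Fin n)} {d : Fin n → ℕ} {E : EdgeList G m}
  {B : BranchDecomposition G (Fin k)} [DecidableRel B.tree.Adj]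

/-- A bound for the cost of the recovery of a solution from `a` merged nodes. -/
def recCost (c a : ℕ) : ℕ := c * (2 * a - 1)

/-- A binary tree with `a` leaves has `2 * a - 1` nodes. With this choice the cost is additive with
exactly one further `c` for the join. -/
theorem recCost_add {c a a' : ℕ} (h : 0 < a) (h' : 0 < a') :
    recCost c a + recCost c a' + c ≤ recCost c (a + a') := by
  obtain ⟨a, rfl⟩ := Nat.exists_eq_succ_of_ne_zero h.ne'
  obtain ⟨a', rfl⟩ := Nat.exists_eq_succ_of_ne_zero h'.ne'
  have e1 : 2 * a.succ - 1 = 2 * a + 1 := by omega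
  have e2 : 2 * a'.succ - 1 = 2 * a' + 1 := by omega
  have e3 : 2 * (a.succ + a'.succ) - 1 = 2 * a + 2 * a' + 3 := by omega
  rw [recCost, recCost, recCost, e1, e2, e3]
  exact le_of_eq (by ring)

/-- The invariant of the contraction: objects for all the nodes in `R`. -/
structure Contracted (d : Fin n → ℕ) (E : EdgeList G m) (B : BranchDecomposition G (Fin k))
    [DecidableRel B.tree.Adj] (R : Finset (Fin k)) (own : Fin k → Fin k) (s : Store) : Prop where
  tree : Contraction B.tree R own
  heap : Heap (instOf d E) s
  obj : ∀ y ∈ R, ∃ L, Obj (instOf d E) s y (part (leafAt E B) own y) L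
    (recCost (300 * (instOf d E).size B.width) (fiber own y)) ∧
    (instOf d E).Clean (part (leafAt E B) own y) L
  empty : Obj (instOf d E) s k ∅ [] 1
  tdeg : ∀ y : Fin k, s.arr ᴀtdeg y = if y ∈ R then (R.filter (B.tree.Adj y)).card else 0
  tdeg_out : ∀ y, k ≤ y → s.arr ᴀtdeg y = 0
  tsum : ∀ y ∈ R, s.arr ᴀtsum (y : Fin k) = ∑ z ∈ R.filter (B.tree.Adj y), (z : ℕ)
  last : ∃ y ∈ R, s.reg ʀlast = ((y : Fin k) : ℕ)
  size : s.reg ʀk = k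
  done : ∀ j ∈ R, ((j : Fin k) : ℕ) ≤ s.reg ʀnd → (j : ℕ) ≠ s.reg ʀx →
    (R.filter (B.tree.Adj j)).card ≠ 1
  halt : s.reg ʀnd < k ∨ (s.reg ʀnd = k ∧ s.reg ʀx = k)

theorem Contracted.contract {R : Finset (Fin k)} {own : Fin k → Fin k} {s : Store}
    (h : Contracted d E B R own s) (hi : s.reg ʀnd < k) (h1 : s.arr ᴀtdeg (s.reg ʀx) = 1) :
    Runs (ʀp ≔ ᴀtsum⁅𝐑 ʀx⁆ ;; joinProg ;; unlink) s (300000 * (instOf d E).size B.width + 100)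
      (fun s' => s'.reg ʀnd = s.reg ʀnd ∧ ∃ x ∈ R, ∃ p : Fin k, Contracted d E B (R.erase x)
        (fun y => if own y = x then p else own y) s') := by
  have hxk : s.reg ʀx < k := by
    by_contra hk
    rw [h.tdeg_out _ (not_lt.1 hk)] at h1
    omega
  obtain ⟨x, hx⟩ : ∃ x : Fin k, (x : ℕ) = s.reg ʀx := ⟨⟨_, hxk⟩, rfl⟩
  rw [← hx, h.tdeg] at h1
  have hxR : x ∈ R := by
    by_contra hn
    rw [if_neg hn] at h1
    omega
  rw [if_pos hxR, Finset.card_eq_one] at h1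
  obtain ⟨p, hp⟩ := h1
  have hp' : p ∈ R ∧ B.tree.Adj x p := Finset.mem_filter.1 (hp ▸ Finset.mem_singleton_self p)
  have hne : p ≠ x := hp'.2.ne'
  -- The sum of the neighbour indices is the index of the only neighbour, so the parent is found
  -- without adjacency lists.
  have hsum : s.arr ᴀtsum (s.reg ʀx) = p := by
    rw [← hx, h.tsum x hxR, hp, Finset.sum_singleton]
  have htree := h.tree.step hxR hp
  have hpR : p ∈ R.erase x := Finset.mem_erase.2 ⟨hne, hp'.1⟩
  set own' := fun y => if own y = x then p else own y with hown
  set I := instOf d E with hI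
  refine ((Runs.flat_seq rfl (p := ʀp ≔ ᴀtsum⁅𝐑 ʀx⁆) ((joinProg_runs (I := I) (b := B.width)
    (PA := part (leafAt E B) own p) (PB := part (leafAt E B) own x)
    (LA := (h.obj p hp'.1).choose) (LB := (h.obj x hxR).choose)
    (ZA := recCost (300 * I.size B.width) (fiber own p))
    (ZB := recCost (300 * I.size B.width) (fiber own x)) rfl ?_ ?_ ?_ (disjoint_part hne)
    (h.obj p hp'.1).choose_spec.2
    (h.obj x hxR).choose_spec.2 (card_bdry_part_le h.tree hp'.1) (card_bdry_part_le h.tree hxR)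
    ?_).seq fun s₂ f₂ h₂ => Runs.flat (B := unlink.bound) rfl le_rfl ?_))).mono ?_ (fun _ _ h => h)
  · have f₁ : Frame (ʀp ≔ ᴀtsum⁅𝐑 ʀx⁆) s _ := Prog.run_frame _ rfl s
    exact h.heap.of_frame f₁ (by decide) (by decide)
  · have f₁ : Frame (ʀp ≔ ᴀtsum⁅𝐑 ʀx⁆) s _ := Prog.run_frame _ rfl s
    have := (h.obj p hp'.1).choose_spec.1.mono (Extends.of_frame f₁ (by decide) (by decide)) rfl rfl rfl
    simpa [Prog.run, hsum] using this
  · have f₁ : Frame (ʀp ≔ ᴀtsum⁅𝐑 ʀx⁆) s _ := Prog.run_frame _ rfl s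
    have := (h.obj x hxR).choose_spec.1.mono (Extends.of_frame f₁ (by decide) (by decide)) rfl rfl rfl
    simpa [Prog.run, ← hx] using this
  · rw [← part_merge_self hne]
    exact card_bdry_part_le htree hpR
  · obtain ⟨g1, ⟨L, g2, g3, -⟩, g4⟩ := h₂
    have f₁ : Frame (ʀp ≔ ᴀtsum⁅𝐑 ʀx⁆) s _ := Prog.run_frame _ rfl s
    have f₃ : Frame unlink s₂ _ := Prog.run_frame unlink rfl s₂
    have e₁ := Extends.of_frame f₁ (by decide) (by decide)
    have e₃ := Extends.of_frame f₃ (by decide) (by decide)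
    set s₁ := Prog.run (ʀp ≔ ᴀtsum⁅𝐑 ʀx⁆) s with hs₁
    have p1 : s₁.reg ʀp = p := by simp [hs₁, Prog.run, hsum]
    have p2 : s₂.reg ʀp = p := by rw [f₂.reg _ (by decide), p1]
    have x2 : s₂.reg ʀx = x := by
      rw [f₂.reg _ (by decide), f₁.reg _ (by decide), hx]
    have td2 : s₂.arr ᴀtdeg = s.arr ᴀtdeg := by
      rw [f₂.arr _ (by decide), f₁.arr _ (by decide)]
    have ts2 : s₂.arr ᴀtsum = s.arr ᴀtsum := by
      rw [f₂.arr _ (by decide), f₁.arr _ (by decide)]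
    have keepObj : ∀ y, y ≠ (p : ℕ) → ∀ P L Z, Obj I s y P L Z → Obj I (unlink.run s₂) y P L Z := by
      intro y hy P L Z ho
      exact (g4 y (by rw [p1]; exact hy) P L Z (ho.mono e₁ rfl rfl rfl)).mono e₃ rfl rfl rfl
    have hval : ∀ y : Fin k, y ≠ x → ((y : ℕ) ≠ (x : ℕ)) := fun y h h' => h (Fin.ext h')
    have hvp : ∀ y : Fin k, ((y : ℕ) = (p : ℕ)) ↔ y = p := fun y => ⟨Fin.ext, fun h => h ▸ rfl⟩
    have nd : (unlink.run s₂).reg ʀnd = s.reg ʀnd := by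
      rw [f₃.reg _ (by decide), f₂.reg _ (by decide), f₁.reg _ (by decide)]
    have xr : (unlink.run s₂).reg ʀx = p := by simp [unlink, Prog.run, p2]
    have card' : ∀ y ∈ R.erase x, ((R.erase x).filter (B.tree.Adj y)).card +
        (if y = p then 1 else 0) = (R.filter (B.tree.Adj y)).card := fun y hy => by
      have := sum_filter_erase hxR hp (fun _ => 1) (Finset.mem_of_mem_erase hy)
      rwa [← Finset.card_eq_sum_ones, ← Finset.card_eq_sum_ones] at this
    refine ⟨nd, x, hxR, p, htree, g1.of_frame f₃ (by decide) (by decide), ?_, ?_, ?_, ?_, ?_, ?_,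
      ?_, ?_, ?_⟩
    · intro y hy
      rw [Finset.mem_erase] at hy
      by_cases hyp : y = p
      · subst hyp
        rw [part_merge_self hne, fiber_merge_self hne]
        refine ⟨L, ?_, g3⟩
        rw [p1] at g2
        exact (g2.mono e₃ rfl rfl rfl).weaken
          (recCost_add (fiber_pos (h.tree.self y hp'.1)) (fiber_pos (h.tree.self x hxR)))
      · rw [part_merge_of_ne hyp hy.1, fiber_merge_of_ne hyp hy.1]
        obtain ⟨L', h3, h4⟩ := h.obj y hy.2
        exact ⟨L', keepObj y (fun h => hyp (Fin.ext h)) _ _ _ h3, h4⟩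
    · exact keepObj k p.2.ne' _ _ _ h.empty
    · intro y
      by_cases hyx : y = x
      · subst hyx
        simp [unlink, Prog.run, p2, x2, hne.symm, Fin.val_inj]
      · have h3 := hval y hyx
        by_cases hyR : y ∈ R
        · have h4 := card' y (Finset.mem_erase.2 ⟨hyx, hyR⟩)
          rw [if_pos (Finset.mem_erase.2 ⟨hyx, hyR⟩)]
          have h5 := h.tdeg y
          rw [if_pos hyR] at h5
          by_cases hyp : y = p
          · subst hyp
            rw [if_pos rfl] at h4
            simp [unlink, Prog.run, p2, x2, h3, td2, h5]
            omega
          · have h6 := (hvp y).not.2 hyp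
            rw [if_neg hyp] at h4
            simp [unlink, Prog.run, p2, x2, h3, h6, td2, h5]
            omega
        · have hyp : y ≠ p := fun h => hyR (h ▸ hp'.1)
          have h6 := (hvp y).not.2 hyp
          have h5 := h.tdeg y
          rw [if_neg hyR] at h5
          rw [if_neg fun h => hyR (Finset.mem_of_mem_erase h)]
          simp [unlink, Prog.run, p2, x2, h3, h6, td2, h5]
    · intro y hy
      have h3 : y ≠ p := fun h => by have := p.2; omega
      have h4 : y ≠ x := fun h => by have := x.2; omega
      simp [unlink, Prog.run, p2, x2, h3, h4, td2, h.tdeg_out y hy]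
    · intro y hy
      have h3 := sum_filter_erase hxR hp (fun z => (z : ℕ)) (Finset.mem_of_mem_erase hy)
      have h5 := h.tsum y (Finset.mem_of_mem_erase hy)
      by_cases hyp : y = p
      · subst hyp
        rw [if_pos rfl] at h3
        simp [unlink, Prog.run, p2, x2, ts2, h5]
        omega
      · have h6 := (hvp y).not.2 hyp
        rw [if_neg hyp] at h3
        simp [unlink, Prog.run, p2, x2, h6, ts2, h5]
        omega
    · exact ⟨p, hpR, by simp [unlink, Prog.run, p2]⟩
    · rw [f₃.reg _ (by decide), f₂.reg _ (by decide), f₁.reg _ (by decide), h.size]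
    · intro j hj hj1 hj2
      rw [nd] at hj1
      rw [xr] at hj2
      have h3 := card' j hj
      rw [if_neg ((hvp j).not.1 hj2), add_zero] at h3
      rw [h3]
      rw [Finset.mem_erase] at hj
      exact h.done j hj.2 hj1 (by rw [← hx]; exact hval j hj.1)
    · left; rw [nd]; exact hi
  · simp [Prog.bound, Term.cost, unlink]
    omega

/-- A round either removes a node from `R` or advances `nd`; the potential charges the cost of a
join for every node of `R` and a constant for every node not yet scanned. -/
theorem contractLoop_spec {R : Finset (Fin k)} {own : Fin k → Fin k} {s : Store}
    (h : Contracted d E B R own s) :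
    Runs contractLoop s (R.card * (300000 * (instOf d E).size B.width + 200) + k * 100 + 100)
      (fun s' => ∃ y own', Contracted d E B {y} own' s' ∧ ∀ z, own' z = y) := by
  refine (Runs.loop_potential (fun φ s => ∃ R own, Contracted d E B R own s ∧
    R.card * (300000 * (instOf d E).size B.width + 200) + (k - s.reg ʀnd) * 100 ≤ φ) ?_
    (R.card * (300000 * (instOf d E).size B.width + 200) + k * 100) s
    ⟨R, own, h, by omega⟩).mono ?_ ?_
  · rintro φ s ⟨R, own, h, hφ⟩ hc
    have hi : s.reg ʀnd < k := by simpa [h.size] using hc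
    by_cases h1 : s.arr ᴀtdeg (s.reg ʀx) = 1
    · refine ⟨φ - (300000 * (instOf d E).size B.width + 200),
        300000 * (instOf d E).size B.width + 105, ?_, ?_⟩
      · have hR : 0 < R.card := by
          obtain ⟨y, hy, -⟩ := h.last
          exact Finset.card_pos.2 ⟨y, hy⟩
        have := Nat.le_mul_of_pos_left (300000 * (instOf d E).size B.width + 200) hR
        simp [Test.cost, Term.cost]
        omega
      · refine (Runs.ite (B := 300000 * (instOf d E).size B.width + 100) (fun _ =>
          h.contract hi h1) (fun hn => absurd (by simpa using h1) hn)).mono ?_ ?_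
        · simp [Test.cost, Term.cost]; omega
        · rintro s' - ⟨h2, x, hx, p, h3⟩
          refine ⟨_, _, h3, ?_⟩
          rw [h2]
          have := Finset.card_erase_add_one hx
          rw [← this, add_mul, one_mul] at hφ
          omega
    · refine ⟨φ - 100, 50, ?_, ?_⟩
      · have : 100 ≤ (k - s.reg ʀnd) * 100 := by omega
        simp [Test.cost, Term.cost]
        omega
      · refine (Runs.ite (B := 40) (fun hn => absurd (by simpa using hn) h1) (fun _ =>
          Runs.flat rfl (by simp [Prog.bound, Term.cost]) (Q := fun s' => s' = Prog.run
            (ʀnd ≔ 𝐑 ʀnd + κ 1 ;; ʀx ≔ 𝐑 ʀnd) s) rfl)).mono ?_ ?_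
        · simp [Test.cost, Term.cost]
        · rintro s' - rfl
          have f : Frame (ʀnd ≔ 𝐑 ʀnd + κ 1 ;; ʀx ≔ 𝐑 ʀnd) s _ := Prog.run_frame _ rfl s
          have e := Extends.of_frame f (by decide) (by decide)
          have n1 : (Prog.run (ʀnd ≔ 𝐑 ʀnd + κ 1 ;; ʀx ≔ 𝐑 ʀnd) s).reg ʀnd = s.reg ʀnd + 1 := by
            simp [Prog.run]
          have n2 : (Prog.run (ʀnd ≔ 𝐑 ʀnd + κ 1 ;; ʀx ≔ 𝐑 ʀnd) s).reg ʀx = s.reg ʀnd + 1 := by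
            simp [Prog.run]
          refine ⟨R, own, ⟨h.tree, h.heap.of_frame f (by decide) (by decide), fun y hy => ?_,
            h.empty.mono e rfl rfl rfl, h.tdeg, h.tdeg_out, h.tsum, h.last, h.size, ?_, ?_⟩, ?_⟩
          · obtain ⟨L, h2, h3⟩ := h.obj y hy
            exact ⟨L, h2.mono e rfl rfl rfl, h3⟩
          · intro j hj hj1 hj2
            rw [n1] at hj1
            rw [n2] at hj2
            by_cases hjx : (j : ℕ) = s.reg ʀx
            · rw [← hjx, h.tdeg, if_pos hj] at h1
              exact h1
            · exact h.done j hj (by omega) hjx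
          · rw [n1, n2]; omega
          · rw [n1]; omega
  · simp [Test.cost, Term.cost]
  · rintro s' - ⟨⟨φ, R, own, h, -⟩, hc⟩
    have hi : ¬ s'.reg ʀnd < k := by simpa [h.size] using hc
    have hs := h.halt.resolve_left hi
    obtain ⟨y, hy, -⟩ := h.last
    -- The scan has passed all nodes, so no node of degree one is left.
    have hall : ∀ z, own z = y := h.tree.exists_leaf B.isTree.connected (fun j hj =>
      h.done j hj (by have := j.2; omega) (by have := j.2; omega)) hy
    have hR : R = {y} := by
      ext z
      rw [Finset.mem_singleton]
      refine ⟨fun hz => by rw [← h.tree.self z hz, hall], fun hz => hz ▸ hy⟩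
    subst hR
    exact ⟨y, own, h, hall⟩

end RAM

namespace RAM

/-! ### Reading the input -/

theorem nbSum_range_succ {eu ev g : ℕ → ℕ} {j v : ℕ} :
    nbSum eu ev (Finset.range (j + 1)) g v = nbSum eu ev (Finset.range j) g v +
      ((if eu j = v then g (ev j) else 0) + (if ev j = v then g (eu j) else 0)) :=
  Finset.sum_range_succ _ _

def degStep : Prog :=
  .setArr ᴀdeg (ᴀeu⁅𝐑 ʀe⁆) (ᴀdeg⁅ᴀeu⁅𝐑 ʀe⁆⁆ + κ 1) ;;
  .setArr ᴀdeg (ᴀev⁅𝐑 ʀe⁆) (ᴀdeg⁅ᴀev⁅𝐑 ʀe⁆⁆ + κ 1) ;; ʀe ≔ 𝐑 ʀe + κ 1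

def degLoop : Prog := ʀe ≔ κ 0 ;; .loop (.lt (𝐑 ʀe) (𝐑 ʀm)) degStep

theorem degLoop_spec {s : Store} (h : ∀ v, s.arr ᴀdeg v = 0) :
    Runs degLoop s (s.reg ʀm * 30 + 10) (fun s' => ∀ v, s'.arr ᴀdeg v =
      incCount (s.arr ᴀeu) (s.arr ᴀev) (Finset.range (s.reg ʀm)) v) := by
  refine (Runs.flat_seq rfl (Runs.loop_const (s.reg ʀm) (fun j s' => s'.reg ʀe = j ∧
    ∀ v, s'.arr ᴀdeg v = incCount (s.arr ᴀeu) (s.arr ᴀev) (Finset.range j) v) degStep.bound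
    ?_ ?_ ?_)).mono ?_ ?_
  · exact ⟨by simp [Prog.run], fun v => by simp [Prog.run, h, incCount, nbSum]⟩
  · rintro j hj s' f ⟨h1, h2⟩
    have e0 : s'.reg ʀm = s.reg ʀm := f.reg _ (by decide)
    have e1 : s'.arr ᴀeu = s.arr ᴀeu := f.arr _ (by decide)
    have e2 : s'.arr ᴀev = s.arr ᴀev := f.arr _ (by decide)
    refine ⟨by simpa [h1, e0] using hj, Runs.flat rfl le_rfl ⟨by simp [degStep, Prog.run, h1],
      fun v => ?_⟩⟩
    rw [incCount, nbSum_range_succ]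
    change _ = incCount _ _ _ _ + _
    have h3 := h2 (s.arr ᴀeu j)
    have h4 := h2 (s.arr ᴀev j)
    have h5 := h2 v
    by_cases c1 : v = s.arr ᴀeu j
    · by_cases c2 : v = s.arr ᴀev j
      · simp [degStep, Prog.run, h1, e1, e2, ← c1, ← c2, h5]
      · simp [degStep, Prog.run, h1, e1, e2, ← c1, c2, Ne.symm c2, h5]
    · by_cases c2 : v = s.arr ᴀev j
      · simp [degStep, Prog.run, h1, e1, e2, c1, Ne.symm c1, ← c2, h5]
      · simp [degStep, Prog.run, h1, e1, e2, c1, Ne.symm c1, c2, Ne.symm c2, h5]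
  · rintro s' f ⟨h1, -⟩
    have e0 : s'.reg ʀm = s.reg ʀm := f.reg _ (by decide)
    simp [h1, e0]
  · simp [Test.cost, Term.cost, degStep, Prog.bound]
    omega
  · rintro s' - ⟨⟨-, h2⟩, -⟩
    exact h2

def treeStep : Prog :=
  .setArr ᴀtdeg (ᴀta⁅𝐑 ʀe⁆) (ᴀtdeg⁅ᴀta⁅𝐑 ʀe⁆⁆ + κ 1) ;;
  .setArr ᴀtsum (ᴀta⁅𝐑 ʀe⁆) (ᴀtsum⁅ᴀta⁅𝐑 ʀe⁆⁆ + ᴀtb⁅𝐑 ʀe⁆) ;;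
  .setArr ᴀtdeg (ᴀtb⁅𝐑 ʀe⁆) (ᴀtdeg⁅ᴀtb⁅𝐑 ʀe⁆⁆ + κ 1) ;;
  .setArr ᴀtsum (ᴀtb⁅𝐑 ʀe⁆) (ᴀtsum⁅ᴀtb⁅𝐑 ʀe⁆⁆ + ᴀta⁅𝐑 ʀe⁆) ;; ʀe ≔ 𝐑 ʀe + κ 1

def treeLoop : Prog := ʀe ≔ κ 0 ;; .loop (.lt (𝐑 ʀe) (𝐑 ʀl)) treeStep

theorem treeLoop_spec {s : Store} (h : ∀ v, s.arr ᴀtdeg v = 0 ∧ s.arr ᴀtsum v = 0) :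
    Runs treeLoop s (s.reg ʀl * 60 + 10) (fun s' => ∀ v, s'.arr ᴀtdeg v =
      incCount (s.arr ᴀta) (s.arr ᴀtb) (Finset.range (s.reg ʀl)) v ∧ s'.arr ᴀtsum v =
      nbSum (s.arr ᴀta) (s.arr ᴀtb) (Finset.range (s.reg ʀl)) (fun w => w) v) := by
  refine (Runs.flat_seq rfl (Runs.loop_const (s.reg ʀl) (fun j s' => s'.reg ʀe = j ∧
    ∀ v, s'.arr ᴀtdeg v = incCount (s.arr ᴀta) (s.arr ᴀtb) (Finset.range j) v ∧
      s'.arr ᴀtsum v = nbSum (s.arr ᴀta) (s.arr ᴀtb) (Finset.range j) (fun w => w) v)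
    treeStep.bound ?_ ?_ ?_)).mono ?_ ?_
  · exact ⟨by simp [Prog.run], fun v => by simp [Prog.run, h, incCount, nbSum]⟩
  · rintro j hj s' f ⟨h1, h2⟩
    have e0 : s'.reg ʀl = s.reg ʀl := f.reg _ (by decide)
    have e1 : s'.arr ᴀta = s.arr ᴀta := f.arr _ (by decide)
    have e2 : s'.arr ᴀtb = s.arr ᴀtb := f.arr _ (by decide)
    refine ⟨by simpa [h1, e0] using hj, Runs.flat rfl le_rfl ⟨by simp [treeStep, Prog.run, h1],
      fun v => ?_⟩⟩
    rw [incCount, nbSum_range_succ, nbSum_range_succ]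
    change _ = incCount _ _ _ _ + _ ∧ _
    obtain ⟨h5, h6⟩ := h2 v
    by_cases c1 : v = s.arr ᴀta j
    · by_cases c2 : v = s.arr ᴀtb j
      · simp [treeStep, Prog.run, h1, e1, e2, ← c1, ← c2, h5, h6, add_assoc]
      · simp [treeStep, Prog.run, h1, e1, e2, ← c1, c2, Ne.symm c2, h5, h6]
    · by_cases c2 : v = s.arr ᴀtb j
      · simp [treeStep, Prog.run, h1, e1, e2, c1, Ne.symm c1, ← c2, h5, h6]
      · simp [treeStep, Prog.run, h1, e1, e2, c1, Ne.symm c1, c2, Ne.symm c2, h5, h6]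
  · rintro s' f ⟨h1, -⟩
    have e0 : s'.reg ʀl = s.reg ʀl := f.reg _ (by decide)
    simp [h1, e0]
  · simp [Test.cost, Term.cost, treeStep, Prog.bound]
    omega
  · rintro s' - ⟨⟨-, h2⟩, -⟩
    exact h2

/-- One pass finds the maximum demand, flags a demand above the degree plus one, and writes the
demands of isolated vertices to the output. If nothing is flagged, the latter are `0` or `1` and
already say which isolated vertices are selected. -/
def vertStep : Prog :=
  .ite (.lt (𝐑 ʀds) (ᴀd⁅𝐑 ʀe⁆)) (ʀds ≔ ᴀd⁅𝐑 ʀe⁆) .skip ;;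
  .ite (.lt (ᴀdeg⁅𝐑 ʀe⁆ + κ 1) (ᴀd⁅𝐑 ʀe⁆)) (ʀbad ≔ κ 1) .skip ;;
  .ite (.eq (ᴀdeg⁅𝐑 ʀe⁆) (κ 0)) (.setArr ᴀout (𝐑 ʀe) (ᴀd⁅𝐑 ʀe⁆)) .skip ;;
  ʀe ≔ 𝐑 ʀe + κ 1

def vertLoop : Prog := ʀe ≔ κ 0 ;; .loop (.lt (𝐑 ʀe) (𝐑 ʀn)) vertStep

theorem vertLoop_spec {s : Store} (h : ∀ v, s.arr ᴀout v = 0) (hds : s.reg ʀds = 0)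
    (hbad : s.reg ʀbad = 0) :
    Runs vertLoop s (s.reg ʀn * 50 + 10) (fun s' =>
      s'.reg ʀds = (Finset.range (s.reg ʀn)).sup (s.arr ᴀd) ∧
      (s'.reg ʀbad = 0 ↔ ∀ v < s.reg ʀn, s.arr ᴀd v ≤ s.arr ᴀdeg v + 1) ∧
      ∀ v, s'.arr ᴀout v = if v < s.reg ʀn ∧ s.arr ᴀdeg v = 0 then s.arr ᴀd v else 0) := by
  refine (Runs.flat_seq rfl (Runs.loop_const (s.reg ʀn) (fun j s' => s'.reg ʀe = j ∧
      s'.reg ʀds = (Finset.range j).sup (s.arr ᴀd) ∧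
      (s'.reg ʀbad = 0 ↔ ∀ v < j, s.arr ᴀd v ≤ s.arr ᴀdeg v + 1) ∧
      ∀ v, s'.arr ᴀout v = if v < j ∧ s.arr ᴀdeg v = 0 then s.arr ᴀd v else 0)
    vertStep.bound ?_ ?_ ?_)).mono ?_ ?_
  · exact ⟨by simp [Prog.run], by simp [Prog.run, hds], by simp [Prog.run, hbad],
      fun v => by simp [Prog.run, h]⟩
  · rintro j hj s' f ⟨h1, h2, h3, h4⟩
    have e0 : s'.reg ʀn = s.reg ʀn := f.reg _ (by decide)
    have e1 : s'.arr ᴀd = s.arr ᴀd := f.arr _ (by decide)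
    have e2 : s'.arr ᴀdeg = s.arr ᴀdeg := f.arr _ (by decide)
    refine ⟨by simpa [h1, e0] using hj, Runs.flat rfl le_rfl ?_⟩
    rw [Finset.range_add_one, Finset.sup_insert]
    have c1 : (vertStep.run s').reg ʀe = j + 1 := by
      simp only [vertStep, Prog.run]
      split_ifs <;> simp [h1]
    have c2 : (vertStep.run s').reg ʀds = max (s'.reg ʀds) (s.arr ᴀd j) := by
      simp only [vertStep, Prog.run]
      by_cases g : s'.reg ʀds < s.arr ᴀd j
      · rw [max_eq_right g.le]
        by_cases g'' : s.arr ᴀdeg j = 0 <;> by_cases g' : s.arr ᴀdeg j + 1 < s.arr ᴀd j <;>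
          (try simp only [g''] at g') <;> simp [e1, e2, h1, g, g', g'']
      · rw [max_eq_left (not_lt.1 g)]
        by_cases g'' : s.arr ᴀdeg j = 0 <;> by_cases g' : s.arr ᴀdeg j + 1 < s.arr ᴀd j <;>
          (try simp only [g''] at g') <;> simp [e1, e2, h1, g, g', g'']
    have c3 : (vertStep.run s').reg ʀbad = if s.arr ᴀdeg j + 1 < s.arr ᴀd j then 1
        else s'.reg ʀbad := by
      simp only [vertStep, Prog.run]
      by_cases g : s'.reg ʀds < s.arr ᴀd j <;> by_cases g'' : s.arr ᴀdeg j = 0 <;>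
        by_cases g' : s.arr ᴀdeg j + 1 < s.arr ᴀd j <;> (try simp only [g''] at g') <;>
        simp [e1, e2, h1, g, g', g'']
    have c4 : ∀ v, (vertStep.run s').arr ᴀout v = if v = j ∧ s.arr ᴀdeg j = 0 then s.arr ᴀd j
        else s'.arr ᴀout v := by
      intro v
      simp only [vertStep, Prog.run]
      by_cases g : s'.reg ʀds < s.arr ᴀd j <;> by_cases g'' : s.arr ᴀdeg j = 0 <;>
        by_cases g' : s.arr ᴀdeg j + 1 < s.arr ᴀd j <;> (try simp only [g''] at g') <;>
        simp [e1, e2, h1, g, g', g'']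
    refine ⟨c1, by rw [c2, h2]; exact sup_comm _ _, ?_, fun v => ?_⟩
    · rw [c3]
      split_ifs with g
      · simp only [false_iff, not_forall]
        exact ⟨j, by omega, by omega⟩
      · rw [h3]
        refine ⟨fun h v hv => ?_, fun h v hv => h v (by omega)⟩
        rcases Nat.lt_succ_iff_lt_or_eq.1 hv with hv | rfl
        exacts [h v hv, by omega]
    · rw [c4, h4]
      by_cases g : v = j
      · subst g; simp
      · simp only [g, false_and, if_false]
        have : v < j ↔ v < j + 1 := by omega
        simp only [this]
  · rintro s' f ⟨h1, -⟩
    have e0 : s'.reg ʀn = s.reg ʀn := f.reg _ (by decide)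
    simp [h1, e0]
  · simp [Test.cost, Term.cost, vertStep, Prog.bound]
    omega
  · rintro s' - ⟨⟨-, h2⟩, -⟩
    exact h2

/-- Multiply `2 * M` by `M`. -/
def squareLoop : Prog :=
  ʀM ≔ 𝐑 ʀds + κ 2 ;; ʀe ≔ κ 0 ;; ʀst ≔ κ 0 ;;
  .loop (.lt (𝐑 ʀe) (𝐑 ʀM)) (ʀst ≔ 𝐑 ʀst + (𝐑 ʀM + 𝐑 ʀM) ;; ʀe ≔ 𝐑 ʀe + κ 1)

theorem squareLoop_spec (s : Store) : Runs squareLoop s (s.reg ʀds * 20 + 100)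
    (fun s' => s'.reg ʀM = s.reg ʀds + 2 ∧
      s'.reg ʀst = (s.reg ʀds + 2) * (2 * (s.reg ʀds + 2))) := by
  refine (Runs.flat_seq rfl (Runs.flat_seq rfl (Runs.flat_seq rfl (Runs.loop_const
    (s.reg ʀds + 2) (fun j s' => s'.reg ʀe = j ∧ s'.reg ʀM = s.reg ʀds + 2 ∧
    s'.reg ʀst = j * (2 * (s.reg ʀds + 2))) 11 ?_ ?_ ?_)))).mono ?_ ?_
  · simp [Prog.run]
  · rintro j hj s' f ⟨h1, h2, h3⟩
    refine ⟨by simpa [h1, h2] using hj, Runs.flat rfl (by simp [Prog.bound, Term.cost]) ?_⟩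
    simp [Prog.run, h1, h2, h3]
    ring
  · rintro s' f ⟨h1, h2, h3⟩
    simp [h1, h2]
  · simp [Test.cost, Term.cost, Prog.bound]
    omega
  · rintro s' - ⟨h2, -⟩
    exact h2.2

end RAM

namespace RAM

/-! ### The tables of single edges -/

/-- The number of `n` copies of a term. -/
def Term.scale (t : Term) : ℕ → Term
  | 0 => κ 0
  | n + 1 => t.scale n + t

@[simp] theorem Term.eval_scale (t : Term) (s : Store) (n : ℕ) :
    (t.scale n).eval s = n * t.eval s := by
  induction n with
  | zero => simp [Term.scale]
  | succ n ih => simp [Term.scale, ih, add_mul]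

/-- The states of an edge `uv`: selection of `u`, demanded selected neighbours of `u`, the same
for `v`. -/
def edgeStates : List (ℕ × ℕ × ℕ × ℕ) :=
  ((List.range 2).product ((List.range 2).product ((List.range 2).product (List.range 2)))).filter
    fun q => q.2.1 ≤ q.2.2.1 ∧ q.2.2.2 ≤ q.1

theorem mem_edgeStates {su cu sv cv : ℕ} :
    (su, cu, sv, cv) ∈ edgeStates ↔ su ≤ 1 ∧ sv ≤ 1 ∧ cu ≤ sv ∧ cv ≤ su := by
  simp only [edgeStates, List.mem_filter, List.pair_mem_product, List.mem_range, decide_eq_true_eq]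
  omega

/-- The cell of a state of an edge. -/
def edgeCell (M : ℕ) (q : ℕ × ℕ × ℕ × ℕ) : ℕ :=
  1 + (q.1 * M + q.2.1) + (q.2.2.1 * (M * (2 * M)) + q.2.2.2 * (2 * M))

def edgeTerm (q : ℕ × ℕ × ℕ × ℕ) : Term :=
  κ 1 + ((𝐑 ʀM).scale q.1 + κ q.2.1) +
    ((𝐑 ʀst).scale q.2.2.1 + (𝐑 ʀM + 𝐑 ʀM).scale q.2.2.2)

/-- Write `1` into the cells of the states in the list. -/
def fillEdge : List (ℕ × ℕ × ℕ × ℕ) → Prog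
  | [] => .skip
  | q :: l => .setArr ᴀval (edgeTerm q) (κ 1) ;; fillEdge l

theorem fillEdge_run {M : ℕ} (l : List (ℕ × ℕ × ℕ × ℕ)) {s : Store} (hM : s.reg ʀM = M)
    (hst : s.reg ʀst = M * (2 * M)) :
    ((fillEdge l).run s).reg = s.reg ∧ ∀ z, ((fillEdge l).run s).arr ᴀval z =
      if z ∈ l.map (edgeCell M) then 1 else s.arr ᴀval z := by
  induction l generalizing s with
  | nil => simp [fillEdge, Prog.run]
  | cons q l ih =>
    obtain ⟨h1, h2⟩ := @ih (Prog.run (.setArr ᴀval (edgeTerm q) (κ 1)) s)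
      (by simp [Prog.run, hM]) (by simp [Prog.run, hst])
    have he : (edgeTerm q).eval s = edgeCell M q := by
      simp [edgeTerm, edgeCell, hM, hst, two_mul]
    refine ⟨by rw [fillEdge, Prog.run, h1]; simp [Prog.run], fun z => ?_⟩
    rw [fillEdge, Prog.run, h2]
    simp only [Prog.run, Store.setArr_arr_apply, if_true, Term.eval_const, he, List.map_cons,
      List.mem_cons]
    by_cases g : z = edgeCell M q <;> by_cases g' : z ∈ l.map (edgeCell M) <;> simp [g, g']

theorem digits_inj {M s c s' c' : ℕ} (hc : c < M) (hc' : c' < M) (h : s * M + c = s' * M + c') :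
    s = s' ∧ c = c' := by
  have e : c = c' := by
    have := congrArg (· % M) h
    simpa [mul_comm _ M, Nat.mul_add_mod, Nat.mod_eq_of_lt hc, Nat.mod_eq_of_lt hc'] using this
  subst e
  exact ⟨Nat.eq_of_mul_eq_mul_right (by omega) (Nat.add_right_cancel h), rfl⟩

theorem edgeCell_eq (M : ℕ) (q : ℕ × ℕ × ℕ × ℕ) :
    edgeCell M q = 1 + ((q.2.2.1 * M + q.2.2.2) * (2 * M) + (q.1 * M + q.2.1)) := by
  rw [edgeCell]; ring

theorem edgeCell_inj {M : ℕ} {q q' : ℕ × ℕ × ℕ × ℕ} (h1 : q.1 ≤ 1) (h2 : q.2.1 < M)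
    (h3 : q.2.2.2 < M) (h1' : q'.1 ≤ 1) (h2' : q'.2.1 < M) (h3' : q'.2.2.2 < M)
    (h : edgeCell M q = edgeCell M q') : q = q' := by
  rw [edgeCell_eq, edgeCell_eq] at h
  obtain ⟨e1, e2⟩ := digits_inj (by nlinarith) (by nlinarith) (Nat.add_left_cancel h)
  obtain ⟨e3, e4⟩ := digits_inj h3 h3' e1
  obtain ⟨e5, e6⟩ := digits_inj h2 h2' e2
  ext <;> assumption

theorem edgeCell_lt {M : ℕ} (hM : 2 ≤ M) {q : ℕ × ℕ × ℕ × ℕ} (hq : q ∈ edgeStates) :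
    edgeCell M q < 1 + 2 * (M * (2 * M)) := by
  obtain ⟨su, cu, sv, cv⟩ := q
  obtain ⟨h1, h2, h3, h4⟩ := mem_edgeStates.1 hq
  have h5 : (sv * M + cv + 1) * (2 * M) ≤ (2 * M) * (2 * M) := Nat.mul_le_mul_right _ (by nlinarith)
  have h6 : su * M + cu < 2 * M := by nlinarith
  rw [edgeCell_eq]
  dsimp only
  nlinarith

theorem cellAt_pair {M b u v : ℕ} {σ c : ℕ → ℕ} (h : u ≠ v) :
    cellAt M b [u, v] σ c = b + (σ u * M + c u) + (σ v * M + c v) * (2 * M) := by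
  have h1 := cellAt_append (M := M) (b := b) (L := [u]) (v := v) (σ := σ) (c := c)
    (by simpa using h.symm)
  have h2 := cellAt_append (M := M) (b := b) (L := []) (v := u) (σ := σ) (c := c) (by simp)
  rw [List.singleton_append] at h1
  rw [List.nil_append, cellAt_nil] at h2
  rw [h1, h2]
  simp

theorem nbSum_singleton {eu ev g : ℕ → ℕ} {i w : ℕ} : nbSum eu ev {i} g w =
    (if eu i = w then g (ev i) else 0) + (if ev i = w then g (eu i) else 0) :=
  Finset.sum_singleton _ _

/-- Both ends are listed, so nothing is forgotten and the only recovered set is empty. The contents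
do not depend on the edge, so all edges share the one table at cell `1`. The bound `2 ≤ M` is needed
because counts up to one occur even if all demands vanish. -/
theorem tableFor_edge {eu ev d val : ℕ → ℕ} {M ds i : ℕ} {Rec : ℕ → Finset ℕ → ℕ → Prop}
    (hne : eu i ≠ ev i) (hM : 2 ≤ M) (hds : ds < M)
    (hval : ∀ z, z ≠ 0 → val z = if z ∈ edgeStates.map (edgeCell M) then 1 else 0)
    (hrec : ∀ z < 1 + 2 * (M * (2 * M)), Rec z ∅ 1) {Z : ℕ} (hZ : 1 ≤ Z) :
    TableFor eu ev d M ds {i} [eu i, ev i] 1 val Rec Z := by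
  have hcell : ∀ σ c : ℕ → ℕ, cellAt M 1 [eu i, ev i] σ c =
      edgeCell M (σ (eu i), c (eu i), σ (ev i), c (ev i)) := fun σ c => by
    rw [cellAt_pair hne, edgeCell]; ring
  have hmem : ∀ v, v ∉ [eu i, ev i] → ¬ 0 < incCount eu ev {i} v := by
    intro v hv
    simp only [List.mem_cons, List.not_mem_nil, or_false, not_or] at hv
    rw [incCount, nbSum_singleton, if_neg (Ne.symm hv.1), if_neg (Ne.symm hv.2)]
    omega
  have hnb : ∀ g : ℕ → ℕ, nbSum eu ev {i} g (eu i) = g (ev i) ∧ nbSum eu ev {i} g (ev i) = g (eu i) :=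
    fun g => by rw [nbSum_singleton, nbSum_singleton]; simp [hne, hne.symm]
  constructor
  · intro σ c hσ hc hv
    rw [hcell] at hv ⊢
    have hu := hc (eu i) (by simp)
    have hw := hc (ev i) (by simp)
    rw [hval _ (by rw [edgeCell]; omega)] at hv ⊢
    have hm : edgeCell M (σ (eu i), c (eu i), σ (ev i), c (ev i)) ∈ edgeStates.map (edgeCell M) := by
      by_contra h
      rw [if_neg h] at hv
      exact hv rfl
    obtain ⟨⟨su, cu, sv, cv⟩, hq, he⟩ := List.mem_map.1 hm
    obtain ⟨g1, g2, g3, g4⟩ := mem_edgeStates.1 hq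
    have heq := edgeCell_inj g1 (by dsimp only; omega) (by dsimp only; omega) (hσ _ (by simp))
      (hu.1.trans_lt hds) (hw.1.trans_lt hds) he
    simp only [Prod.mk.injEq] at heq
    obtain ⟨rfl, rfl, rfl, rfl⟩ := heq
    refine ⟨∅, 1, hrec _ (edgeCell_lt hM hq), hZ, by rw [if_pos hm]; rfl, by simp, ?_, ?_⟩
    · intro v hv
      simp only [List.mem_cons, List.not_mem_nil, or_false] at hv
      rcases hv with rfl | rfl
      · rw [(hnb _).1, if_pos (by simp)]; exact g3
      · rw [(hnb _).2, if_pos (by simp)]; exact g4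
    · exact fun v hv hp => absurd hp (hmem v hv)
  · intro g c hg hc hf
    have h1 := hf.1 (eu i) (by simp)
    have h2 := hf.1 (ev i) (by simp)
    rw [(hnb g).1] at h1
    rw [(hnb g).2] at h2
    have hq := mem_edgeStates.2 ⟨hg (eu i), hg (ev i), h1, h2⟩
    rw [hcell, hval _ (by rw [edgeCell]; omega), if_pos (List.mem_map_of_mem hq)]
    exact ⟨one_ne_zero, Nat.le_add_left _ _⟩

theorem tableFor_empty {eu ev d val : ℕ → ℕ} {M ds b : ℕ} {Rec : ℕ → Finset ℕ → ℕ → Prop}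
    (hval : val b = 1) (hrec : Rec b ∅ 1) {Z : ℕ} (hZ : 1 ≤ Z) :
    TableFor eu ev d M ds ∅ [] b val Rec Z := by
  refine ⟨fun σ c _ _ _ => ?_, fun g c _ _ _ => ?_⟩ <;> rw [cellAt_nil]
  · exact ⟨∅, 1, hrec, hZ, by rw [hval]; rfl, by simp, by simp, by simp [incCount, nbSum]⟩
  · rw [hval]
    exact ⟨one_ne_zero, Nat.le_add_left _ _⟩

/-- Cell `0` is the table of the empty part. The queue starts at position `1` because `0` stands for
no entry, and the merged lists start at `1` so that the initial zeros in `pos` count as stale. -/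
def initTable : Prog :=
  fillEdge edgeStates ;; .setArr ᴀval (κ 0) (κ 1) ;;
  ʀcp ≔ κ 1 + (𝐑 ʀst + 𝐑 ʀst) ;; ʀqp ≔ κ 1 ;; ʀxp ≔ κ 1

def leafStep : Prog :=
  .setArr ᴀLS (ᴀlf⁅𝐑 ʀe⁆) (𝐑 ʀip) ;; .setArr ᴀLE (ᴀlf⁅𝐑 ʀe⁆) (𝐑 ʀip + κ 2) ;;
  .setArr ᴀTB (ᴀlf⁅𝐑 ʀe⁆) (κ 1) ;;
  .setArr ᴀitV (𝐑 ʀip) (ᴀeu⁅𝐑 ʀe⁆) ;; .setArr ᴀitV (𝐑 ʀip + κ 1) (ᴀev⁅𝐑 ʀe⁆) ;;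
  .setArr ᴀitN (𝐑 ʀip) (κ 1) ;; .setArr ᴀitN (𝐑 ʀip + κ 1) (κ 1) ;;
  .setArr ᴀitC (𝐑 ʀip) (κ 1) ;; .setArr ᴀitC (𝐑 ʀip + κ 1) (𝐑 ʀM + 𝐑 ʀM) ;;
  .setArr ᴀitS (𝐑 ʀip) (𝐑 ʀM) ;; .setArr ᴀitS (𝐑 ʀip + κ 1) (𝐑 ʀst) ;;
  ʀip ≔ 𝐑 ʀip + κ 2 ;; ʀe ≔ 𝐑 ʀe + κ 1

def leafLoop : Prog := ʀe ≔ κ 0 ;; .loop (.lt (𝐑 ʀe) (𝐑 ʀm)) leafStep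

/-- The first `j` leaves have got their objects. -/
structure Leaves (M : ℕ) (s₀ s : Store) (j : ℕ) : Prop where
  ip : s.reg ʀip = 2 * j
  leaf : ∀ i < j, s.arr ᴀLS (s₀.arr ᴀlf i) = 2 * i ∧ s.arr ᴀLE (s₀.arr ᴀlf i) = 2 * i + 2 ∧
    s.arr ᴀTB (s₀.arr ᴀlf i) = 1
  other : ∀ y, (∀ i < j, s₀.arr ᴀlf i ≠ y) → s.arr ᴀLS y = 0 ∧ s.arr ᴀLE y = 0 ∧ s.arr ᴀTB y = 0
  item : ∀ i < j, s.item (2 * i) = (s₀.arr ᴀeu i, 1, 1, M) ∧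
    s.item (2 * i + 1) = (s₀.arr ᴀev i, 1, 2 * M, M * (2 * M))

theorem leafLoop_spec {s : Store} {M : ℕ} (hM : s.reg ʀM = M) (hst : s.reg ʀst = M * (2 * M))
    (hip : s.reg ʀip = 0) (hinj : ∀ i < s.reg ʀm, ∀ j < s.reg ʀm, s.arr ᴀlf i = s.arr ᴀlf j → i = j)
    (h0 : ∀ y, s.arr ᴀLS y = 0 ∧ s.arr ᴀLE y = 0 ∧ s.arr ᴀTB y = 0) :
    Runs leafLoop s (s.reg ʀm * 100 + 10) (fun s' => Leaves M s s' (s.reg ʀm)) := by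
  refine (Runs.flat_seq rfl (Runs.loop_const (s.reg ʀm) (fun j s' => s'.reg ʀe = j ∧
    Leaves M s s' j) leafStep.bound ?_ ?_ ?_)).mono ?_ ?_
  · exact ⟨by simp [Prog.run], by simp [Prog.run, hip], by simp, fun y _ => by simp [Prog.run, h0],
      by simp⟩
  · rintro j hj s' f ⟨h1, h2⟩
    have e0 : s'.reg ʀm = s.reg ʀm := f.reg _ (by decide)
    have e1 : s'.arr ᴀlf = s.arr ᴀlf := f.arr _ (by decide)
    have e2 : s'.arr ᴀeu = s.arr ᴀeu := f.arr _ (by decide)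
    have e3 : s'.arr ᴀev = s.arr ᴀev := f.arr _ (by decide)
    have e4 : s'.reg ʀM = M := (f.reg _ (by decide)).trans (by simpa [Prog.run] using hM)
    have e5 : s'.reg ʀst = M * (2 * M) := (f.reg _ (by decide)).trans (by simpa [Prog.run] using hst)
    have e6 := h2.ip
    refine ⟨by simpa [h1, e0] using hj, Runs.flat rfl le_rfl ⟨by simp [leafStep, Prog.run, h1], ?_,
      ?_, ?_, ?_⟩⟩
    · simp [leafStep, Prog.run, e6]; ring
    · intro i hi
      rcases Nat.lt_succ_iff_lt_or_eq.1 hi with hi | rfl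
      · have hne : s.arr ᴀlf i ≠ s.arr ᴀlf j := fun h => by
          have := hinj i (by omega) j hj h; omega
        simpa [leafStep, Prog.run, h1, e1, hne] using h2.leaf i hi
      · simp [leafStep, Prog.run, h1, e1, e6]
    · intro y hy
      have hne : y ≠ s.arr ᴀlf j := (hy j (by omega)).symm
      simpa [leafStep, Prog.run, h1, e1, hne] using h2.other y fun i hi => hy i (by omega)
    · intro i hi
      rcases Nat.lt_succ_iff_lt_or_eq.1 hi with hi | rfl
      · have n1 : 2 * i ≠ 2 * j := by omega
        have n2 : 2 * i ≠ 2 * j + 1 := by omega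
        have n3 : 2 * i + 1 ≠ 2 * j := by omega
        have n4 : 2 * i + 1 ≠ 2 * j + 1 := by omega
        have := h2.item i hi
        simp only [Store.item] at this
        simp only [leafStep, Prog.run, Store.item, Store.setReg_reg, Store.setReg_arr,
          Store.setArr_reg, Store.setArr_arr_apply, Term.eval_add, Term.eval_const, Term.eval_reg,
          e6, n1, n2, n3, n4]
        simpa using this
      · simp [leafStep, Prog.run, Store.item, h1, e2, e3, e4, e5, e6, two_mul]
  · rintro s' f ⟨h1, -⟩
    have e0 : s'.reg ʀm = s.reg ʀm := f.reg _ (by decide)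
    simp [h1, e0]
  · simp [Test.cost, Term.cost, leafStep, Prog.bound]
    omega
  · rintro s' - ⟨⟨-, h2⟩, -⟩
    exact ⟨h2.ip, h2.leaf, h2.other, h2.item⟩

end RAM

namespace RAM

theorem Runs.le {p : Prog} {s : Store} {B B' : ℕ} {Q : Store → Prop} (h : Runs p s B Q)
    (hB : B ≤ B') : Runs p s B' Q :=
  h.mono hB fun _ _ h => h

theorem Runs.loop_stop {c : Test} {p : Prog} {s : Store} {B : ℕ} {Q : Store → Prop}
    (hc : ¬ c.holds s) (hB : c.cost ≤ B) (hQ : Q s) : Runs (.loop c p) s B Q :=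
  ⟨_, _, .loop_false hc, hB, hQ⟩

theorem Runs.loop_next {c : Test} {p : Prog} {s : Store} {B B' : ℕ} {R Q : Store → Prop}
    (hc : c.holds s) (h : Runs p s B R)
    (h' : ∀ s₁, Frame p s s₁ → R s₁ → Runs (.loop c p) s₁ B' Q) :
    Runs (.loop c p) s (c.cost + B + B') Q := by
  obtain ⟨t, s', he, ht, hq⟩ := h
  obtain ⟨t', s'', he', ht', hq'⟩ := h' s' he.frame hq
  exact ⟨_, _, .loop_true hc he he', by omega, hq'⟩

/-! ### Recovering a solution -/

notation "ʀsp" => 16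
notation "ʀq" => 17
notation "ᴀstk" => 34

def walkStep : Prog :=
  .ite (.eq (ᴀqM⁅𝐑 ʀq⁆) (κ 0)) .skip (.setArr ᴀout (ᴀqM⁅𝐑 ʀq⁆ - κ 1) (κ 1)) ;; ʀq ≔ ᴀqP⁅𝐑 ʀq⁆

def walkLoop : Prog := .loop (.lt (κ 0) (𝐑 ʀq)) walkStep

theorem walkStep_run (s : Store) : (walkStep.run s).reg ʀq = (s.ent (s.reg ʀq)).par ∧
    ∀ v, (walkStep.run s).arr ᴀout v = if (s.ent (s.reg ʀq)).mark ≠ 0 ∧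
      v = (s.ent (s.reg ʀq)).mark - 1 then 1 else s.arr ᴀout v := by
  by_cases h : s.arr ᴀqM (s.reg ʀq) = 0 <;> simp [walkStep, Prog.run, Store.ent, h]

theorem walkLoop_spec {ent : ℕ → Entry} {qb q z : ℕ} {F : Finset ℕ} (h : Walk ent qb q F z)
    {s : Store} (he : s.ent = ent) (hq : s.reg ʀq = q) :
    Runs walkLoop s (30 * z + 10) (fun s' => ∀ v, s'.arr ᴀout v =
      if v ∈ F then 1 else s.arr ᴀout v) := by
  induction h generalizing s with
  | @root q h0 hqb hp hm =>
    refine (Runs.loop_next (B := 20) (B' := 10) (by simpa [hq] using h0)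
      (Runs.flat (Q := fun s' => s' = walkStep.run s) rfl (by decide) rfl) ?_).mono
      (by simp [Test.cost, Term.cost]) (fun _ _ h => h)
    rintro s₁ - rfl
    obtain ⟨h1, h2⟩ := walkStep_run s
    rw [he, hq] at h1 h2
    refine Runs.loop_stop (by simp [h1, hp]) (by simp [Test.cost, Term.cost]) fun v => ?_
    rw [h2]
    simp [hm]
  | @step q z F hqb hw hl ih =>
    refine (Runs.loop_next (B := 20) (B' := 30 * z + 10) (by simp [hq]; omega)
      (Runs.flat (Q := fun s' => s' = walkStep.run s) rfl (by decide) rfl) ?_).mono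
      (by simp [Test.cost, Term.cost]; omega) (fun _ _ h => h)
    rintro s₁ f rfl
    obtain ⟨h1, h2⟩ := walkStep_run s
    rw [he, hq] at h1 h2
    have he' : (walkStep.run s).ent = ent := by
      rw [← he]
      funext r
      simp (disch := decide) only [Store.ent, f.arr]
    refine (ih he' h1).mono le_rfl fun s' _ h3 v => ?_
    rw [h3, h2]
    by_cases g1 : v ∈ F
    · simp only [g1, if_true]
      split_ifs <;> simp_all
    · by_cases g2 : (ent q).mark = 0 <;> by_cases g3 : v = (ent q).mark - 1 <;> simp [g1, g2, g3]

def pop : Prog := ʀsp ≔ 𝐑 ʀsp - κ 1 ;; ʀq ≔ ᴀbp⁅ᴀstk⁅𝐑 ʀsp⁆⁆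

def push : Prog :=
  .setArr ᴀstk (𝐑 ʀsp) (ᴀqA⁅𝐑 ʀq⁆) ;; .setArr ᴀstk (𝐑 ʀsp + κ 1) (ᴀqB⁅𝐑 ʀq⁆) ;;
  ʀsp ≔ 𝐑 ʀsp + κ 2

/-- The two subproblems must be pushed before the walk, which overwrites the register `q`. -/
def popStep : Prog := pop ;; .ite (.eq (𝐑 ʀq) (κ 0)) .skip (push ;; walkLoop)

def popLoop : Prog := .loop (.lt (κ 0) (𝐑 ʀsp)) popStep

theorem pop_run {s : Store} {r : ℕ} (h : s.reg ʀsp = r + 1) : (pop.run s).reg ʀsp = r ∧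
    (pop.run s).reg ʀq = s.arr ᴀbp (s.arr ᴀstk r) ∧ (pop.run s).arr = s.arr := by
  simp [pop, Prog.run, h]

theorem push_run (s : Store) : (push.run s).reg ʀsp = s.reg ʀsp + 2 ∧
    (push.run s).reg ʀq = s.reg ʀq ∧ (push.run s).arr ᴀout = s.arr ᴀout ∧
    (push.run s).ent = s.ent ∧ ∀ i, (push.run s).arr ᴀstk i =
      if i = s.reg ʀsp + 1 then (s.ent (s.reg ʀq)).b
      else if i = s.reg ʀsp then (s.ent (s.reg ʀq)).a else s.arr ᴀstk i := by
  refine ⟨by simp [push, Prog.run], by simp [push, Prog.run],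
    by simp [push, Prog.run, Store.setArr_arr], ?_, fun i => by simp [push, Prog.run, Store.ent]⟩
  funext q
  simp [push, Prog.run, Store.ent]

theorem Frame.ent_popStep {s s' : Store} (f : Frame popStep s s') : s'.ent = s.ent := by
  funext q
  simp (disch := decide) only [Store.ent, f.arr]

/-- A single loop carries out the whole recursion, so the statement is in continuation form: `hQ`
takes over when the top cell has been worked off and the stack below is unchanged. The induction
over `Rec` can then chain the two subproblems. -/
theorem popLoop_spec {ent : ℕ → Entry} {bp : ℕ → ℕ} {qb cb q z : ℕ} {S : Finset ℕ}
    (h : Rec ent bp qb cb q S z) {s : Store} {r B : ℕ} {Q : Store → Prop} (he : s.ent = ent)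
    (hb : s.arr ᴀbp = bp) (hsp : s.reg ʀsp = r + 1) (hq : s.arr ᴀstk r = q)
    (hQ : ∀ s', s'.ent = ent → s'.arr ᴀbp = bp → s'.reg ʀsp = r →
      (∀ i < r, s'.arr ᴀstk i = s.arr ᴀstk i) →
      (∀ v, s'.arr ᴀout v = if v ∈ S then 1 else s.arr ᴀout v) → Runs popLoop s' B Q) :
    Runs popLoop s (70 * z + B) Q := by
  induction h generalizing s r B Q with
  | @base q hlt h0 =>
    obtain ⟨h1, h2, h3⟩ := pop_run hsp
    rw [hb, hq] at h2
    refine (Runs.loop_next (c := .lt (κ 0) (𝐑 ʀsp)) (p := popStep) (B := 40) (B' := B)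
      (R := fun s' => s' = pop.run s) (by simp [hsp]) ((Runs.flat_seq (p := pop) rfl (Runs.ite (B := 1) (fun _ => Runs.flat (p := .skip)
        (Q := fun s' => s' = pop.run s) rfl le_rfl rfl) fun hn => absurd (by simpa [h2] using h0) hn)).mono (by decide) (fun _ _ h => h)) ?_).mono
      (by simp [Test.cost, Term.cost]) (fun _ _ h => h)
    rintro _ f rfl
    exact hQ _ (f.ent_popStep.trans he) (by rw [h3, hb]) h1 (fun i _ => by rw [h3])
      fun v => by simp [h3]
  | @step q zF zA zB F SA SB hlt hw rA rB ihA ihB =>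
    obtain ⟨h1, h2, h3⟩ := pop_run hsp
    obtain ⟨g1, g2, g3, g4, g5⟩ := push_run (pop.run s)
    rw [hb, hq] at h2
    have h4 : (pop.run s).ent = ent := by
      rw [← he]; funext r; simp only [Store.ent, h3]
    rw [h4] at g4
    rw [h1] at g1
    rw [h2] at g2
    rw [h3] at g3
    rw [h1, h2, h3, h4] at g5
    refine (Runs.loop_next (B := 30 * zF + 60) (B' := 70 * zB + (70 * zA + B))
      (R := fun s' => Frame walkLoop (push.run (pop.run s)) s' ∧
        ∀ v, s'.arr ᴀout v = if v ∈ F then 1 else s.arr ᴀout v) (by simp [hsp])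
      ((Runs.flat_seq rfl (Runs.ite (B := 30 * zF + 30)
        (fun hn => absurd (by simpa [h2] using hn) hw.pos.1.ne') fun _ =>
        (Runs.flat_seq rfl ((walkLoop_spec hw g4 g2).mono le_rfl fun s' f h =>
          ⟨f, by simpa only [g3] using h⟩)).mono ?_ (fun _ _ h => h))).mono ?_
            (fun _ _ h => h)) ?_).mono ?_ (fun _ _ h => h)
    · simp [push, Prog.bound, Term.cost]; omega
    · simp [pop, Prog.bound, Test.cost, Term.cost]; omega
    · rintro s₃ f ⟨fw, h5⟩
      have k3 : ∀ i, s₃.arr ᴀstk i = (push.run (pop.run s)).arr ᴀstk i := fun i => by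
        rw [fw.arr _ (by decide)]
      refine ihB (f.ent_popStep.trans he) (by rw [f.arr _ (by decide), hb])
        (r := r + 1) (by rw [fw.reg _ (by decide), g1]) (by rw [k3, g5, if_pos rfl]) ?_
      intro s₄ a1 a2 a3 a4 a5
      refine ihA a1 a2 a3 (by rw [a4 r (by omega), k3, g5, if_neg (by omega), if_pos rfl]) ?_
      intro s₅ b1 b2 b3 b4 b5
      refine hQ s₅ b1 b2 b3 (fun i hi => ?_) fun v => ?_
      · rw [b4 i hi, a4 i (by omega), k3, g5, if_neg (by omega), if_neg (by omega)]
      · rw [b5, a5, h5]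
        by_cases c1 : v ∈ F <;> by_cases c2 : v ∈ SA <;> by_cases c3 : v ∈ SB <;> simp [c1, c2, c3]
    · simp [Test.cost, Term.cost]; omega

def recover : Prog := .setArr ᴀstk (κ 0) (ᴀTB⁅𝐑 ʀp⁆) ;; ʀsp ≔ κ 1 ;; popLoop

theorem recover_spec {s : Store} {z : ℕ} {S : Finset ℕ} (h : s.Rec (s.arr ᴀTB (s.reg ʀp)) S z) :
    Runs recover s (70 * z + 20) (fun s' => ∀ v, s'.arr ᴀout v =
      if v ∈ S then 1 else s.arr ᴀout v) := by
  refine (Runs.flat_seq rfl (Runs.flat_seq rfl (popLoop_spec (B := 5) (r := 0) (q := s.arr ᴀTB (s.reg ʀp)) h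
    ?_ ?_ ?_ ?_ ?_))).mono ?_ (fun _ _ h => h)
  · funext q
    simp [Prog.run, Store.ent]
  · simp [Prog.run, Store.setArr_arr]
  · simp [Prog.run]
  · simp [Prog.run]
  · intro s' _ _ h1 _ h2
    refine Runs.loop_stop (by simp [h1]) (by simp [Test.cost, Term.cost]) fun v => ?_
    rw [h2]
    simp [Prog.run]
  · simp [Prog.bound, Term.cost]; omega

def copyOut : Prog :=
  ʀe ≔ κ 0 ;; .loop (.lt (𝐑 ʀe) (𝐑 ʀn)) (.setArr ᴀd (𝐑 ʀe) (ᴀout⁅𝐑 ʀe⁆) ;; ʀe ≔ 𝐑 ʀe + κ 1)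

theorem copyOut_spec (s : Store) : Runs copyOut s (s.reg ʀn * 20 + 10)
    (fun s' => ∀ v < s.reg ʀn, s'.arr ᴀd v = s.arr ᴀout v) := by
  refine (Runs.flat_seq rfl (Runs.loop_const (s.reg ʀn) (fun j s' => s'.reg ʀe = j ∧
    ∀ v < j, s'.arr ᴀd v = s.arr ᴀout v) 10 ?_ ?_ ?_)).mono ?_ ?_
  · simp [Prog.run]
  · rintro j hj s' f ⟨h1, h2⟩
    have e0 : s'.reg ʀn = s.reg ʀn := f.reg _ (by decide)
    have e1 : s'.arr ᴀout = s.arr ᴀout := f.arr _ (by decide)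
    refine ⟨by simpa [h1, e0] using hj, Runs.flat rfl (by simp [Prog.bound, Term.cost])
      ⟨by simp [Prog.run, h1], fun v hv => ?_⟩⟩
    by_cases g : v = j
    · simp [Prog.run, h1, e1, g]
    · simpa [Prog.run, h1, e1, g] using h2 v (by omega)
  · rintro s' f ⟨h1, -⟩
    have e0 : s'.reg ʀn = s.reg ʀn := f.reg _ (by decide)
    simp [h1, e0]
  · simp [Test.cost, Term.cost, Prog.bound]
    omega
  · rintro s' - ⟨⟨-, h2⟩, -⟩
    exact h2

end RAM

/-! ### Domination expressed by edge lists, and correctness of the final table. -/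

section Domination

variable {n m : ℕ} {G : SimpleGraph (Fin n)}

theorem EdgeList.nbSum_range [DecidableRel G.Adj] (E : EdgeList G m) (g : ℕ → ℕ) (v : Fin n) :
    nbSum (RAM.arrayOf fun i => (E.fst i : ℕ)) (RAM.arrayOf fun i => (E.snd i : ℕ))
      (Finset.range m) g v = ∑ w ∈ Finset.univ.filter (G.Adj v), g w := by
  rw [nbSum, Finset.sum_range, ← E.sum_neighbors (fun w => g w)]
  refine Finset.sum_congr rfl fun i _ => ?_
  simp only [RAM.arrayOf_apply, Fin.val_inj]

theorem EdgeList.nbSum_range_of_le (E : EdgeList G m) (g : ℕ → ℕ) {v : ℕ} (hv : n ≤ v) :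
    nbSum (RAM.arrayOf fun i => (E.fst i : ℕ)) (RAM.arrayOf fun i => (E.snd i : ℕ))
      (Finset.range m) g v = 0 := by
  rw [nbSum, Finset.sum_range]
  refine Finset.sum_eq_zero fun i _ => ?_
  have h1 := (E.fst i).2
  have h2 := (E.snd i).2
  rw [RAM.arrayOf_apply, RAM.arrayOf_apply, if_neg (by omega), if_neg (by omega), add_zero]

theorem ncard_closedNbhd_inter (E : EdgeList G m) (S : Finset (Fin n)) (v : Fin n) :
    (closedNbhd G v ∩ (S : Set (Fin n))).ncard = ind (S.map Fin.valEmbedding) v +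
      nbSum (RAM.arrayOf fun i => (E.fst i : ℕ)) (RAM.arrayOf fun i => (E.snd i : ℕ))
      (Finset.range m) (ind (S.map Fin.valEmbedding)) v := by
  classical
  have hind : ∀ w : Fin n, ind (S.map Fin.valEmbedding) w = if w ∈ S then 1 else 0 := fun w => by
    have h : (w : ℕ) ∈ S.map Fin.valEmbedding ↔ w ∈ S :=
      Finset.mem_map' (f := Fin.valEmbedding) (a := w)
    simp only [ind, h]
  have h1 : closedNbhd G v ∩ (S : Set (Fin n)) =
      ((insert v (Finset.univ.filter (G.Adj v))).filter (· ∈ S) : Finset (Fin n)) := by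
    ext w
    simp [closedNbhd]
  rw [h1, Set.ncard_coe_finset, Finset.card_filter, Finset.sum_insert (by simp), E.nbSum_range, hind]
  congr 1
  exact Finset.sum_congr rfl fun w _ => (hind w).symm

end Domination

namespace RAM

variable {n m k : ℕ} {G : SimpleGraph (Fin n)} {d : Fin n → ℕ} {E : EdgeList G m}

theorem isMultipleDominating_iff {S : Finset (Fin n)} : IsMultipleDominating G d S ↔
    ∀ v : Fin n, d v ≤ ind (S.map Fin.valEmbedding) v + nbSum (instOf d E).eu (instOf d E).ev
      (Finset.range m) (ind (S.map Fin.valEmbedding)) v :=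
  forall_congr' fun v => by rw [ncard_closedNbhd_inter E]; rfl

theorem ind_le_one (S : Finset ℕ) (v : ℕ) : ind S v ≤ 1 := by
  rw [ind]; split_ifs <;> omega

theorem deg_eq_zero_of_le {v : ℕ} (hv : n ≤ v) : (instOf d E).deg v = 0 :=
  E.nbSum_range_of_le (fun _ => 1) hv

theorem mem_map_val {S : Finset (Fin n)} {v : Fin n} :
    (v : ℕ) ∈ S.map Fin.valEmbedding ↔ v ∈ S :=
  Finset.mem_map' (f := Fin.valEmbedding) (a := v)

theorem feasible_of_isMultipleDominating {S : Finset (Fin n)} (h : IsMultipleDominating G d S) :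
    Feasible (instOf d E).eu (instOf d E).ev (instOf d E).d (Finset.range m) []
      (ind (S.map Fin.valEmbedding)) 0 := by
  refine ⟨by simp, fun v _ hv => ?_⟩
  have hvn : v < n := by
    by_contra hn
    have : (instOf d E).deg v = 0 := deg_eq_zero_of_le (not_lt.1 hn)
    change 0 < (instOf d E).deg v at hv
    omega
  have := isMultipleDominating_iff (E := E).1 h ⟨v, hvn⟩
  have hd : (instOf d E).d v = d ⟨v, hvn⟩ := arrayOf_apply d ⟨v, hvn⟩
  rwa [hd]

theorem not_isMultipleDominating_of_table {b Z : ℕ} {val : ℕ → ℕ} {Rec : ℕ → Finset ℕ → ℕ → Prop}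
    (ht : TableFor (instOf d E).eu (instOf d E).ev (instOf d E).d (instOf d E).M (instOf d E).ds
      (Finset.range m) [] b val Rec Z) (h0 : val b = 0) (S : Finset (Fin n)) :
    ¬ IsMultipleDominating G d S := fun h => by
  have := (ht.complete _ 0 (ind_le_one _) (by simp) (feasible_of_isMultipleDominating (E := E) h)).1
  rw [cellAt_nil] at this
  exact this h0

/-- The graph splits into its isolated vertices and the rest. On the rest the table is optimal; an
isolated vertex with demand one can be dominated only by itself, so it adds one to every solution.
-/
theorem isMinimum_of_table {b Z : ℕ} {val : ℕ → ℕ} {Rec : ℕ → Finset ℕ → ℕ → Prop}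
    (ht : TableFor (instOf d E).eu (instOf d E).ev (instOf d E).d (instOf d E).M (instOf d E).ds
      (Finset.range m) [] b val Rec Z) (h0 : val b ≠ 0)
    (hd : ∀ v : Fin n, d v ≤ (instOf d E).deg v + 1) : ∃ S z, Rec b S z ∧ z ≤ Z ∧
      ∀ O : Finset (Fin n), (∀ v : Fin n, v ∈ O ↔ (v : ℕ) ∈ S ∨ ((instOf d E).deg v = 0 ∧ d v = 1)) →
        IsMinimumMultipleDominating G d O := by
  set I := instOf d E with hI
  obtain ⟨S, z, h1, h2, h3, h4, -, h5⟩ := ht.sound 0 0 (by simp) (by simp)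
    (by rw [cellAt_nil]; exact h0)
  rw [cellAt_nil] at h1 h3
  simp only [List.not_mem_nil, if_false, not_false_eq_true, forall_true_left] at h5
  have hS : ∀ v ∈ S, 0 < I.deg v := fun v hv => (mem_forgotten.1 (h4 hv)).1
  have hdeg : ∀ v : ℕ, 0 < I.deg v → v < n := fun v hv => by
    by_contra hn
    have : I.deg v = 0 := deg_eq_zero_of_le (not_lt.1 hn)
    omega
  refine ⟨S, z, h1, h2, fun O hO => ⟨(isMultipleDominating_iff (E := E)).2 fun v => ?_, fun O' h' => ?_⟩⟩
  · have hOS : ∀ w, 0 < I.deg w → ind (O.map Fin.valEmbedding) w = ind S w := fun w hw => by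
      have : w ∈ O.map Fin.valEmbedding ↔ w ∈ S := by
        have h6 := hO ⟨w, hdeg w hw⟩
        rw [← mem_map_val] at h6
        dsimp only at h6
        rw [h6]
        refine or_iff_left fun h => ?_
        have := h.1
        omega
      simp only [ind, this]
    rcases Nat.eq_zero_or_pos (I.deg v) with h6 | h6
    · rcases Nat.eq_zero_or_pos (d v) with h7 | h7
      · omega
      · have h8 := hd v
        rw [h6] at h8
        have h9 : v ∈ O := (hO v).2 (Or.inr ⟨h6, by omega⟩)
        have h10 : ind (O.map Fin.valEmbedding) v = 1 := if_pos (mem_map_val.2 h9)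
        rw [h10]; omega
    · have h7 := h5 v h6
      have h8 : I.d v = d v := arrayOf_apply d v
      have h9 := nbSum_congr (eu := I.eu) (ev := I.ev) (P := Finset.range m) (v := v) hOS
      rw [h8] at h7
      rw [hOS v h6]
      exact h7.trans (Nat.add_le_add_left h9.symm.le _)
  · set D := Finset.univ.filter fun v : Fin n => I.deg v = 0 ∧ d v = 1
    have h6 := (ht.complete _ 0 (ind_le_one _) (by simp)
      (feasible_of_isMultipleDominating (E := E) h')).2
    rw [cellAt_nil, h3] at h6
    have h7 : O.card ≤ S.card + D.card := by
      rw [← Finset.card_map Fin.valEmbedding, ← Finset.card_map (s := D) Fin.valEmbedding]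
      refine le_trans (Finset.card_le_card fun w hw => ?_) (Finset.card_union_le _ _)
      obtain ⟨v, hv, rfl⟩ := Finset.mem_map.1 hw
      rw [Finset.mem_union]
      refine ((hO v).1 hv).imp id fun h => ?_
      exact mem_map_val.2 (Finset.mem_filter.2 ⟨Finset.mem_univ _, h⟩)
    -- Any competitor contains all of `D`, and `D` is disjoint from the vertices which the table
    -- counts.
    have h8 : ∑ v ∈ forgotten I.eu I.ev (Finset.range m) [], ind (O'.map Fin.valEmbedding) v +
        D.card ≤ O'.card := by
      have h9 : ∑ v ∈ forgotten I.eu I.ev (Finset.range m) [], ind (O'.map Fin.valEmbedding) v =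
          ((forgotten I.eu I.ev (Finset.range m) []).filter (· ∈ O'.map Fin.valEmbedding)).card := by
        rw [Finset.card_filter]; rfl
      rw [h9, ← Finset.card_map (s := D) Fin.valEmbedding, ← Finset.card_map (s := O') Fin.valEmbedding,
        ← Finset.card_union_of_disjoint]
      · refine Finset.card_le_card (Finset.union_subset (fun v hv => (Finset.mem_filter.1 hv).2) ?_)
        refine Finset.map_subset_map.2 fun v hv => ?_
        obtain ⟨-, g1, g2⟩ := Finset.mem_filter.1 hv
        have g3 : d v ≤ ind (O'.map Fin.valEmbedding) v +
            nbSum I.eu I.ev (Finset.range m) (ind (O'.map Fin.valEmbedding)) v :=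
          (isMultipleDominating_iff (E := E)).1 h' v
        have g4 : nbSum I.eu I.ev (Finset.range m) (ind (O'.map Fin.valEmbedding)) v ≤ I.deg v :=
          nbSum_le_incCount (ind_le_one _)
        by_contra hv
        have g5 : ind (O'.map Fin.valEmbedding) v = 0 := if_neg (mem_map_val.not.2 hv)
        rw [g2, g5] at g3
        omega
      · refine Finset.disjoint_left.2 fun w hw hw' => ?_
        obtain ⟨v, hv, rfl⟩ := Finset.mem_map.1 hw'
        have g1 : 0 < I.deg v := (mem_forgotten.1 (Finset.mem_filter.1 hw).1).1
        have := (Finset.mem_filter.1 hv).2.1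
        omega
    omega

/-! ### Building the objects -/

/-- The store after reading the input. -/
structure Prepared (d : Fin n → ℕ) (E : EdgeList G m) (B : BranchDecomposition G (Fin k))
    [DecidableRel B.tree.Adj] (s : Store) : Prop where
  reg_n : s.reg ʀn = n
  reg_m : s.reg ʀm = m
  reg_k : s.reg ʀk = k
  reg_ds : s.reg ʀds = maxDemand d
  reg_ip : s.reg ʀip = 0
  reg_nd : s.reg ʀnd = 0
  reg_x : s.reg ʀx = 0
  reg_last : s.reg ʀlast = 0
  arr_eu : s.arr ᴀeu = (instOf d E).eu
  arr_ev : s.arr ᴀev = (instOf d E).ev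
  arr_lf : s.arr ᴀlf = arrayOf fun i => (leafAt E B i : ℕ)
  arr_d : s.arr ᴀd = (instOf d E).d
  deg : ∀ v, s.arr ᴀdeg v = (instOf d E).deg v
  tdeg : ∀ y : Fin k, s.arr ᴀtdeg y = (Finset.univ.filter (B.tree.Adj y)).card
  tdeg_out : ∀ y, k ≤ y → s.arr ᴀtdeg y = 0
  tsum : ∀ y : Fin k, s.arr ᴀtsum y = ∑ z ∈ Finset.univ.filter (B.tree.Adj y), (z : ℕ)
  obj : ∀ y, s.arr ᴀLS y = 0 ∧ s.arr ᴀLE y = 0 ∧ s.arr ᴀTB y = 0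
  cell : ∀ z, s.arr ᴀval z = 0 ∧ s.arr ᴀbp z = 0 ∧ s.arr ᴀpos z = 0

variable {B : BranchDecomposition G (Fin k)} [DecidableRel B.tree.Adj]

def setup : Prog := squareLoop ;; initTable ;; leafLoop

/-- The tables of the single edges and of the empty part. -/
structure Tables (M : ℕ) (s : Store) : Prop where
  base : s.reg ʀM = M
  cp : s.reg ʀcp = 1 + 2 * (M * (2 * M))
  qp : s.reg ʀqp = 1
  xp : s.reg ʀxp = 1
  zero : s.arr ᴀval 0 = 1
  pos : ∀ z, z ≠ 0 → s.arr ᴀval z = if z ∈ edgeStates.map (edgeCell M) then 1 else 0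

theorem initTable_run {s : Store} {M : ℕ} (hM : s.reg ʀM = M) (hst : s.reg ʀst = M * (2 * M))
    (h0 : ∀ z, s.arr ᴀval z = 0) : Tables M (initTable.run s) := by
  obtain ⟨h1, h2⟩ := fillEdge_run edgeStates hM hst
  have e : initTable.run s = Prog.run (.setArr ᴀval (κ 0) (κ 1) ;;
    ʀcp ≔ κ 1 + (𝐑 ʀst + 𝐑 ʀst) ;; ʀqp ≔ κ 1 ;; ʀxp ≔ κ 1) ((fillEdge edgeStates).run s) := rfl
  rw [e]
  refine ⟨?_, ?_, ?_, ?_, ?_, fun z hz => ?_⟩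
  · simp [Prog.run, h1, hM]
  · simp [Prog.run, h1, hst]; ring
  · simp [Prog.run]
  · simp [Prog.run]
  · simp [Prog.run]
  · simp [Prog.run, hz, h2, h0]

theorem setup_spec {s : Store} (h : Prepared d E B s) :
    Runs setup s (maxDemand d * 20 + m * 100 + 1000)
      (fun s' => Tables (maxDemand d + 2) s' ∧ Leaves (maxDemand d + 2) s s' m) := by
  refine ((squareLoop_spec s).seq fun s₁ f₁ h₁ => Runs.flat_seq (p := initTable) rfl
    ((leafLoop_spec (M := maxDemand d + 2) ?_ ?_ ?_ ?_ ?_).mono (B' := m * 100 + 10) ?_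
    (Q' := fun s' => Tables (maxDemand d + 2) s' ∧ Leaves (maxDemand d + 2) s s' m)
    fun s' f hl => ?_)).mono (by
      have : initTable.bound ≤ 500 := by decide
      rw [h.reg_ds]
      omega) (fun _ _ h => h)
  all_goals
    have f₂ : Frame initTable s₁ _ := Prog.run_frame _ rfl s₁
    rw [h.reg_ds] at h₁
    have ht := initTable_run h₁.1 h₁.2 fun z => by rw [f₁.arr _ (by decide), (h.cell z).1]
  · exact ht.base
  · rw [f₂.reg _ (by decide), h₁.2]
  · rw [f₂.reg _ (by decide), f₁.reg _ (by decide), h.reg_ip]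
  · rw [f₂.arr _ (by decide), f₁.arr _ (by decide), f₂.reg _ (by decide), f₁.reg _ (by decide),
      h.reg_m, h.arr_lf]
    intro i hi j hj hij
    have e1 := arrayOf_apply (fun i => (leafAt E B i : ℕ)) ⟨i, hi⟩
    have e2 := arrayOf_apply (fun i => (leafAt E B i : ℕ)) ⟨j, hj⟩
    dsimp only at e1 e2
    rw [e1, e2] at hij
    have := E.edge.injective (B.leafOf.injective (Subtype.ext (Fin.ext hij)))
    exact congrArg Fin.val this
  · intro y
    rw [f₂.arr _ (by decide), f₂.arr _ (by decide), f₂.arr _ (by decide), f₁.arr _ (by decide),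
      f₁.arr _ (by decide), f₁.arr _ (by decide)]
    exact h.obj y
  · rw [f₂.reg _ (by decide), f₁.reg _ (by decide), h.reg_m]
  · rw [f₂.reg _ (by decide), f₁.reg _ (by decide), h.reg_m] at hl
    refine ⟨⟨by rw [f.reg _ (by decide), ht.base], by rw [f.reg _ (by decide), ht.cp],
      by rw [f.reg _ (by decide), ht.qp], by rw [f.reg _ (by decide), ht.xp],
      by rw [f.arr _ (by decide), ht.zero], by rw [f.arr _ (by decide)]; exact ht.pos⟩,
      hl.ip, fun i hi => ?_, fun y hy => ?_, fun i hi => ?_⟩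
    · have := hl.leaf i hi
      rwa [f₂.arr _ (by decide), f₁.arr _ (by decide)] at this
    · refine hl.other y fun i hi => ?_
      rw [f₂.arr _ (by decide), f₁.arr _ (by decide)]
      exact hy i hi
    · have := hl.item i hi
      rwa [f₂.arr _ (by decide), f₁.arr _ (by decide), f₂.arr _ (by decide),
        f₁.arr _ (by decide)] at this

theorem Contracted.init (F : ℕ) (hk : F + 1 = k) {s₀ s : Store} (h : Prepared d E B s₀)
    (f : Frame setup s₀ s) (ht : Tables (maxDemand d + 2) s)
    (hl : Leaves (maxDemand d + 2) s₀ s m) :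
    Contracted d E B Finset.univ id s := by
  set I := instOf d E with hI
  have hM : I.M = maxDemand d + 2 := rfl
  have hpart : ∀ i : Fin m, part (leafAt E B) id (leafAt E B i) = {(i : ℕ)} := fun i => by
    ext j
    rw [mem_part, Finset.mem_singleton]
    constructor
    · rintro ⟨h1, h2⟩
      have := E.edge.injective (B.leafOf.injective (Subtype.ext h2))
      exact congrArg Fin.val this
    · rintro rfl
      exact ⟨i.2, rfl⟩
  have hlf : ∀ i : Fin m, s₀.arr ᴀlf i = (leafAt E B i : ℕ) := fun i => by
    rw [h.arr_lf]; exact arrayOf_apply (fun i => (leafAt E B i : ℕ)) i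
  have hbp : ∀ z, s.arr ᴀbp z = 0 := fun z => by rw [f.arr _ (by decide), (h.cell z).2.1]
  have hrec : ∀ z < s.reg ʀcp, s.Rec z ∅ 1 := fun z hz => .base hz (hbp z)
  have hZ : ∀ a, 0 < a → 1 ≤ recCost (300 * I.size B.width) a := fun a ha =>
    Nat.mul_pos (by have := I.one_le_size B.width; omega) (by omega)
  have hcp := ht.cp
  -- Untouched array cells are zero, which describes an empty list with its table at cell `0`; inner
  -- nodes of the tree and the extra index `k` thus need no initialisation.
  have hempty : ∀ y Z, 1 ≤ Z → (∀ i < m, s₀.arr ᴀlf i ≠ y) → Obj I s y ∅ [] Z := by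
    intro y Z hZ hy
    obtain ⟨h1, h2, h3⟩ := hl.other y hy
    refine ⟨⟨by simp, List.nodup_nil, by simp, by simp [incCount, nbSum]⟩, by simp [h1, h2],
      by simp [h2], fun i hi => by simp at hi, by rw [h3, hcp]; simp, ?_⟩
    rw [h3]
    exact tableFor_empty ht.zero (hrec 0 (by omega)) hZ
  refine ⟨Contraction.refl B.isTree, ⟨ht.base, ?_, ?_, ?_, ?_, ?_, ?_⟩, ?_, ?_, ?_, ?_, ?_, ?_, ?_, ?_, ?_⟩
  · rw [f.reg _ (by decide), h.reg_ds]; rfl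
  · rw [f.arr _ (by decide)]; exact h.deg
  · rw [f.arr _ (by decide), h.arr_d]; exact fun _ => rfl
  · intro v
    rw [f.arr _ (by decide), (h.cell v).2.2, ht.xp]; omega
  · rw [ht.qp]; omega
  · intro z hz
    rw [ht.pos z (by omega), if_neg]
    intro hm
    obtain ⟨q, hq, rfl⟩ := List.mem_map.1 hm
    have := edgeCell_lt (M := maxDemand d + 2) (by omega) hq
    omega
  · intro y _
    by_cases hy : ∃ i, leafAt E B i = y
    · obtain ⟨i, rfl⟩ := hy
      rw [hpart]
      have hadj : G.Adj (E.fst i) (E.snd i) := by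
        have := (E.edge i).2
        rw [E.edge_eq] at this
        exact this
      have hu : I.eu i = E.fst i := instOf_eu i
      have hv : I.ev i = E.snd i := instOf_ev i
      have hne : I.eu i ≠ I.ev i := by
        rw [hu, hv]
        exact fun h => hadj.ne (Fin.ext h)
      obtain ⟨h1, h2, h3⟩ := hl.leaf i i.2
      rw [hlf] at h1 h2 h3
      have hitem := hl.item i i.2
      rw [h.arr_eu, h.arr_ev, ← hI] at hitem
      have hinc : ∀ w, I.inc {(i : ℕ)} w = (if I.eu i = w then 1 else 0) +
          (if I.ev i = w then 1 else 0) := fun w => nbSum_singleton (g := fun _ => 1)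
      have hin : ∀ w ∈ [I.eu i, I.ev i], I.inc {(i : ℕ)} w = 1 := by
        intro w hw
        simp only [List.mem_cons, List.not_mem_nil, or_false] at hw
        rw [hinc]
        rcases hw with rfl | rfl
        · simp [hne.symm]
        · simp [hne]
      have hsub : {(i : ℕ)} ⊆ Finset.range m := by simp
      refine ⟨[I.eu i, I.ev i], ⟨⟨hsub, by simp [hne], fun w hw => ?_, ?_⟩, ?_, ?_, ?_, ?_, ?_⟩, ?_, ?_⟩
      · change 0 < I.inc {(i : ℕ)} w
        rw [hin w hw]; exact one_pos
      · intro w hw hpos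
        change 0 < I.inc {(i : ℕ)} w at hpos
        simp only [List.mem_cons, List.not_mem_nil, or_false, not_or] at hw
        rw [hinc, if_neg (Ne.symm hw.1), if_neg (Ne.symm hw.2)] at hpos
        omega
      · rw [h1, h2]; rfl
      · rw [h2, hl.ip]; have := i.2; omega
      · intro j hj
        have hj' : j = 0 ∨ j = 1 := by
          simp only [List.length_cons, List.length_nil] at hj
          omega
        rcases hj' with rfl | rfl
        · rw [h1]
          change s.item (2 * i + 0) = (I.eu i, I.inc {(i : ℕ)} (I.eu i), (2 * I.M) ^ 0,
            I.M * (2 * I.M) ^ 0)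
          rw [hin _ (by simp)]
          simpa [hM] using hitem.1
        · rw [h1]
          change s.item (2 * i + 1) = (I.ev i, I.inc {(i : ℕ)} (I.ev i), (2 * I.M) ^ 1,
            I.M * (2 * I.M) ^ 1)
          rw [hin _ (by simp)]
          simpa [hM] using hitem.2
      · rw [h3, hcp, hM]
        exact le_of_eq (by simp only [List.length_cons, List.length_nil]; ring)
      · rw [h3]
        refine tableFor_edge hne (by rw [hM]; omega) I.ds_lt ht.pos (fun z hz => hrec z ?_)
          (hZ _ (fiber_pos rfl))
        rw [hcp, ← hM]; exact hz
      -- An end of a single edge has one incidence in the part, so it is in the boundary unless its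
      -- degree is one.
      · intro w hw
        have h4 : I.inc {(i : ℕ)} w ≤ I.deg w :=
          nbSum_mono (g := fun _ => 1) (v := w) hsub
        change I.inc {(i : ℕ)} w < I.deg w ∨ I.deg w = 1
        rw [hin w hw] at h4 ⊢
        omega
      · refine (Finset.card_filter_le _ _).trans ((List.toFinset_card_le _).trans ?_)
        simp
    · push Not at hy
      have hp : part (leafAt E B) id y = ∅ := by
        rw [Finset.eq_empty_iff_forall_notMem]
        intro j hj
        obtain ⟨h1, h2⟩ := mem_part.1 hj
        exact hy _ h2
      rw [hp]
      refine ⟨[], hempty y _ (hZ _ (fiber_pos rfl)) fun i hi hiy => ?_, by simp, by simp⟩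
      exact hy ⟨i, hi⟩ (Fin.ext (by rw [← hlf]; exact hiy))
  · refine hempty k 1 le_rfl fun i hi hik => ?_
    have := hlf ⟨i, hi⟩
    have := (leafAt E B ⟨i, hi⟩).2
    dsimp only at *
    omega
  · intro y
    rw [f.arr _ (by decide), h.tdeg, if_pos (Finset.mem_univ _)]
  · intro y hy
    rw [f.arr _ (by decide), h.tdeg_out y hy]
  · intro y _
    rw [f.arr _ (by decide), h.tsum]
  · exact ⟨⟨0, by omega⟩, Finset.mem_univ _, by rw [f.reg _ (by decide), h.reg_last]⟩
  · rw [f.reg _ (by decide), h.reg_k]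
  · intro j _ h1 h2
    rw [f.reg _ (by decide), h.reg_nd] at h1
    rw [f.reg _ (by decide), h.reg_x] at h2
    omega
  · left
    rw [f.reg _ (by decide), h.reg_nd]
    omega

end RAM

/-! ### The whole program. -/

namespace RAM

variable {n m k l : ℕ} {G : SimpleGraph (Fin n)} {d : Fin n → ℕ} {E : EdgeList G m}
  {B : BranchDecomposition G (Fin k)}

/-- Node `k` carries a table for the whole graph. -/
def Solved (d : Fin n → ℕ) (E : EdgeList G m) (B : BranchDecomposition G (Fin k)) (s : Store) :
    Prop :=
  Obj (instOf d E) s k (Finset.range m) []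
    (1 + recCost (300 * (instOf d E).size B.width) k + 300 * (instOf d E).size B.width)

def answer : Prog :=
  .ite (.eq (ᴀval⁅ᴀTB⁅𝐑 ʀp⁆⁆) (κ 0)) (ʀn ≔ κ 0) (recover ;; copyOut ;; ʀn ≔ κ 1)

theorem mem_outputSet {s : Store} {v : Fin n} : v ∈ outputSet n s ↔ s.arr 0 v = 1 := by
  rw [outputSet, Finset.mem_filter]
  exact and_iff_right (Finset.mem_univ v)

theorem answer_spec {s : Store} (hs : Solved d E B s) (hp : s.reg ʀp = k) (hn : s.reg ʀn = n)
    (hd : ∀ v : Fin n, d v ≤ (instOf d E).deg v + 1)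
    (hout : ∀ v : Fin n, s.arr ᴀout v = if (instOf d E).deg v = 0 then d v else 0) :
    Runs answer s (70 * (1 + recCost (300 * (instOf d E).size B.width) k +
      300 * (instOf d E).size B.width) + n * 20 + 100) (IsCorrectAnswer G d) := by
  have ht := hs.table
  refine (Runs.ite (B := 70 * (1 + recCost (300 * (instOf d E).size B.width) k +
      300 * (instOf d E).size B.width) + n * 20 + 50) (fun h => ?_) (fun h => ?_)).mono
    (by simp [Test.cost, Term.cost]; omega) (fun _ _ h => h)
  · simp only [Test.holds_eq, Term.eval_arr, Term.eval_reg, Term.eval_const, hp] at h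
    refine Runs.flat rfl (by simp [Prog.bound, Term.cost]) (Or.inr ⟨?_, ?_⟩)
    · simp [Prog.run]
    · exact not_isMultipleDominating_of_table ht h
  · simp only [Test.holds_eq, Term.eval_arr, Term.eval_reg, Term.eval_const, hp] at h
    obtain ⟨S, z, h1, h2, h3⟩ := isMinimum_of_table ht h hd
    rw [← hp] at h1
    refine ((recover_spec h1).seq fun s₁ f₁ h₁ => ((copyOut_spec s₁).le (B' := n * 20 + 10) ?_).seq fun s₂ f₂ h₂ => Runs.flat (B := 5) rfl
      (by simp [Prog.bound, Term.cost]) (Or.inl ⟨by simp [Prog.run], h3 _ fun v => ?_⟩)).mono ?_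
      (fun _ _ h => h)
    · rw [f₁.reg _ (by decide), hn]
    · omega
    · have h4 := h₂ v (by rw [f₁.reg _ (by decide), hn]; exact v.2)
      rw [h₁, hout] at h4
      rw [mem_outputSet, Prog.run, Store.setReg_arr, h4]
      by_cases g1 : (v : ℕ) ∈ S <;> by_cases g2 : (instOf d E).deg v = 0 <;> simp [g1, g2]

variable [DecidableRel B.tree.Adj]

def readInput : Prog := degLoop ;; treeLoop ;; vertLoop

theorem sup_range_arrayOf (d : Fin n → ℕ) : (Finset.range n).sup (arrayOf d) = maxDemand d := by
  refine le_antisymm (Finset.sup_le fun v hv => ?_) (Finset.sup_le fun v _ => ?_)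
  · rw [Finset.mem_range] at hv
    rw [arrayOf, dif_pos hv]
    exact Finset.le_sup (f := d) (Finset.mem_univ _)
  · rw [← arrayOf_apply d v]
    exact Finset.le_sup (f := arrayOf d) (Finset.mem_range.2 v.2)

/-- The demands can be met at every single vertex, and the isolated vertices with a demand have been
selected. -/
structure Checked (d : Fin n → ℕ) (E : EdgeList G m) (s : Store) : Prop where
  bad : s.reg ʀbad = 0 ↔ ∀ v : Fin n, d v ≤ (instOf d E).deg v + 1
  out : ∀ v : Fin n, s.arr ᴀout v = if (instOf d E).deg v = 0 then d v else 0

theorem readInput_spec (F : EdgeList B.tree l) : Runs readInput (inputStore d E B F)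
    (m * 30 + l * 60 + n * 50 + 30) (fun s => Prepared d E B s ∧ Checked d E s) := by
  set s := inputStore d E B F with hs
  refine ((degLoop_spec (s := s) fun _ => rfl).seq fun s₁ f₁ h₁ => ((treeLoop_spec (s := s₁)
    fun v => ?_).le (B' := l * 60 + 10) ?_).seq fun s₂ f₂ h₂ => (vertLoop_spec (s := s₂) (fun v => ?_) ?_ ?_).mono
    (B' := n * 50 + 10) ?_ fun s₃ f₃ h₃ => ?_).mono ?_ (fun _ _ h => h)
  · rw [f₁.arr _ (by decide), f₁.arr _ (by decide)]
    exact ⟨rfl, rfl⟩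
  · rw [f₁.reg _ (by decide)]
    exact le_rfl
  · rw [f₂.arr _ (by decide), f₁.arr _ (by decide)]
    rfl
  · rw [f₂.reg _ (by decide), f₁.reg _ (by decide)]
    rfl
  · rw [f₂.reg _ (by decide), f₁.reg _ (by decide)]
    rfl
  · rw [f₂.reg _ (by decide), f₁.reg _ (by decide)]
    exact le_rfl
  · have e1 : s₂.reg ʀn = n := by
      rw [f₂.reg _ (by decide), f₁.reg _ (by decide)]; rfl
    have e2 : s₂.arr ᴀd = arrayOf d := by
      rw [f₂.arr _ (by decide), f₁.arr _ (by decide)]; rfl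
    have e3 : ∀ v, s₂.arr ᴀdeg v = (instOf d E).deg v := fun v => by
      rw [f₂.arr _ (by decide), h₁]; rfl
    have e4 : s₁.reg ʀl = l := by rw [f₁.reg _ (by decide)]; rfl
    have e5 : s₁.arr ᴀta = arrayOf fun i => (F.fst i : ℕ) := by
      rw [f₁.arr _ (by decide)]; rfl
    have e6 : s₁.arr ᴀtb = arrayOf fun i => (F.snd i : ℕ) := by
      rw [f₁.arr _ (by decide)]; rfl
    rw [e4, e5, e6] at h₂
    obtain ⟨g1, g2, g3⟩ := h₃
    rw [e1, e2] at g1 g2 g3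
    have hr : ∀ r, r ∉ readInput.regs → s₃.reg r = s.reg r := fun r hr => by
      simp only [readInput, Prog.regs, List.mem_append, not_or] at hr
      rw [f₃.reg r hr.2.2, f₂.reg r hr.2.1, f₁.reg r hr.1]
    have ha : ∀ a, a ∉ readInput.arrs → s₃.arr a = s.arr a := fun a ha => by
      simp only [readInput, Prog.arrs, List.mem_append, not_or] at ha
      rw [f₃.arr a ha.2.2, f₂.arr a ha.2.1, f₁.arr a ha.1]
    refine ⟨⟨hr _ (by decide), hr _ (by decide), hr _ (by decide), ?_, hr _ (by decide),
      hr _ (by decide), hr _ (by decide), hr _ (by decide), ha _ (by decide), ha _ (by decide),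
      ha _ (by decide), ha _ (by decide), fun v => ?_, fun y => ?_, fun y hy => ?_, fun y => ?_,
      fun y => ?_, fun z => ?_⟩, ?_, fun v => ?_⟩
    · rw [g1, sup_range_arrayOf]
    · rw [f₃.arr _ (by decide), e3]
    · rw [f₃.arr _ (by decide), (h₂ y).1, Finset.card_eq_sum_ones]
      exact F.nbSum_range (fun _ => 1) y
    · rw [f₃.arr _ (by decide), (h₂ y).1]
      exact F.nbSum_range_of_le (fun _ => 1) hy
    · rw [f₃.arr _ (by decide), (h₂ y).2]
      exact F.nbSum_range (fun w => w) y
    · rw [ha _ (by decide), ha _ (by decide), ha _ (by decide)]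
      exact ⟨rfl, rfl, rfl⟩
    · rw [ha _ (by decide), ha _ (by decide), ha _ (by decide)]
      exact ⟨rfl, rfl, rfl⟩
    · rw [g2]
      refine ⟨fun h v => ?_, fun h v hv => ?_⟩
      · have := h v v.2
        rwa [arrayOf_apply, e3] at this
      · have := h ⟨v, hv⟩
        rw [e3, arrayOf, dif_pos hv]
        exact this
    · rw [g3, e3, arrayOf_apply]
      simp
  · change m * 30 + 10 + (l * 60 + 10 + (n * 50 + 10)) ≤ _
    omega

/-- A final join with the empty part, stored at the extra index `k`, forgets all vertices still
listed. It matters when the graph has a single edge, whose two ends would otherwise never be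
forgotten. -/
def joinAll : Prog := (ʀp ≔ 𝐑 ʀk ;; ʀx ≔ 𝐑 ʀlast) ;; joinProg

theorem joinAll_spec {y : Fin k} {own : Fin k → Fin k} {s : Store}
    (h : Contracted d E B {y} own s) (hown : ∀ z, own z = y) :
    Runs joinAll s (300000 * (instOf d E).size B.width + 10)
      (fun s' => Solved d E B s' ∧ s'.reg ʀp = k) := by
  have hpart : part (leafAt E B) own y = Finset.range m := by
    ext i
    rw [mem_part, Finset.mem_range]
    exact ⟨fun h => h.1, fun h => ⟨h, hown _⟩⟩
  have hfib : fiber own y = k := by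
    rw [fiber, Finset.filter_true_of_mem fun z _ => hown z, Finset.card_univ, Fintype.card_fin]
  have hy := Finset.mem_singleton_self y
  obtain ⟨L, h1, h2⟩ := h.obj y hy
  have hb := card_bdry_part_le (d := d) (E := E) h.tree hy
  rw [hpart] at h1 h2 hb
  rw [hfib] at h1
  obtain ⟨y', hy', hlast⟩ := h.last
  rw [Finset.mem_singleton] at hy'
  subst hy'
  have f₁ : Frame (ʀp ≔ 𝐑 ʀk ;; ʀx ≔ 𝐑 ʀlast) s _ := Prog.run_frame _ rfl s
  have e₁ := Extends.of_frame f₁ (by decide) (by decide)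
  set s₁ := Prog.run (ʀp ≔ 𝐑 ʀk ;; ʀx ≔ 𝐑 ʀlast) s with hs₁
  have p1 : s₁.reg ʀp = k := by simp [hs₁, Prog.run, h.size]
  have x1 : s₁.reg ʀx = y' := by simp [hs₁, Prog.run, hlast]
  refine (Runs.flat_seq rfl ((joinProg_runs (I := instOf d E) (b := B.width) (PA := ∅)
    (PB := Finset.range m) (LA := []) (LB := L) rfl (h.heap.of_frame f₁ (by decide) (by decide))
    (by rw [p1]; exact h.empty.mono e₁ rfl rfl rfl)
    (by rw [x1]; exact h1.mono e₁ rfl rfl rfl) (Finset.disjoint_empty_left _)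
    ⟨by simp, by simp⟩ h2 (by simp [Inst.bdry]) hb (by rw [Finset.empty_union]; exact hb)).mono le_rfl
      ?_)).mono ?_ (fun _ _ h => h)
  · rintro s' f ⟨-, ⟨L', g1, -, g2⟩, -⟩
    rw [Finset.empty_union] at g1 g2
    -- A vertex on the new list would miss an edge of the graph, but the part consists of all edges.
    have hL : L' = [] := List.eq_nil_iff_forall_not_mem.2 fun v hv => (g2 v hv).ne rfl
    rw [hL, p1] at g1
    exact ⟨g1, by rw [f.reg _ (by decide), p1]⟩
  · simp [Prog.bound, Term.cost]
    omega

def build : Prog := setup ;; contractLoop ;; joinAll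

theorem build_spec (F : EdgeList B.tree l) {s : Store} (h : Prepared d E B s) :
    Runs build s (maxDemand d * 20 + m * 100 + (k + 1) * (300000 * (instOf d E).size B.width + 300)
      + 1200) (fun s' => Solved d E B s' ∧ s'.reg ʀp = k) := by
  have hk := F.length_add_one B.isTree
  refine ((setup_spec h).seq fun s₁ f₁ h₁ => (contractLoop_spec
    (Contracted.init l hk h f₁ h₁.1 h₁.2)).seq fun s₂ f₂ ⟨y, own, h₂, ho⟩ =>
    joinAll_spec h₂ ho).mono ?_ (fun _ _ h => h)
  rw [Finset.card_univ, Fintype.card_fin]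
  ring_nf
  omega

def solve : Prog :=
  readInput ;; .ite (.eq (𝐑 ʀbad) (κ 0)) (build ;; answer) (ʀn ≔ κ 0)

theorem not_isMultipleDominating_of_deg {v : Fin n} (h : (instOf d E).deg v + 1 < d v)
    (S : Finset (Fin n)) : ¬ IsMultipleDominating G d S := fun hS => by
  have h1 := (isMultipleDominating_iff (E := E)).1 hS v
  have h2 := ind_le_one (S.map Fin.valEmbedding) v
  have h3 : nbSum (instOf d E).eu (instOf d E).ev (Finset.range m) (ind (S.map Fin.valEmbedding)) v ≤
    (instOf d E).deg v := nbSum_le_incCount (ind_le_one _)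
  omega

theorem deg_le (v : ℕ) : (instOf d E).deg v ≤ 2 * m := by
  have h : (instOf d E).deg v ≤ ∑ i ∈ Finset.range m, 2 := by
    rw [Inst.deg, Inst.inc, incCount, nbSum]
    refine Finset.sum_le_sum fun i _ => ?_
    split_ifs <;> omega
  simpa [mul_comm] using h

/-- Once the degree test has been passed, loops of length `maxDemand d` are affordable in time
linear in `m`. -/
theorem maxDemand_le (h : ∀ v : Fin n, d v ≤ (instOf d E).deg v + 1) : maxDemand d ≤ 2 * m + 1 :=
  Finset.sup_le fun v _ => (h v).trans (Nat.succ_le_succ (deg_le v))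

theorem solve_spec (F : EdgeList B.tree l) : Runs solve (inputStore d E B F)
    (100000000 * (instOf d E).size B.width * (m + n)) (IsCorrectAnswer G d) := by
  have hk := F.length_add_one B.isTree
  have hm := B.card_nodes_le E
  have hW := (instOf d E).one_le_size B.width
  set W := (instOf d E).size B.width with hWdef
  refine ((readInput_spec F).seq fun s₁ f₁ h₁ => Runs.ite (B := 200 * m + 100 + n * 20 +
    (k + 1) * (400000 * W)) (fun hb => ?_) (fun hb => ?_)).le ?_
  · have hd := h₁.2.bad.1 (by simpa using hb)
    refine ((build_spec F h₁.1).seq fun s₂ f₂ h₂ => answer_spec h₂.1 h₂.2 ?_ hd fun v => ?_).le ?_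
    · rw [f₂.reg _ (by decide), h₁.1.reg_n]
    · rw [f₂.arr _ (by decide), h₁.2.out]
    · have h1 := maxDemand_le hd
      have h2 : recCost (300 * W) k ≤ 600 * (k * W) := by
        have := Nat.mul_le_mul_left (300 * W) (Nat.sub_le (2 * k) 1)
        rw [recCost]
        calc _ ≤ _ := this
          _ = _ := by ring
      have h3 : k ≤ k * W := Nat.le_mul_of_pos_right _ hW
      rw [← hWdef]
      have e1 : (k + 1) * (300000 * W + 300) = 300000 * (k * W) + 300000 * W + 300 * k + 300 := by
        ring
      have e2 : (k + 1) * (400000 * W) = 400000 * (k * W) + 400000 * W := by ring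
      rw [e1, e2]
      omega
  · have hb' : ¬ ∀ v : Fin n, d v ≤ (instOf d E).deg v + 1 := fun h =>
      hb (by simpa using h₁.2.bad.2 h)
    push Not at hb'
    obtain ⟨v, hv⟩ := hb'
    refine Runs.flat rfl ?_ (Or.inr ⟨by simp [Prog.run], not_isMultipleDominating_of_deg hv⟩)
    simp [Prog.bound, Term.cost]
    omega
  · have e1 : (k + 1) * (400000 * W) ≤ 3 * m * (400000 * W) := Nat.mul_le_mul_right _ (by omega)
    have e2 : m ≤ m * W := Nat.le_mul_of_pos_right _ hW
    have e3 : n ≤ n * W := Nat.le_mul_of_pos_right _ hW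
    have e4 : 100000000 * W * (m + n) = 100000000 * (m * W) + 100000000 * (n * W) := by ring
    have e5 : 3 * m * (400000 * W) = 1200000 * (m * W) := by ring
    simp [Test.cost, Term.cost]
    omega

end RAM

theorem theorem3 :
    ∃ (P : RAM.Prog) (C : ℝ),
      ∀ (n m k l : ℕ) (G : SimpleGraph (Fin n)) (d : Fin n → ℕ)
        (E : EdgeList G m) (B : BranchDecomposition G (Fin k)) (F : EdgeList B.tree l),
        ∃ (t : ℕ) (s : RAM.Store),
          RAM.Exec P (inputStore d E B F) t s ∧
          IsCorrectAnswer G d s ∧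
          (t : ℝ) ≤ C * ((2 : ℝ) ^ (3 * (B.width : ℝ) / 2) *
            ((maxDemand d : ℝ) + 1) ^ (2 * B.width) *
            ((m : ℝ) + ({v : Fin n | ∀ u : Fin n, ¬ G.Adj v u}.ncard : ℝ))) := by
  classical
  refine ⟨RAM.solve, 300000000, fun n m k l G d E B F => ?_⟩
  obtain ⟨t, s, h1, h2, h3⟩ := RAM.solve_spec (d := d) (E := E) F
  refine ⟨t, s, h1, h3, ?_⟩
  have hn := E.card_le
  set n₀ := {v : Fin n | ∀ u : Fin n, ¬ G.Adj v u}.ncard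
  have h4 : t ≤ 300000000 * ((RAM.instOf d E).size B.width * (m + n₀)) := by
    refine h2.trans ?_
    -- From `n ≤ 2 * m + n₀` the sum `m + n` is at most `3 * (m + n₀)`.
    calc 100000000 * (RAM.instOf d E).size B.width * (m + n)
        ≤ 100000000 * (RAM.instOf d E).size B.width * (3 * (m + n₀)) :=
          Nat.mul_le_mul_left _ (by omega)
      _ = _ := by ring
  have h5 : (t : ℝ) ≤ 300000000 * (((RAM.instOf d E).size B.width : ℝ) * ((m : ℝ) + n₀)) := by
    exact_mod_cast h4
  refine h5.trans (mul_le_mul_of_nonneg_left (mul_le_mul_of_nonneg_right ?_ (by positivity))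
    (by norm_num))
  -- The bound was proved with the rounded exponent `3 * b / 2` of natural numbers, which is at most
  -- the real one.
  have h6 : ((2 : ℝ) ^ (3 * B.width / 2) : ℝ) ≤ (2 : ℝ) ^ (3 * (B.width : ℝ) / 2) := by
    rw [← Real.rpow_natCast]
    refine Real.rpow_le_rpow_of_exponent_le (by norm_num) ?_
    refine Nat.cast_div_le.trans ?_
    push_cast
    exact le_rfl
  have h7 : ((RAM.instOf d E).size B.width : ℝ) =
      (2 : ℝ) ^ (3 * B.width / 2) * ((maxDemand d : ℝ) + 1) ^ (2 * B.width) := by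
    rw [RAM.Inst.size]
    push_cast
    rfl
  rw [h7]
  exact mul_le_mul_of_nonneg_right h6 (by positivity)
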